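/- Let $d$ be a positive integer and let $C=(c_{ij})$ be a $d\times d$-matrix of real-valued, measurable, locally bounded functions $c_{ij}=c_{ji}$ on $\mathbf R^d$ with $C(x)\ge 0$ for almost every $x\in\mathbf R^d$. Let $W^{1,2}_0(\mathbf R^d)$ be the space of functions in $W^{1,2}(\mathbf R^d)$ with compact support, and let $h$ be the quadratic form on the real space $L_2(\mathbf R^d)$ with domain $D(h)=W^{1,2}_0(\mathbf R^d)$ and $h(\varphi)=\sum_{i,j=1}^d(\partial_i\varphi,c_{ij}\,\partial_j\varphi)$. Let $h_0$ be the relaxation of $h$, i.e. the largest closed positive quadratic form with $D(h)\subseteq D(h_0)$ and $h_0(\varphi)\le h(\varphi)$ for all $\varphi\in D(h)$ (forms are ordered by $k\le q$ if $D(q)\subseteq D(k)$ and $k(\varphi)\leq q(\varphi)$ for all $\varphi\in D(q)$). Let $H_0$ be the positive self-adjoint operator on $L_2(\mathbf R^d)$ associated with $h_0$, and let $S^{(0)}_t=e^{-tH_0}$, $t\ge 0$. For $s\ge0$ put $\nu(s)=\operatorname{ess\,sup}_{|x|\le s}\|C(x)\|$, where $\|\cdot\|$ is the operator norm of matrices,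 and $\rho(s)=\int_0^s(1+\nu(t))^{-1/2}\,dt$, and let $B_\rho(r)=\{x\in\mathbf R^d:\rho(|x|)<r\}$. Assume the Tikhonov growth condition: there are $a,b>0$ such that the Lebesgue measure of $B_\rho(r)$ satisfies $|B_\rho(r)|\le a\,e^{b r^2}$ for all large $r$. Then the relaxation $h_0$ and the semigroup $S^{(0)}$ exist, and $S^{(0)}$ is conservative, i.e. for every $t>0$ the operator $S^{(0)}_t$ extends from $L_2(\mathbf R^d)\cap L_\infty(\mathbf R^d)$ to a bounded weak* continuous operator on $L_\infty(\mathbf R^d)$, and this (unique) extension satisfies $S^{(0)}_t 1=1$. -/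

import Mathlib

open MeasureTheory Filter Topology
open scoped ENNReal NNReal

noncomputable section

namespace DegenerateElliptic

/-! ### Positive quadratic forms on a real Hilbert space

A positive quadratic form with a domain is represented by the functional `q : H → [0, ∞]` that has
the value `∞` off the domain, so `D(q) = {u | q u ≠ ∞}`.  The pointwise order `k ≤ q` then says
that `D(q) ⊆ D(k)` and that `k(u) ≤ q(u)` for all `u ∈ D(q)`. -/

section Forms

variable {H : Type*} [NormedAddCommGroup H] [InnerProductSpace ℝ H]

/-- `q` is a positive quadratic form (whose domain `{u | q u ≠ ∞}` is then a linear subspace). -/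
structure IsQuadraticForm (q : H → ℝ≥0∞) : Prop where
  smul : ∀ (c : ℝ) (u : H), q (c • u) = ENNReal.ofReal (c ^ 2) * q u
  parallelogram : ∀ u v : H, q (u + v) + q (u - v) = 2 * q u + 2 * q v

/-- `q` is a closed positive quadratic form: its domain is complete for the form norm
`(q(u) + ‖u‖²)^{1/2}`. -/
structure IsClosedForm (q : H → ℝ≥0∞) : Prop extends IsQuadraticForm q where
  closed : ∀ (u : ℕ → H) (v : H), (∀ n, q (u n) ≠ ∞) → Tendsto u atTop (𝓝 v) →
    Tendsto (fun p : ℕ × ℕ => q (u p.1 - u p.2)) atTop (𝓝 0) →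
    q v ≠ ∞ ∧ Tendsto (fun n => q (u n - v)) atTop (𝓝 0)

/-- `q₀` is the relaxation of `q`: the largest closed positive quadratic form majorized by `q`. -/
def IsRelaxation (q q₀ : H → ℝ≥0∞) : Prop :=
  IsGreatest {k : H → ℝ≥0∞ | IsClosedForm k ∧ k ≤ q} q₀

/-- The bilinear form `q(u, v)`, for `u, v` in the domain of the quadratic form `q`. -/
def polar (q : H → ℝ≥0∞) (u v : H) : ℝ :=
  ((q (u + v)).toReal - (q (u - v)).toReal) / 4

/-- The graph of the operator `A` associated with the form `q`: `u ∈ D(A)` and `A u = f`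
if and only if `u ∈ D(q)` and `q(u, v) = (f, v)` for all `v ∈ D(q)`. -/
def FormOperatorGraph (q : H → ℝ≥0∞) (u f : H) : Prop :=
  q u ≠ ∞ ∧ ∀ v : H, q v ≠ ∞ → polar q u v = inner ℝ f v

/-- `S` is the semigroup associated with the form `q`: the strongly continuous semigroup
`S_t = e^{-tA}` whose generator is `-A`, where `A` is the operator associated with `q`. -/
structure IsFormSemigroup (q : H → ℝ≥0∞) (S : ℝ≥0 → H →L[ℝ] H) : Prop where
  zero : S 0 = ContinuousLinearMap.id ℝ H
  add : ∀ s t : ℝ≥0, S (s + t) = (S s).comp (S t)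
  continuous : ∀ u : H, Continuous fun t : ℝ≥0 => S t u
  generator : ∀ u f : H, FormOperatorGraph q u f ↔
    Tendsto (fun t : ℝ≥0 => (t : ℝ)⁻¹ • (u - S t u)) (𝓝[>] 0) (𝓝 f)

end Forms

/-! ### Function spaces on `ℝᵈ` -/

/-- The Euclidean space `ℝᵈ`. -/
abbrev E (d : ℕ) : Type := EuclideanSpace ℝ (Fin d)

/-- The real space `L_p(ℝᵈ)` with respect to Lebesgue measure. -/
abbrev L (d : ℕ) (p : ℝ≥0∞) : Type := Lp ℝ p (volume : Measure (E d))

variable {d : ℕ}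

/-- `G ∈ L_2(ℝᵈ; ℝᵈ)` is the weak gradient of `u ∈ L_2(ℝᵈ)`. -/
def IsWeakGradient (u : L d 2) (G : Lp (E d) 2 (volume : Measure (E d))) : Prop :=
  ∀ η : E d → ℝ, ContDiff ℝ (⊤ : ℕ∞) η → HasCompactSupport η → ∀ i : Fin d,
    ∫ x, u x * fderiv ℝ η x (EuclideanSpace.single i 1) = -∫ x, G x i * η x

/-- `W_0^{1,2}(ℝᵈ)`: the functions in `W^{1,2}(ℝᵈ)` that have compact support. -/
def W₀ (d : ℕ) : Set (L d 2) :=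
  {u | (∃ G, IsWeakGradient u G) ∧
    ∃ K : Set (E d), IsCompact K ∧ ∀ᵐ x : E d, x ∉ K → u x = 0}

open Classical in
/-- The weak gradient `∇u` of `u ∈ W^{1,2}(ℝᵈ)` (and `0` for other `u`). -/
def weakGradient (u : L d 2) : Lp (E d) 2 (volume : Measure (E d)) :=
  if h : ∃ G, IsWeakGradient u G then h.choose else 0

/-! ### The form with coefficients `C`, and the growth condition -/

/-- The standing assumptions on the coefficients `C = (c_ij)`: the `c_ij` are real-valued,
(Lebesgue) measurable and locally bounded, and `C(x)` is symmetric and `C(x) ≥ 0` for almost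
every `x`. -/
structure IsCoefficientMatrix (C : E d → Matrix (Fin d) (Fin d) ℝ) : Prop where
  locallyBounded : ∀ i j : Fin d, ∀ K : Set (E d), IsCompact K →
    MemLp (fun x => C x i j) ∞ (volume.restrict K)
  posSemidef : ∀ᵐ x : E d, (C x).PosSemidef

open Classical in
/-- The form `h` with domain `D(h) = W_0^{1,2}(ℝᵈ)` and
`h(u) = ∑_{i,j} (∂_i u, c_ij ∂_j u)`. -/
def form (C : E d → Matrix (Fin d) (Fin d) ℝ) (u : L d 2) : ℝ≥0∞ :=
  if u ∈ W₀ d then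
    ENNReal.ofReal (∑ i, ∑ j, ∫ x, weakGradient u x i * (C x i j * weakGradient u x j))
  else ∞

/-- `ν(s) = ess sup_{|x| ≤ s} ‖C(x)‖`, with the operator norm of the matrix `C(x)` on `ℝᵈ`. -/
def nu (C : E d → Matrix (Fin d) (Fin d) ℝ) (s : ℝ) : ℝ :=
  (essSup (fun x => ‖Matrix.toEuclideanCLM (𝕜 := ℝ) (C x)‖ₑ)
    (volume.restrict (Metric.closedBall (0 : E d) s))).toReal

/-- `ρ(s) = ∫_0^s (1 + ν(t))^{-1/2} dt`. -/
def rho (C : E d → Matrix (Fin d) (Fin d) ℝ) (s : ℝ) : ℝ :=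
  ∫ t in (0 : ℝ)..s, (1 + nu C t) ^ (-(1 / 2) : ℝ)

/-- The balls `B_ρ(r) = {x | ρ(|x|) < r}`. -/
def rhoBall (C : E d → Matrix (Fin d) (Fin d) ℝ) (r : ℝ) : Set (E d) :=
  {x | rho C ‖x‖ < r}

/-- The Tikhonov growth condition: `|B_ρ(r)| ≤ a e^{b r²}` for all large `r`. -/
def TikhonovGrowth (C : E d → Matrix (Fin d) (Fin d) ℝ) : Prop :=
  ∃ a b : ℝ, 0 < a ∧ 0 < b ∧ ∀ᶠ r : ℝ in atTop,
    volume (rhoBall C r) ≤ ENNReal.ofReal (a * Real.exp (b * r ^ 2))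

/-! ### Conservative semigroups -/

/-- `T` is the extension of the bounded operator `A` on `L_2(ℝᵈ)` to `L_∞(ℝᵈ)`: it agrees with
`A` on `L_2 ∩ L_∞` and it is weak* continuous, i.e. it is the adjoint of a map `L_1 → L_1`.
There is at most one such `T`, because `L_2 ∩ L_∞` is weak* dense in `L_∞`. -/
structure IsLinftyExtension (A : L d 2 →L[ℝ] L d 2) (T : L d ∞ →L[ℝ] L d ∞) : Prop where
  agrees : ∀ (u : L d 2) (f : L d ∞), u =ᵐ[volume] f → A u =ᵐ[volume] T f
  weakStar : ∀ g : L d 1, ∃ g' : L d 1, ∀ f : L d ∞,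
    ∫ x, T f x * g x = ∫ x, f x * g' x

/-- The constant function `1` as an element of `L_∞(ℝᵈ)`. -/
def oneLinfty (d : ℕ) : L d ∞ := MemLp.toLp (fun _ : E d => (1 : ℝ)) (memLp_top_const 1)

/-- `S` is conservative: each `S_t`, `t > 0`, extends to `L_∞(ℝᵈ)`, and `S_t 1 = 1`. -/
def IsConservative (S : ℝ≥0 → L d 2 →L[ℝ] L d 2) : Prop :=
  ∀ t : ℝ≥0, 0 < t →
    ∃ T : L d ∞ →L[ℝ] L d ∞, IsLinftyExtension (S t) T ∧ T (oneLinfty d) = oneLinfty d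

end DegenerateElliptic

end

open MeasureTheory Filter Topology
open scoped ENNReal NNReal

noncomputable section

namespace DegenerateElliptic

/-! ### Quadratic forms: bilinearity of the polar form -/

section QuadraticForms

set_option linter.unusedSectionVars false

variable {H : Type*} [NormedAddCommGroup H] [InnerProductSpace ℝ H] {q : H → ℝ≥0∞}

/-! The form h may fail to be closable, so its relaxation has no integral formula, and every
estimate has to be phrased so that it survives a limit of energies.

Relaxation. A positive quadratic form is closed exactly when it is lower semicontinuous, so a
relaxation is a lower semicontinuous envelope. Here it is the envelope of `lipForm`, the energy on
compactly supported Lipschitz functions. These have gradients almost everywhere and are stable under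
normal contractions and under multiplication by bounded Lipschitz weights. Mollification
(`lscEnvelope_lipForm_le`) shows that the smaller domain gives the same envelope. Along a sequence
whose energies converge to the envelope, the polar form converges against any L_2-convergent
sequence of bounded energy (`tendsto_polar_lscEnvelope`).

Semigroup. It is the limit of the exponentials of the Yosida approximations
(`exists_formSemigroup`). Normal contractions do not increase the energy, hence not the envelope,
and so the semigroup preserves the closed convex sets onto which they project
(`norm_sub_projection_le`). Therefore S_t is positive and contractive for the L_∞-norm. By symmetry
it is also contractive for the L_1-norm, which yields the weak* continuous extension
(`exists_isLinftyExtension`).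

Conservation. This is a Davies–Gaffney argument. The function ρ(|x|) has energy density at most 1.
For U = S_t u, a truncation m of ρ and w = e^{2αm}, the weighted norm F = (U, wU) satisfies F' ≤
4α²F. The derivative of (U, χ), for a cut-off χ, is controlled by the energy term in F' plus the
integral of w⁻¹ times the energy density of χ. Adding a small multiple of F to ±(U, χ) absorbs the
energy (`abs_inner_semigroup_sub_le`). The density of χ lives where ρ lies between n and n + 1,
where w = e^{2αn}, and the volume there is at most of order e^{b(n+2)²}. For times below 1/(8b) the
parameters can be chosen so that all errors vanish as n → ∞ (`tendsto_inner_cutoff_sub`). Hence S_t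
1 = 1 for small t, and the semigroup law gives every t. -/

theorem polar_comm (hq : IsQuadraticForm q) (u v : H) : polar q u v = polar q v u := by
  have h : q (u - v) = q (v - u) := by
    have := hq.smul (-1) (v - u)
    simpa using this
  rw [polar, polar, add_comm u v, h]

namespace IsQuadraticForm

theorem map_zero (hq : IsQuadraticForm q) : q 0 = 0 := by
  simpa using hq.smul 0 0

theorem map_neg (hq : IsQuadraticForm q) (u : H) : q (-u) = q u := by
  simpa using hq.smul (-1) u

theorem smul_ne_top (hq : IsQuadraticForm q) (c : ℝ) {u : H} (hu : q u ≠ ∞) : q (c • u) ≠ ∞ := by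
  rw [hq.smul]
  exact ENNReal.mul_ne_top ENNReal.ofReal_ne_top hu

theorem add_ne_top (hq : IsQuadraticForm q) {u v : H} (hu : q u ≠ ∞) (hv : q v ≠ ∞) :
    q (u + v) ≠ ∞ := by
  refine ne_top_of_le_ne_top ?_ (le_self_add.trans (hq.parallelogram u v).le)
  finiteness

theorem sub_ne_top (hq : IsQuadraticForm q) {u v : H} (hu : q u ≠ ∞) (hv : q v ≠ ∞) :
    q (u - v) ≠ ∞ := by
  rw [sub_eq_add_neg]
  exact hq.add_ne_top hu (by rwa [hq.map_neg])

theorem toReal_smul (hq : IsQuadraticForm q) (c : ℝ) (u : H) :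
    (q (c • u)).toReal = c ^ 2 * (q u).toReal := by
  rw [hq.smul, ENNReal.toReal_mul, ENNReal.toReal_ofReal (sq_nonneg c)]

theorem toReal_parallelogram (hq : IsQuadraticForm q) {u v : H} (hu : q u ≠ ∞) (hv : q v ≠ ∞) :
    (q (u + v)).toReal + (q (u - v)).toReal = 2 * (q u).toReal + 2 * (q v).toReal := by
  have := congrArg ENNReal.toReal (hq.parallelogram u v)
  rwa [ENNReal.toReal_add (hq.add_ne_top hu hv) (hq.sub_ne_top hu hv),
    ENNReal.toReal_add (by finiteness) (by finiteness), ENNReal.toReal_mul,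
    ENNReal.toReal_mul, ENNReal.toReal_ofNat] at this

theorem polar_self (hq : IsQuadraticForm q) (u : H) : polar q u u = (q u).toReal := by
  have : (q (u + u)).toReal = 4 * (q u).toReal := by
    rw [← two_smul ℝ u, hq.toReal_smul]; norm_num
  rw [polar, this, sub_self, hq.map_zero]
  simp

/-- Jordan–von Neumann. The parallelogram law for x + z, y + z and for x - z, y - z has the same
difference term x - y, which cancels on subtraction. What remains is additivity up to the midpoint,
and the pair x + y, 0 removes the midpoint. -/
theorem polar_add_left (hq : IsQuadraticForm q) {x y z : H} (hx : q x ≠ ∞) (hy : q y ≠ ∞)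
    (hz : q z ≠ ∞) : polar q (x + y) z = polar q x z + polar q y z := by
  have key : ∀ {x y : H}, q x ≠ ∞ → q y ≠ ∞ →
      polar q x z + polar q y z = 2 * polar q ((2⁻¹ : ℝ) • (x + y)) z := by
    intro x y hx hy
    have h1 := hq.toReal_parallelogram (hq.add_ne_top hx hz) (hq.add_ne_top hy hz)
    have h2 := hq.toReal_parallelogram (hq.sub_ne_top hx hz) (hq.sub_ne_top hy hz)
    have e1 : x + z + (y + z) = (2 : ℝ) • ((2⁻¹ : ℝ) • (x + y) + z) := by
      simp only [smul_add, smul_smul]; norm_num; rw [two_smul]; abel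
    have e2 : x - z + (y - z) = (2 : ℝ) • ((2⁻¹ : ℝ) • (x + y) - z) := by
      simp only [smul_add, smul_sub, smul_smul]; norm_num; rw [two_smul]; abel
    rw [e1, hq.toReal_smul, add_sub_add_right_eq_sub] at h1
    rw [e2, hq.toReal_smul, sub_sub_sub_cancel_right] at h2
    simp only [polar]
    linarith
  have h0 : polar q (0 : H) z = 0 := by simp [polar, hq.map_neg]
  have h1 := key hx hy
  have h2 := key (hq.add_ne_top hx hy) (by rw [hq.map_zero]; simp : q (0 : H) ≠ ∞)
  rw [h0, add_zero, add_zero] at h2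
  rw [h2, h1]

theorem abs_polar_le (hq : IsQuadraticForm q) {u v : H} (hu : q u ≠ ∞) (hv : q v ≠ ∞) :
    |polar q u v| ≤ ((q u).toReal + (q v).toReal) / 2 := by
  have h := hq.toReal_parallelogram hu hv
  have h1 : 0 ≤ (q (u + v)).toReal := ENNReal.toReal_nonneg
  have h2 : 0 ≤ (q (u - v)).toReal := ENNReal.toReal_nonneg
  rw [polar, abs_le]
  constructor <;> linarith

/-- As a function of c the left side is additive and bounded on [-1, 1]; an additive real function
with this property is continuous, hence linear. -/
theorem polar_smul_left (hq : IsQuadraticForm q) (c : ℝ) {x z : H} (hx : q x ≠ ∞)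
    (hz : q z ≠ ∞) : polar q (c • x) z = c * polar q x z := by
  let f : ℝ →+ ℝ :=
    { toFun := fun c => polar q (c • x) z
      map_zero' := by simp [polar, hq.map_neg]
      map_add' := fun a b => by
        rw [add_smul, hq.polar_add_left (hq.smul_ne_top a hx) (hq.smul_ne_top b hx) hz] }
  have hf : Continuous f := by
    refine f.continuous_of_isBounded_nhds_zero (s := Metric.closedBall 0 1)
      (Metric.closedBall_mem_nhds _ one_pos) ?_
    refine (Metric.isBounded_closedBall (x := (0 : ℝ))
      (r := ((q x).toReal + (q z).toReal) / 2)).subset ?_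
    rintro _ ⟨a, ha, rfl⟩
    rw [mem_closedBall_zero_iff, Real.norm_eq_abs] at ha ⊢
    refine (hq.abs_polar_le (hq.smul_ne_top a hx) hz).trans ?_
    rw [hq.toReal_smul]
    have : a ^ 2 ≤ 1 := by rw [← sq_abs]; exact pow_le_one₀ (abs_nonneg a) ha
    have h0 : 0 ≤ (q x).toReal := ENNReal.toReal_nonneg
    nlinarith
  have := map_real_smul f hf c 1
  simpa [f] using this

theorem polar_neg_left (hq : IsQuadraticForm q) {x z : H} (hx : q x ≠ ∞) (hz : q z ≠ ∞) :
    polar q (-x) z = -polar q x z := by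
  simpa using hq.polar_smul_left (-1) hx hz

theorem polar_sub_left (hq : IsQuadraticForm q) {x y z : H} (hx : q x ≠ ∞) (hy : q y ≠ ∞)
    (hz : q z ≠ ∞) : polar q (x - y) z = polar q x z - polar q y z := by
  rw [sub_eq_add_neg, hq.polar_add_left hx (by rwa [hq.map_neg]) hz, hq.polar_neg_left hy hz,
    sub_eq_add_neg]

theorem toReal_add (hq : IsQuadraticForm q) {u v : H} (hu : q u ≠ ∞) (hv : q v ≠ ∞) :
    (q (u + v)).toReal = (q u).toReal + 2 * polar q u v + (q v).toReal := by
  have := hq.toReal_parallelogram hu hv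
  rw [polar]
  linarith

theorem toReal_add_smul (hq : IsQuadraticForm q) (c : ℝ) {u v : H} (hu : q u ≠ ∞)
    (hv : q v ≠ ∞) :
    (q (u + c • v)).toReal = (q u).toReal + 2 * c * polar q u v + c ^ 2 * (q v).toReal := by
  rw [hq.toReal_add hu (hq.smul_ne_top c hv), polar_comm hq, hq.polar_smul_left c hv hu,
    polar_comm hq, hq.toReal_smul]
  ring

end IsQuadraticForm

/-! ### The lower semicontinuous envelope -/

/-- The lower semicontinuous envelope of a functional. -/
def lscEnvelope (q : H → ℝ≥0∞) (u : H) : ℝ≥0∞ := liminf q (𝓝 u)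

theorem le_of_lowerSemicontinuous_of_tendsto {X : Type*} [TopologicalSpace X] {k : X → ℝ≥0∞}
    (hk : LowerSemicontinuous k) {x : ℕ → X} {y : X} (hx : Tendsto x atTop (𝓝 y))
    {c : ℕ → ℝ≥0∞} {a : ℝ≥0∞} (hc : Tendsto c atTop (𝓝 a)) (h : ∀ n, k (x n) ≤ c n) :
    k y ≤ a := by
  by_contra! hlt
  obtain ⟨z, haz, hzk⟩ := exists_between hlt
  obtain ⟨n, h1, h2⟩ := ((hx.eventually (hk y z hzk)).and (hc.eventually_lt_const haz)).exists
  exact (h1.trans_le (h n)).not_gt h2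

theorem lowerSemicontinuous_lscEnvelope (q : H → ℝ≥0∞) :
    LowerSemicontinuous (lscEnvelope q) := by
  intro u y hy
  obtain ⟨z, hyz, hz⟩ := exists_between hy
  have h := eventually_lt_of_lt_liminf hz
  filter_upwards [eventually_eventually_nhds.2 h] with w hw
  exact hyz.trans_le (le_liminf_of_le (by isBoundedDefault) (hw.mono fun _ hx => hx.le))

theorem lscEnvelope_le (q : H → ℝ≥0∞) : lscEnvelope q ≤ q := fun u =>
  le_of_forall_lt fun _ hc => (eventually_lt_of_lt_liminf hc).self_of_nhds

theorem le_lscEnvelope {k q : H → ℝ≥0∞} (hk : LowerSemicontinuous k) (hkq : k ≤ q) :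
    k ≤ lscEnvelope q := fun u =>
  (lowerSemicontinuousAt_iff_le_liminf.1 (hk u)).trans
    (liminf_le_liminf (Eventually.of_forall hkq))

/-- A recovery sequence: points within 1/(n+1) of u whose values exceed the liminf by less than
1/(n+1). Properties of q are transferred to the envelope along such sequences. -/
theorem exists_tendsto_lscEnvelope {q : H → ℝ≥0∞} {u : H} (hu : lscEnvelope q u ≠ ∞) :
    ∃ v : ℕ → H, (∀ n, q (v n) ≠ ∞) ∧ Tendsto v atTop (𝓝 u) ∧
      Tendsto (fun n => q (v n)) atTop (𝓝 (lscEnvelope q u)) := by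
  have h : ∀ n : ℕ, ∃ v ∈ Metric.ball u (1 / ((n : ℝ) + 1)),
      q v < lscEnvelope q u + ((n : ℝ≥0∞) + 1)⁻¹ := by
    intro n
    have hlt : liminf q (𝓝 u) < lscEnvelope q u + ((n : ℝ≥0∞) + 1)⁻¹ :=
      ENNReal.lt_add_right hu (ENNReal.inv_ne_zero.2 (by finiteness))
    have := (frequently_lt_of_liminf_lt (by isBoundedDefault) hlt).and_eventually
      (Metric.ball_mem_nhds u (Nat.one_div_pos_of_nat (n := n)))
    obtain ⟨v, h1, h2⟩ := this.exists
    exact ⟨v, h2, h1⟩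
  choose v hv hqv using h
  have hvu : Tendsto v atTop (𝓝 u) :=
    tendsto_iff_dist_tendsto_zero.2 (squeeze_zero (fun _ => dist_nonneg)
      (fun n => (Metric.mem_ball.1 (hv n)).le) tendsto_one_div_add_atTop_nhds_zero_nat)
  refine ⟨v, fun n => (hqv n).ne_top, hvu, ?_⟩
  refine tendsto_of_le_liminf_of_limsup_le ?_ ?_
  · have : liminf q (𝓝 u) ≤ liminf q (map v atTop) := liminf_le_liminf_of_le hvu
    exact this
  · have h1 : Tendsto (fun n : ℕ => lscEnvelope q u + ((n : ℝ≥0∞) + 1)⁻¹) atTop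
        (𝓝 (lscEnvelope q u + 0)) := by
      refine tendsto_const_nhds.add ?_
      have := (tendsto_add_atTop_iff_nat 1).2 ENNReal.tendsto_inv_nat_nhds_zero
      simpa using this
    rw [add_zero] at h1
    rw [← h1.limsup_eq]
    exact limsup_le_limsup (Eventually.of_forall fun n => (hqv n).le)

theorem lscEnvelope_smul_le (hq : IsQuadraticForm q) (c : ℝ) (u : H) :
    lscEnvelope q (c • u) ≤ ENNReal.ofReal (c ^ 2) * lscEnvelope q u := by
  rcases eq_or_ne c 0 with rfl | hc
  · rw [zero_smul]
    exact (lscEnvelope_le q 0).trans (by simp [hq.map_zero])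
  by_cases hu : lscEnvelope q u = ∞
  · rw [hu, ENNReal.mul_top (by simp; positivity)]
    exact le_top
  obtain ⟨v, -, hv, hqv⟩ := exists_tendsto_lscEnvelope hu
  exact le_of_lowerSemicontinuous_of_tendsto (lowerSemicontinuous_lscEnvelope q)
    (hv.const_smul c) (ENNReal.Tendsto.const_mul hqv (Or.inr ENNReal.ofReal_ne_top))
    fun n => (lscEnvelope_le q _).trans (hq.smul c (v n)).le

/-- Recovery sequences for u and v give one inequality of the parallelogram law. The reverse is the
same inequality for u + v and u - v, by homogeneity. -/
theorem isQuadraticForm_lscEnvelope (hq : IsQuadraticForm q) :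
    IsQuadraticForm (lscEnvelope q) := by
  have hsmul : ∀ (c : ℝ) (u : H),
      lscEnvelope q (c • u) = ENNReal.ofReal (c ^ 2) * lscEnvelope q u := by
    intro c u
    refine le_antisymm (lscEnvelope_smul_le hq c u) ?_
    rcases eq_or_ne c 0 with rfl | hc
    · simp
    have := lscEnvelope_smul_le hq c⁻¹ (c • u)
    rw [smul_smul, inv_mul_cancel₀ hc, one_smul] at this
    calc ENNReal.ofReal (c ^ 2) * lscEnvelope q u
        ≤ ENNReal.ofReal (c ^ 2) * (ENNReal.ofReal (c⁻¹ ^ 2) * lscEnvelope q (c • u)) := by gcongr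
      _ = lscEnvelope q (c • u) := by
        rw [← mul_assoc, ← ENNReal.ofReal_mul (sq_nonneg c), ← mul_pow, mul_inv_cancel₀ hc]
        simp
  have hle : ∀ u v : H, lscEnvelope q (u + v) + lscEnvelope q (u - v) ≤
      2 * lscEnvelope q u + 2 * lscEnvelope q v := by
    intro u v
    by_cases hu : lscEnvelope q u = ∞
    · simp [hu]
    by_cases hv : lscEnvelope q v = ∞
    · simp [hv]
    obtain ⟨a, -, ha, hqa⟩ := exists_tendsto_lscEnvelope hu
    obtain ⟨b, -, hb, hqb⟩ := exists_tendsto_lscEnvelope hv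
    have hl := lowerSemicontinuous_lscEnvelope q
    have hl2 : LowerSemicontinuous fun p : H × H => lscEnvelope q p.1 + lscEnvelope q p.2 :=
      (hl.comp continuous_fst).add (hl.comp continuous_snd)
    refine le_of_lowerSemicontinuous_of_tendsto hl2 (y := (u + v, u - v))
      ((ha.add hb).prodMk_nhds (ha.sub hb))
      ((ENNReal.Tendsto.const_mul hqa (Or.inr ENNReal.ofNat_ne_top)).add
        (ENNReal.Tendsto.const_mul hqb (Or.inr ENNReal.ofNat_ne_top))) fun n => ?_
    rw [← hq.parallelogram]
    exact add_le_add (lscEnvelope_le q _) (lscEnvelope_le q _)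
  refine ⟨hsmul, fun u v => le_antisymm (hle u v) ?_⟩
  have h := hle (u + v) (u - v)
  have e1 : u + v + (u - v) = (2 : ℝ) • u := by rw [two_smul]; abel
  have e2 : u + v - (u - v) = (2 : ℝ) • v := by rw [two_smul]; abel
  rw [e1, e2, hsmul, hsmul, ← mul_add, ← mul_add] at h
  have e3 : ENNReal.ofReal (2 ^ 2) = 2 * 2 := by
    rw [sq, ENNReal.ofReal_mul (by norm_num)]; norm_num
  rw [e3, mul_assoc] at h
  rw [← mul_add]
  exact (ENNReal.mul_le_mul_iff_right (by norm_num) (by norm_num)).1 h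

theorem isClosedForm_of_lowerSemicontinuous (hq : IsQuadraticForm q)
    (hl : LowerSemicontinuous q) : IsClosedForm q := by
  refine ⟨hq, fun u v hu huv hc => ?_⟩
  have key : ∀ ε : ℝ≥0∞, 0 < ε → ∀ᶠ n in atTop, q (u n - v) ≤ ε := by
    intro ε hε
    have h := hc.eventually_le_const hε
    rw [← prod_atTop_atTop_eq] at h
    -- With n fixed, letting m → ∞ in q(u n - u m) ≤ ε gives q(u n - v) ≤ ε by lower semicontinuity.
    have h' := h.curry
    filter_upwards [h'] with n hn
    by_contra! hlt
    have h1 : Tendsto (fun m => u n - u m) atTop (𝓝 (u n - v)) := tendsto_const_nhds.sub huv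
    obtain ⟨m, h2, h3⟩ := ((h1.eventually (hl _ _ hlt)).and hn).exists
    exact h2.not_ge h3
  have hlim : Tendsto (fun n => q (u n - v)) atTop (𝓝 0) :=
    ENNReal.tendsto_nhds_zero.2 key
  refine ⟨?_, hlim⟩
  obtain ⟨n, hn⟩ := (key 1 one_pos).exists
  have := hq.sub_ne_top (hu n) (ne_top_of_le_ne_top ENNReal.one_ne_top hn)
  simpa using this

/-- Midpoints of a recovery sequence also converge to u, so their energies are asymptotically at
least the liminf c. The parallelogram law then forces the sequence to be Cauchy for the form, and
closedness identifies the limit. -/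
theorem lowerSemicontinuous_of_isClosedForm (hq : IsClosedForm q) : LowerSemicontinuous q := by
  rw [lowerSemicontinuous_iff_le_liminf]
  intro u
  change q u ≤ lscEnvelope q u
  by_cases htop : lscEnvelope q u = ∞
  · simp [htop]
  have hQ := hq.toIsQuadraticForm
  obtain ⟨v, hv, hvu, hqv⟩ := exists_tendsto_lscEnvelope htop
  set c := lscEnvelope q u with hc
  have hqv' : Tendsto (fun n => (q (v n)).toReal) atTop (𝓝 c.toReal) :=
    (ENNReal.tendsto_toReal htop).comp hqv
  have hcauchy : Tendsto (fun p : ℕ × ℕ => q (v p.1 - v p.2)) atTop (𝓝 0) := by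
    rw [ENNReal.tendsto_nhds_zero]
    intro ε hε
    -- The 8 is 4(c + δ) - 4(c - δ) = 8δ in the parallelogram law for v p.1 and v p.2.
    obtain ⟨δ, hδ, hδε⟩ : ∃ δ : ℝ, 0 < δ ∧ ENNReal.ofReal (8 * δ) ≤ ε := by
      rcases eq_or_ne ε ∞ with rfl | h
      · exact ⟨1, one_pos, le_top⟩
      · refine ⟨ε.toReal / 8, by have := ENNReal.toReal_pos hε.ne' h; positivity, ?_⟩
        rw [mul_div_cancel₀ _ (by norm_num), ENNReal.ofReal_toReal h]
    have hlow : ∀ᶠ w in 𝓝 u, q w ≠ ∞ → c.toReal - δ < (q w).toReal := by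
      by_cases hcδ : c.toReal - δ < 0
      · exact Eventually.of_forall fun w _ => hcδ.trans_le ENNReal.toReal_nonneg
      push Not at hcδ
      have hlt : ENNReal.ofReal (c.toReal - δ) < liminf q (𝓝 u) := by
        change _ < c
        rw [ENNReal.ofReal_lt_iff_lt_toReal hcδ htop]
        linarith
      filter_upwards [eventually_lt_of_lt_liminf hlt] with w hw hw'
      exact (ENNReal.ofReal_lt_iff_lt_toReal hcδ hw').1 hw
    have hmid : Tendsto (fun p : ℕ × ℕ => (2⁻¹ : ℝ) • (v p.1 + v p.2)) atTop (𝓝 u) := by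
      rw [← prod_atTop_atTop_eq]
      have := ((hvu.comp tendsto_fst).add (hvu.comp tendsto_snd)
        : Tendsto (fun p : ℕ × ℕ => v p.1 + v p.2) (atTop ×ˢ atTop) (𝓝 (u + u))).const_smul
          (2⁻¹ : ℝ)
      rwa [← two_smul ℝ u, smul_smul, inv_mul_cancel₀ two_ne_zero, one_smul] at this
    have hup := hqv'.eventually_lt_const (show c.toReal < c.toReal + δ by linarith)
    have hup1 : ∀ᶠ p : ℕ × ℕ in atTop, (q (v p.1)).toReal < c.toReal + δ := by
      rw [← prod_atTop_atTop_eq]; exact tendsto_fst.eventually hup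
    have hup2 : ∀ᶠ p : ℕ × ℕ in atTop, (q (v p.2)).toReal < c.toReal + δ := by
      rw [← prod_atTop_atTop_eq]; exact tendsto_snd.eventually hup
    filter_upwards [hmid.eventually hlow, hup1, hup2] with p h1 h2 h3
    have h4 := h1 (hQ.smul_ne_top _ (hQ.add_ne_top (hv _) (hv _)))
    rw [hQ.toReal_smul] at h4
    have h5 := hQ.toReal_parallelogram (hv p.1) (hv p.2)
    refine le_trans ?_ hδε
    rw [ENNReal.le_ofReal_iff_toReal_le (hQ.sub_ne_top (hv _) (hv _)) (by positivity)]
    linarith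
  obtain ⟨hu, hlim⟩ := hq.closed v u hv hvu hcauchy
  have hlim' : Tendsto (fun n => (q (v n - u)).toReal) atTop (𝓝 0) := by
    exact (ENNReal.tendsto_toReal ENNReal.zero_ne_top).comp hlim
  rw [← ENNReal.toReal_le_toReal hu htop]
  -- Young's inequality with parameter s, from q(v n + s⁻¹(v n - u)) ≥ 0. The limit n → ∞ kills the
  -- last term; afterwards s → 0.
  have hbound : ∀ s : ℝ, 0 < s → (q u).toReal ≤ (1 + s) * c.toReal := by
    intro s hs
    have hle : ∀ n, (q u).toReal ≤
        (1 + s) * (q (v n)).toReal + (1 + s⁻¹) * (q (v n - u)).toReal := by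
      intro n
      have hd := hQ.sub_ne_top (hv n) hu
      have e : u = v n + (-1 : ℝ) • (v n - u) := by simp
      have h1 := hQ.toReal_add_smul (-1) (hv n) hd
      rw [← e] at h1
      have h2 := hQ.toReal_add_smul s⁻¹ (hv n) hd
      have h3 : 0 ≤ (q (v n + s⁻¹ • (v n - u))).toReal := ENNReal.toReal_nonneg
      rw [h2] at h3
      have h4 := mul_nonneg hs.le h3
      have h5 : s * ((q (v n)).toReal + 2 * s⁻¹ * polar q (v n) (v n - u) +
          s⁻¹ ^ 2 * (q (v n - u)).toReal) = s * (q (v n)).toReal +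
          2 * polar q (v n) (v n - u) + s⁻¹ * (q (v n - u)).toReal := by
        field_simp
      rw [h5] at h4
      linarith
    have := (hqv'.const_mul (1 + s)).add (hlim'.const_mul (1 + s⁻¹))
    rw [mul_zero, add_zero] at this
    exact ge_of_tendsto' this hle
  have hcont : Tendsto (fun s : ℝ => (1 + s) * c.toReal) (𝓝[>] 0) (𝓝 ((1 + 0) * c.toReal)) :=
    ((tendsto_const_nhds.add tendsto_id).mul_const _).mono_left nhdsWithin_le_nhds
  rw [add_zero, one_mul] at hcont
  exact ge_of_tendsto hcont (eventually_mem_nhdsWithin.mono hbound)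

/-- If the envelope of `k` lies below `q ≤ k`, then it is the relaxation of `q`. -/
theorem isRelaxation_lscEnvelope {k : H → ℝ≥0∞} (hk : IsQuadraticForm k) (hqk : q ≤ k)
    (hkq : lscEnvelope k ≤ q) : IsRelaxation q (lscEnvelope k) :=
  ⟨⟨isClosedForm_of_lowerSemicontinuous (isQuadraticForm_lscEnvelope hk)
    (lowerSemicontinuous_lscEnvelope k), hkq⟩,
    fun _ hp => le_lscEnvelope (lowerSemicontinuous_of_isClosedForm hp.1) (hp.2.trans hqk)⟩

/-- Convergence of the polar form along a recovery sequence. -/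
theorem tendsto_polar_lscEnvelope (hq : IsQuadraticForm q) {u v : H} {a b : ℕ → H}
    (ha : Tendsto a atTop (𝓝 u)) (hqa : Tendsto (fun n => q (a n)) atTop (𝓝 (lscEnvelope q u)))
    (hfin : ∀ n, q (a n) ≠ ∞) (hu : lscEnvelope q u ≠ ∞)
    (hb : Tendsto b atTop (𝓝 v)) {M : ℝ} (hM : ∀ n, q (b n) ≤ ENNReal.ofReal M) :
    lscEnvelope q v ≠ ∞ ∧
      Tendsto (fun n => polar q (a n) (b n)) atTop (𝓝 (polar (lscEnvelope q) u v)) := by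
  have hl := lowerSemicontinuous_lscEnvelope q
  have hE := isQuadraticForm_lscEnvelope hq
  have hbfin : ∀ n, q (b n) ≠ ∞ := fun n => ne_top_of_le_ne_top ENNReal.ofReal_ne_top (hM n)
  have hv : lscEnvelope q v ≠ ∞ := ne_top_of_le_ne_top ENNReal.ofReal_ne_top
    (le_of_lowerSemicontinuous_of_tendsto hl hb tendsto_const_nhds
      fun n => (lscEnvelope_le q _).trans (hM n))
  refine ⟨hv, ?_⟩
  have hM0 : ∀ n, (q (b n)).toReal ≤ max M 0 := fun n => by
    refine ENNReal.toReal_le_of_le_ofReal (le_max_right _ _)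
      ((hM n).trans (ENNReal.ofReal_le_ofReal (le_max_left _ _)))
  set N := max M 0
  have hqa' : Tendsto (fun n => (q (a n)).toReal) atTop (𝓝 (lscEnvelope q u).toReal) :=
    (ENNReal.tendsto_toReal hu).comp hqa
  -- Expand q(a n + s b n): lower semicontinuity bounds it below in the limit, and the energies of a
  -- n converge. Only an error of order s²N remains, against a main term linear in s. Both signs of
  -- s give the two-sided bound.
  have key : ∀ s : ℝ, ∀ δ : ℝ, 0 < δ → ∀ᶠ n in atTop,
      2 * s * polar (lscEnvelope q) u v - δ - s ^ 2 * N ≤ 2 * s * polar q (a n) (b n) := by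
    intro s δ hδ
    have hconv : Tendsto (fun n => a n + s • b n) atTop (𝓝 (u + s • v)) :=
      ha.add (hb.const_smul s)
    have hne : lscEnvelope q (u + s • v) ≠ ∞ := hE.add_ne_top hu (hE.smul_ne_top s hv)
    have hlow : ∀ᶠ n in atTop, (lscEnvelope q (u + s • v)).toReal - δ / 2 <
        (q (a n + s • b n)).toReal := by
      by_cases hneg : (lscEnvelope q (u + s • v)).toReal - δ / 2 < 0
      · exact Eventually.of_forall fun n => hneg.trans_le ENNReal.toReal_nonneg
      push Not at hneg
      have hlt : ENNReal.ofReal ((lscEnvelope q (u + s • v)).toReal - δ / 2) <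
          lscEnvelope q (u + s • v) := by
        rw [ENNReal.ofReal_lt_iff_lt_toReal hneg hne]; linarith
      filter_upwards [hconv.eventually (hl _ _ hlt)] with n hn
      have hfin' := hq.add_ne_top (hfin n) (hq.smul_ne_top s (hbfin n))
      exact (ENNReal.ofReal_lt_iff_lt_toReal hneg hfin').1
        (hn.trans_le (lscEnvelope_le q _))
    have hup := hqa'.eventually_lt_const
      (show (lscEnvelope q u).toReal < (lscEnvelope q u).toReal + δ / 2 by linarith)
    filter_upwards [hlow, hup] with n h1 h2
    rw [hq.toReal_add_smul s (hfin n) (hbfin n), hE.toReal_add_smul s hu hv] at h1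
    have h3 := mul_le_mul_of_nonneg_left (hM0 n) (sq_nonneg s)
    have h4 : 0 ≤ s ^ 2 * (lscEnvelope q v).toReal :=
      mul_nonneg (sq_nonneg s) ENNReal.toReal_nonneg
    linarith
  have hN : 0 ≤ N := le_max_right _ _
  rw [Metric.tendsto_atTop']
  intro ε hε
  -- After division by s the error in twice the polar form is ε/2 + sN, and sN < ε.
  set s := ε / (2 * (N + 1)) with hs
  have hs0 : 0 < s := by positivity
  have hsN : s * N < ε := by
    rw [hs, div_mul_eq_mul_div, div_lt_iff₀ (by positivity)]
    nlinarith
  have h1 := key s (s * ε / 2) (by positivity)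
  have h2 := key (-s) (s * ε / 2) (by positivity)
  obtain ⟨n₀, hn₀⟩ := eventually_atTop.1 (h1.and h2)
  refine ⟨n₀, fun n hn => ?_⟩
  obtain ⟨h3, h4⟩ := hn₀ n hn.le
  have h5 : s * (2 * polar (lscEnvelope q) u v - ε / 2 - s * N) ≤
      s * (2 * polar q (a n) (b n)) := by
    linarith
  have h6 : s * (2 * polar q (a n) (b n)) ≤
      s * (2 * polar (lscEnvelope q) u v + ε / 2 + s * N) := by
    linarith
  have h7 := le_of_mul_le_mul_left h5 hs0
  have h8 := le_of_mul_le_mul_left h6 hs0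
  rw [Real.dist_eq, abs_lt]
  constructor <;> linarith

end QuadraticForms

/-! ### The operator associated with a closed form and its resolvents -/

section Semigroup

variable {H : Type*} [NormedAddCommGroup H] [InnerProductSpace ℝ H] {q : H → ℝ≥0∞}

namespace FormOperatorGraph

theorem sub (hq : IsQuadraticForm q) {u v f g : H} (hu : FormOperatorGraph q u f)
    (hv : FormOperatorGraph q v g) : FormOperatorGraph q (u - v) (f - g) :=
  ⟨hq.sub_ne_top hu.1 hv.1, fun w hw => by
    rw [hq.polar_sub_left hu.1 hv.1 hw, hu.2 w hw, hv.2 w hw, inner_sub_left]⟩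

theorem add (hq : IsQuadraticForm q) {u v f g : H} (hu : FormOperatorGraph q u f)
    (hv : FormOperatorGraph q v g) : FormOperatorGraph q (u + v) (f + g) :=
  ⟨hq.add_ne_top hu.1 hv.1, fun w hw => by
    rw [hq.polar_add_left hu.1 hv.1 hw, hu.2 w hw, hv.2 w hw, inner_add_left]⟩

theorem smul (hq : IsQuadraticForm q) (c : ℝ) {u f : H} (hu : FormOperatorGraph q u f) :
    FormOperatorGraph q (c • u) (c • f) :=
  ⟨hq.smul_ne_top c hu.1, fun w hw => by
    rw [hq.polar_smul_left c hu.1 hw, hu.2 w hw, real_inner_smul_left]⟩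

theorem inner_eq (hq : IsQuadraticForm q) {u f : H} (hu : FormOperatorGraph q u f) :
    inner ℝ f u = (q u).toReal := by
  rw [← hu.2 u hu.1, hq.polar_self]

theorem inner_nonneg (hq : IsQuadraticForm q) {u f : H} (hu : FormOperatorGraph q u f) :
    0 ≤ inner ℝ f u := by
  rw [hu.inner_eq hq]
  exact ENNReal.toReal_nonneg

/-- Uniqueness for the resolvent equation. -/
theorem eq_of_resolvent (hq : IsQuadraticForm q) {l : ℝ} (hl : 0 < l) {u v f : H}
    (hu : FormOperatorGraph q u (l • (f - u))) (hv : FormOperatorGraph q v (l • (f - v))) :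
    u = v := by
  have h := (hu.sub hq hv).inner_nonneg hq
  rw [← smul_sub, sub_sub_sub_cancel_left, real_inner_smul_left, ← neg_sub u v, inner_neg_left,
    real_inner_self_eq_norm_sq] at h
  have : ‖u - v‖ = 0 := by
    have h2 : ‖u - v‖ ^ 2 ≤ 0 := by nlinarith
    exact pow_eq_zero_iff two_ne_zero |>.1 (le_antisymm h2 (sq_nonneg _))
  exact sub_eq_zero.1 (norm_eq_zero.1 this)

end FormOperatorGraph

theorem eq_zero_of_forall_quadratic_nonneg {a K : ℝ} (hK : 0 ≤ K)
    (h : ∀ s : ℝ, 0 ≤ 2 * s * a + s ^ 2 * K) : a = 0 := by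
  -- The denominator K + 1 replaces the exact minimizer -a/K, which is undefined for K = 0.
  have h1 := h (-a / (K + 1))
  have hK1 : 0 < K + 1 := by linarith
  have e : 2 * (-a / (K + 1)) * a + (-a / (K + 1)) ^ 2 * K =
      -(a ^ 2 * (K + 2)) / (K + 1) ^ 2 := by
    field_simp
    ring
  rw [e, div_nonneg_iff] at h1
  rcases h1 with ⟨h1, -⟩ | ⟨-, h1⟩
  · have : a ^ 2 ≤ 0 := by nlinarith [sq_nonneg a]
    exact pow_eq_zero_iff two_ne_zero |>.1 (le_antisymm this (sq_nonneg _))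
  · nlinarith

/-- The resolvent equation is solved by minimization. -/
theorem exists_resolvent [CompleteSpace H] (hq : IsClosedForm q) {l : ℝ} (hl : 0 < l) (f : H) :
    ∃ u, FormOperatorGraph q u (l • (f - u)) ∧
      ∀ v, q v ≠ ∞ → (q u).toReal + l * ‖u - f‖ ^ 2 ≤ (q v).toReal + l * ‖v - f‖ ^ 2 := by
  have hQ := hq.toIsQuadraticForm
  have hlsc := lowerSemicontinuous_of_isClosedForm hq
  let φ : {v : H // q v ≠ ∞} → ℝ := fun v => (q v).toReal + l * ‖(v : H) - f‖ ^ 2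
  have hφ0 : ∀ v, 0 ≤ φ v := fun v => by
    have : 0 ≤ (q v).toReal := ENNReal.toReal_nonneg
    positivity
  have : Nonempty {v : H // q v ≠ ∞} := ⟨⟨0, by simp [hQ.map_zero]⟩⟩
  have hbdd : BddBelow (Set.range φ) := ⟨0, by rintro _ ⟨v, rfl⟩; exact hφ0 v⟩
  set m := ⨅ v, φ v with hm
  have hmle : ∀ v, m ≤ φ v := fun v => ciInf_le hbdd v
  have hex : ∀ n : ℕ, ∃ v, φ v < m + 1 / ((n : ℝ) + 1) := fun n =>
    exists_lt_of_ciInf_lt (lt_add_of_pos_right m Nat.one_div_pos_of_nat)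
  choose v hv using hex
  -- Uniform convexity: the midpoint of a and b has value at least m, so near-minimizers are close
  -- to each other in norm.
  have hpar : ∀ a b : {v : H // q v ≠ ∞},
      l / 2 * ‖(a : H) - b‖ ^ 2 ≤ φ a + φ b - 2 * m := by
    intro a b
    have h1 := hmle ⟨(2⁻¹ : ℝ) • ((a : H) + b), hQ.smul_ne_top _ (hQ.add_ne_top a.2 b.2)⟩
    simp only [φ] at h1 ⊢
    rw [hQ.toReal_smul] at h1
    have h2 := hQ.toReal_parallelogram a.2 b.2
    have h3 : 0 ≤ (q ((a : H) - b)).toReal := ENNReal.toReal_nonneg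
    have h4 := parallelogram_law_with_norm ℝ ((a : H) - f) (b - f)
    have e1 : (2⁻¹ : ℝ) • ((a : H) + b) - f = (2⁻¹ : ℝ) • ((a - f) + (b - f)) := by
      simp only [smul_add, smul_sub]
      have : f = (2⁻¹ : ℝ) • f + (2⁻¹ : ℝ) • f := by
        rw [← add_smul]; norm_num
      nth_rewrite 1 [this]
      abel
    rw [e1, norm_smul, mul_pow] at h1
    rw [sub_sub_sub_cancel_right] at h4
    norm_num at h1
    have h5 : ‖(a : H) - b‖ ^ 2 = 2 * (‖(a : H) - f‖ ^ 2 + ‖(b : H) - f‖ ^ 2) -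
        ‖(a : H) - f + (b - f)‖ ^ 2 := by simp only [sq]; linarith
    rw [h5]
    nlinarith
  have hcau : CauchySeq fun n => (v n : H) := by
    refine cauchySeq_of_le_tendsto_0 (fun N : ℕ => √(4 / l * (1 / ((N : ℝ) + 1)))) ?_ ?_
    · intro n k N hn hk
      rw [dist_eq_norm]
      refine Real.le_sqrt_of_sq_le ?_
      have h1 := hpar (v n) (v k)
      have h2 : 1 / ((n : ℝ) + 1) ≤ 1 / ((N : ℝ) + 1) := Nat.one_div_le_one_div hn
      have h3 : 1 / ((k : ℝ) + 1) ≤ 1 / ((N : ℝ) + 1) := Nat.one_div_le_one_div hk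
      have h4 : l / 2 * ‖(v n : H) - v k‖ ^ 2 ≤ 2 * (1 / ((N : ℝ) + 1)) := by
        linarith [hv n, hv k]
      rw [div_mul_eq_mul_div, le_div_iff₀ hl]
      linarith
    · have := (tendsto_one_div_add_atTop_nhds_zero_nat (𝕜 := ℝ)).const_mul (4 / l)
      rw [mul_zero] at this
      have h0 := (Real.continuous_sqrt.tendsto 0).comp this
      rwa [Real.sqrt_zero] at h0
  obtain ⟨u, hu⟩ := cauchySeq_tendsto_of_complete hcau
  have hlim : Tendsto (fun n : ℕ => m + 1 / ((n : ℝ) + 1) - l * ‖(v n : H) - f‖ ^ 2) atTop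
      (𝓝 (m + 0 - l * ‖u - f‖ ^ 2)) :=
    (tendsto_const_nhds.add tendsto_one_div_add_atTop_nhds_zero_nat).sub
      (((hu.sub_const f).norm.pow 2).const_mul l)
  rw [add_zero] at hlim
  have hle : ∀ n, (q (v n)).toReal ≤ m + 1 / ((n : ℝ) + 1) - l * ‖(v n : H) - f‖ ^ 2 := fun n => by
    have := (hv n).le
    simp only [φ] at this
    linarith
  have hnn : 0 ≤ m - l * ‖u - f‖ ^ 2 :=
    ge_of_tendsto' hlim fun n => ENNReal.toReal_nonneg.trans (hle n)
  have hqu : q u ≤ ENNReal.ofReal (m - l * ‖u - f‖ ^ 2) :=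
    le_of_lowerSemicontinuous_of_tendsto hlsc hu (ENNReal.tendsto_ofReal hlim) fun n => by
      rw [← ENNReal.ofReal_toReal (v n).2]
      exact ENNReal.ofReal_le_ofReal (hle n)
  have hfin : q u ≠ ∞ := ne_top_of_le_ne_top ENNReal.ofReal_ne_top hqu
  have hqu' : (q u).toReal ≤ m - l * ‖u - f‖ ^ 2 := ENNReal.toReal_le_of_le_ofReal hnn hqu
  have hmin : ∀ v, q v ≠ ∞ →
      (q u).toReal + l * ‖u - f‖ ^ 2 ≤ (q v).toReal + l * ‖v - f‖ ^ 2 := fun v hv => by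
    have := hmle ⟨v, hv⟩
    simp only [φ] at this
    linarith
  refine ⟨u, ⟨hfin, fun w hw => ?_⟩, hmin⟩
  -- Euler–Lagrange equation: the functional along u + s w is quadratic in s with its minimum at s =
  -- 0.
  have h : polar q u w + l * inner ℝ (u - f) w = 0 := by
    refine eq_zero_of_forall_quadratic_nonneg (K := (q w).toReal + l * ‖w‖ ^ 2) ?_ fun s => ?_
    · have : 0 ≤ (q w).toReal := ENNReal.toReal_nonneg
      positivity
    have h1 := hmin (u + s • w) (hQ.add_ne_top hfin (hQ.smul_ne_top s hw))
    rw [hQ.toReal_add_smul s hfin hw, add_sub_right_comm, norm_add_sq_real,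
      real_inner_smul_right, norm_smul, mul_pow, Real.norm_eq_abs, sq_abs] at h1
    linarith
  rw [real_inner_smul_left, ← neg_sub u f, inner_neg_left]
  linarith

/-- The operator `l (l + A)⁻¹`, where `A` is the operator associated with the closed form `q`. -/
def resolvent [CompleteSpace H] (hq : IsClosedForm q) {l : ℝ} (hl : 0 < l) : H →L[ℝ] H :=
  LinearMap.mkContinuous
    { toFun := fun f => (exists_resolvent hq hl f).choose
      map_add' := fun f g => by
        have hQ := hq.toIsQuadraticForm
        refine FormOperatorGraph.eq_of_resolvent hQ hl
          (exists_resolvent hq hl (f + g)).choose_spec.1 ?_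
        convert ((exists_resolvent hq hl f).choose_spec.1.add hQ
          (exists_resolvent hq hl g).choose_spec.1) using 1
        rw [← smul_add]
        congr 1
        abel
      map_smul' := fun c f => by
        have hQ := hq.toIsQuadraticForm
        refine FormOperatorGraph.eq_of_resolvent hQ hl
          (exists_resolvent hq hl (c • f)).choose_spec.1 ?_
        have h := (exists_resolvent hq hl f).choose_spec.1.smul hQ c
        rwa [smul_comm c l, smul_sub c] at h }
    1 (fun f => by
      have h := (exists_resolvent hq hl f).choose_spec.1.inner_nonneg hq.toIsQuadraticForm
      set u := (exists_resolvent hq hl f).choose with hu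
      change ‖u‖ ≤ 1 * ‖f‖
      rw [real_inner_smul_left, inner_sub_left, real_inner_self_eq_norm_sq] at h
      have h1 := real_inner_le_norm f u
      have h2 : 0 ≤ inner ℝ f u - ‖u‖ ^ 2 := by
        by_contra! hneg
        nlinarith
      rw [one_mul]
      by_contra! hlt
      nlinarith [norm_nonneg f])

variable [CompleteSpace H]

theorem graph_resolvent (hq : IsClosedForm q) {l : ℝ} (hl : 0 < l) (f : H) :
    FormOperatorGraph q (resolvent hq hl f) (l • (f - resolvent hq hl f)) :=
  (exists_resolvent hq hl f).choose_spec.1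

theorem resolvent_minimal (hq : IsClosedForm q) {l : ℝ} (hl : 0 < l) (f v : H) (hv : q v ≠ ∞) :
    (q (resolvent hq hl f)).toReal + l * ‖resolvent hq hl f - f‖ ^ 2 ≤
      (q v).toReal + l * ‖v - f‖ ^ 2 :=
  (exists_resolvent hq hl f).choose_spec.2 v hv

theorem norm_resolvent_apply_le (hq : IsClosedForm q) {l : ℝ} (hl : 0 < l) (f : H) :
    ‖resolvent hq hl f‖ ≤ ‖f‖ := by
  have h : ‖resolvent hq hl‖ ≤ 1 := LinearMap.mkContinuous_norm_le _ zero_le_one _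
  simpa using (resolvent hq hl).le_of_opNorm_le h f

theorem resolvent_eq (hq : IsClosedForm q) {l : ℝ} (hl : 0 < l) {f u : H}
    (h : FormOperatorGraph q u (l • (f - u))) : resolvent hq hl f = u :=
  FormOperatorGraph.eq_of_resolvent hq.toIsQuadraticForm hl (graph_resolvent hq hl f) h

theorem inner_resolvent (hq : IsClosedForm q) {l : ℝ} (hl : 0 < l) (f g : H) :
    inner ℝ (resolvent hq hl f) g = inner ℝ f (resolvent hq hl g) := by
  have hf := graph_resolvent hq hl f
  have hg := graph_resolvent hq hl g
  have h1 := hf.2 _ hg.1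
  have h2 := hg.2 _ hf.1
  rw [polar_comm hq.toIsQuadraticForm, h1, real_inner_smul_left, real_inner_smul_left] at h2
  have h3 := mul_left_cancel₀ hl.ne' h2
  rw [inner_sub_left, inner_sub_left, real_inner_comm (resolvent hq hl f) (resolvent hq hl g)]
    at h3
  rw [real_inner_comm]
  linarith

/-- On the domain of `A` the Yosida approximation is `A_l u = l (l + A)⁻¹ A u`. -/
theorem yosida_eq_resolvent (hq : IsClosedForm q) {l : ℝ} (hl : 0 < l) {u f : H}
    (h : FormOperatorGraph q u f) : l • (u - resolvent hq hl u) = resolvent hq hl f := by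
  symm
  have hQ := hq.toIsQuadraticForm
  exact resolvent_eq hq hl ((h.sub hQ (graph_resolvent hq hl u)).smul hQ l)

theorem graph_resolvent_of_graph (hq : IsClosedForm q) {l : ℝ} (hl : 0 < l) {u f : H}
    (h : FormOperatorGraph q u f) :
    FormOperatorGraph q (resolvent hq hl u) (resolvent hq hl f) := by
  rw [← yosida_eq_resolvent hq hl h]
  exact graph_resolvent hq hl u

/-- Each resolvent maps the graph of the operator into itself, so the image of a solution of the
second resolvent equation is again a solution; uniqueness finishes. -/
theorem resolvent_comm (hq : IsClosedForm q) {l m : ℝ} (hl : 0 < l) (hm : 0 < m) :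
    Commute (resolvent hq hl) (resolvent hq hm) := by
  ext f
  have h := graph_resolvent_of_graph hq hl (graph_resolvent hq hm f)
  rw [map_smul, map_sub] at h
  exact (resolvent_eq hq hm h).symm

/-- The Yosida approximations `-A_n`, with parameter `n + 1`. -/
def yosida (hq : IsClosedForm q) (n : ℕ) : H →L[ℝ] H :=
  ((n : ℝ) + 1) • (resolvent hq (n.cast_add_one_pos : (0 : ℝ) < n + 1) - 1)

theorem yosida_comm (hq : IsClosedForm q) (m n : ℕ) : Commute (yosida hq m) (yosida hq n) :=
  (((resolvent_comm hq _ _).sub_left (Commute.one_left _)).sub_right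
    (Commute.one_right _)).smul_left _ |>.smul_right _

theorem inner_yosida_nonpos (hq : IsClosedForm q) (n : ℕ) (u : H) :
    inner ℝ (yosida hq n u) u ≤ 0 := by
  have hn : (0 : ℝ) < n + 1 := n.cast_add_one_pos
  have h1 := real_inner_le_norm (resolvent hq hn u) u
  have h2 := norm_resolvent_apply_le hq hn u
  simp only [yosida, _root_.smul_apply, _root_.sub_apply,
    one_apply_eq_self, real_inner_smul_left, inner_sub_left,
    real_inner_self_eq_norm_sq]
  refine mul_nonpos_of_nonneg_of_nonpos hn.le ?_
  nlinarith [norm_nonneg u]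

theorem inner_yosida (hq : IsClosedForm q) (n : ℕ) (u v : H) :
    inner ℝ (yosida hq n u) v = inner ℝ u (yosida hq n v) := by
  simp only [yosida, _root_.smul_apply, _root_.sub_apply,
    one_apply_eq_self, real_inner_smul_left, real_inner_smul_right, inner_sub_left,
    inner_sub_right, inner_resolvent]

/-- On the form domain, comparing the minimizer with v itself gives l‖J v - v‖² ≤ q(v), a rate in l.
Contractivity and density of the domain extend the convergence. -/
theorem tendsto_resolvent (hq : IsClosedForm q) (hd : Dense {u | q u ≠ ∞}) (f : H) :
    Tendsto (fun n : ℕ => resolvent hq (n.cast_add_one_pos : (0 : ℝ) < n + 1) f) atTop (𝓝 f) := by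
  have hdom : ∀ v, q v ≠ ∞ →
      Tendsto (fun n : ℕ => resolvent hq (n.cast_add_one_pos : (0 : ℝ) < n + 1) v) atTop
        (𝓝 v) := by
    intro v hv
    rw [tendsto_iff_norm_sub_tendsto_zero]
    have hb : ∀ n : ℕ, ‖resolvent hq (n.cast_add_one_pos : (0 : ℝ) < n + 1) v - v‖ ≤
        √((q v).toReal * (1 / ((n : ℝ) + 1))) := by
      intro n
      have h := resolvent_minimal hq (n.cast_add_one_pos : (0 : ℝ) < n + 1) v v hv
      rw [sub_self, norm_zero] at h
      refine Real.le_sqrt_of_sq_le ?_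
      have hn : (0 : ℝ) < n + 1 := n.cast_add_one_pos
      rw [mul_one_div, le_div_iff₀ hn]
      have : 0 ≤ (q (resolvent hq (n.cast_add_one_pos : (0 : ℝ) < n + 1) v)).toReal :=
        ENNReal.toReal_nonneg
      linarith
    refine squeeze_zero (fun _ => norm_nonneg _) hb ?_
    have := (tendsto_one_div_add_atTop_nhds_zero_nat (𝕜 := ℝ)).const_mul (q v).toReal
    rw [mul_zero] at this
    have h0 := (Real.continuous_sqrt.tendsto 0).comp this
    rwa [Real.sqrt_zero] at h0
  rw [Metric.tendsto_atTop']
  intro ε hε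
  obtain ⟨v, hv, hvf⟩ := hd.exists_dist_lt f (show 0 < ε / 3 by positivity)
  obtain ⟨N, hN⟩ := (Metric.tendsto_atTop'.1 (hdom v hv)) (ε / 3) (by positivity)
  refine ⟨N, fun n hn => ?_⟩
  set J := resolvent hq (n.cast_add_one_pos : (0 : ℝ) < n + 1)
  have h1 : dist (J f) (J v) ≤ dist f v := by
    rw [dist_eq_norm, dist_eq_norm, ← map_sub]
    exact norm_resolvent_apply_le hq _ _
  have h2 := dist_triangle4 (J f) (J v) v f
  rw [dist_comm v f] at h2
  linarith [hN n hn]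

theorem dense_graph (hq : IsClosedForm q) (hd : Dense {u | q u ≠ ∞}) :
    Dense {u | ∃ f, FormOperatorGraph q u f} := fun f =>
  mem_closure_of_tendsto (tendsto_resolvent hq hd f)
    (Eventually.of_forall fun _ => ⟨_, graph_resolvent hq _ f⟩)

theorem tendsto_yosida (hq : IsClosedForm q) (hd : Dense {u | q u ≠ ∞}) {u f : H}
    (h : FormOperatorGraph q u f) : Tendsto (fun n => yosida hq n u) atTop (𝓝 (-f)) := by
  refine ((tendsto_resolvent hq hd f).neg).congr fun n => ?_
  rw [← yosida_eq_resolvent hq _ h, ← smul_neg, neg_sub]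
  rfl

/-! ### Exponentials of bounded dissipative operators -/

open NormedSpace in
theorem hasDerivAt_exp_apply (B : H →L[ℝ] H) (u : H) (t : ℝ) :
    HasDerivAt (fun s : ℝ => exp (s • B) u) (exp (t • B) (B u)) t :=
  (hasDerivAt_exp_smul_const B t).clm_apply (hasDerivAt_const t u) |>.congr_deriv (by simp)

open NormedSpace in
-- The squared norm of the orbit has derivative 2(Bx, x) ≤ 0 at the orbit point x.
theorem norm_exp_apply_le {B : H →L[ℝ] H} (hB : ∀ u, inner ℝ (B u) u ≤ 0) {t : ℝ} (ht : 0 ≤ t)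
    (u : H) : ‖exp (t • B) u‖ ≤ ‖u‖ := by
  have hder : ∀ s : ℝ, HasDerivAt (fun s : ℝ => ‖exp (s • B) u‖ ^ 2)
      (2 * inner ℝ (exp (s • B) u) (B (exp (s • B) u))) s := fun s => by
    have hc : exp (s • B) (B u) = B (exp (s • B) u) := by
      have : Commute (exp (s • B)) B := ((Commute.refl B).smul_left s).exp_left
      exact DFunLike.congr_fun this.eq u
    rw [← hc]
    exact (hasDerivAt_exp_apply B u s).norm_sq
  have hanti : Antitone fun s : ℝ => ‖exp (s • B) u‖ ^ 2 :=
    antitone_of_hasDerivAt_nonpos hder fun s => by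
      have := hB (exp (s • B) u)
      rw [real_inner_comm] at this
      simp only [Pi.zero_apply]
      linarith
  have h := hanti ht
  simp only [zero_smul, exp_zero, one_apply_eq_self] at h
  exact (sq_le_sq₀ (norm_nonneg _) (norm_nonneg _)).1 h

open NormedSpace in
-- The curve e^{(t-s)B'} e^{sB} u joins e^{tB'}u to e^{tB}u. By commutation its derivative is
-- e^{(t-s)B'} e^{sB} (B - B')u, of norm at most ‖(B - B')u‖.
theorem norm_exp_sub_exp_apply_le {B B' : H →L[ℝ] H} (hB : ∀ u, inner ℝ (B u) u ≤ 0)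
    (hB' : ∀ u, inner ℝ (B' u) u ≤ 0) (hc : Commute B B') {t : ℝ} (ht : 0 ≤ t) (u : H) :
    ‖exp (t • B) u - exp (t • B') u‖ ≤ t * ‖B u - B' u‖ := by
  have hcs : ∀ s : ℝ, exp (t • B') * exp (s • (B - B')) = exp ((t - s) • B') * exp (s • B) := by
    intro s
    let _ : NormedAlgebra ℚ (H →L[ℝ] H) := NormedAlgebra.restrictScalars ℚ ℝ _
    rw [← exp_add_of_commute, ← exp_add_of_commute]
    · congr 1
      simp only [smul_sub, sub_smul]
      abel
    · exact (hc.symm.smul_left _).smul_right _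
    · exact ((hc.symm.sub_right (Commute.refl _)).smul_left _).smul_right _
  have hd : ∀ s : ℝ, HasDerivAt (fun s : ℝ => exp (t • B') (exp (s • (B - B')) u))
      (exp (t • B') (exp (s • (B - B')) ((B - B') u))) s := fun s =>
    ((exp (t • B')).hasFDerivAt.comp_hasDerivAt s (hasDerivAt_exp_apply (B - B') u s))
  have h := norm_image_sub_le_of_norm_deriv_le_segment' (a := 0) (b := t)
    (C := ‖B u - B' u‖) (fun s _ => (hd s).hasDerivWithinAt) (fun s hs => ?_) t
    (Set.right_mem_Icc.2 ht)
  · have h1 := DFunLike.congr_fun (hcs t) u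
    simp only [sub_self, zero_smul, exp_zero, mul_apply_eq_comp,
      one_apply_eq_self] at h1
    simp only [zero_smul, exp_zero, one_apply_eq_self, h1, sub_zero] at h
    rwa [mul_comm]
  · have h1 := DFunLike.congr_fun (hcs s) ((B - B') u)
    simp only [mul_apply_eq_comp] at h1
    rw [h1]
    exact (norm_exp_apply_le hB' (sub_nonneg.2 hs.2.le) _).trans (norm_exp_apply_le hB hs.1 _)

open NormedSpace in
theorem norm_exp_sub_self_le {B : H →L[ℝ] H} (hB : ∀ u, inner ℝ (B u) u ≤ 0) {t : ℝ}
    (ht : 0 ≤ t) (u : H) : ‖exp (t • B) u - u‖ ≤ t * ‖B u‖ := by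
  have := norm_exp_sub_exp_apply_le (B' := 0) hB (by simp) (Commute.zero_right B) ht u
  simpa using this

open NormedSpace in
-- A second-order term ‖B(Bu)‖ would not be uniform over the Yosida approximations when u is only in
-- the domain of A. Hence Bu is replaced by a nearby g for which ‖Bg‖ stays under control.
theorem norm_exp_sub_linear_le {B : H →L[ℝ] H} (hB : ∀ u, inner ℝ (B u) u ≤ 0) {t : ℝ}
    (ht : 0 ≤ t) (u g : H) :
    ‖exp (t • B) u - u - t • B u‖ ≤ t * (2 * ‖B u - g‖ + t * ‖B g‖) := by
  have hd : ∀ s : ℝ, HasDerivAt (fun s : ℝ => exp (s • B) u - s • B u)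
      (exp (s • B) (B u) - (1 : ℝ) • B u) s := fun s =>
    (hasDerivAt_exp_apply B u s).sub ((hasDerivAt_id s).smul_const (B u))
  have h := norm_image_sub_le_of_norm_deriv_le_segment' (a := 0) (b := t)
    (C := 2 * ‖B u - g‖ + t * ‖B g‖) (fun s _ => (hd s).hasDerivWithinAt) (fun s hs => ?_) t
    (Set.right_mem_Icc.2 ht)
  · simp only [zero_smul, exp_zero, one_apply_eq_self, sub_zero] at h
    rw [mul_comm t, sub_right_comm]
    exact h
  · have e : exp (s • B) (B u) - (1 : ℝ) • B u =
        exp (s • B) (B u - g) + (exp (s • B) g - g) - (B u - g) := by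
      rw [one_smul, map_sub]; abel
    rw [e]
    have h1 := norm_exp_apply_le hB hs.1 (B u - g)
    have h2 := norm_exp_sub_self_le hB hs.1 g
    have h3 : s * ‖B g‖ ≤ t * ‖B g‖ := by
      have := hs.2.le
      gcongr
    have h4 := norm_sub_le (exp (s • B) (B u - g) + (exp (s • B) g - g)) (B u - g)
    have h5 := norm_add_le (exp (s • B) (B u - g)) (exp (s • B) g - g)
    linarith

end Semigroup

/-! ### The semigroup of a closed form: existence, uniqueness, invariant convex sets -/

section Semigroup

variable {H : Type*} [NormedAddCommGroup H] [InnerProductSpace ℝ H] {q : H → ℝ≥0∞}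

theorem tendsto_coe_nhdsGT_zero : Tendsto (fun t : ℝ≥0 => (t : ℝ)) (𝓝[>] 0) (𝓝 0) :=
  (NNReal.continuous_coe.tendsto 0).mono_left nhdsWithin_le_nhds

theorem cauchySeq_of_dense_of_contractive {T : ℕ → H →L[ℝ] H} (hT : ∀ n u, ‖T n u‖ ≤ ‖u‖)
    {D : Set H} (hD : Dense D) (h : ∀ u ∈ D, CauchySeq fun n => T n u) (u : H) :
    CauchySeq fun n => T n u := by
  rw [Metric.cauchySeq_iff]
  intro ε hε
  obtain ⟨v, hv, huv⟩ := hD.exists_dist_lt u (show 0 < ε / 3 by positivity)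
  obtain ⟨N, hN⟩ := Metric.cauchySeq_iff.1 (h v hv) (ε / 3) (by positivity)
  have hc : ∀ n, dist (T n u) (T n v) ≤ dist u v := fun n => by
    rw [dist_eq_norm, dist_eq_norm, ← map_sub]
    exact hT n _
  refine ⟨N, fun m hm n hn => ?_⟩
  have h1 := dist_triangle4 (T m u) (T m v) (T n v) (T n u)
  rw [dist_comm (T n v)] at h1
  linarith [hN m hm n hn, hc m, hc n]

open NormedSpace in
/-- Existence of the semigroup of a densely defined closed form; its operators are symmetric. -/
theorem exists_formSemigroup [CompleteSpace H] (hq : IsClosedForm q)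
    (hd : Dense {u | q u ≠ ∞}) :
    ∃ S : ℝ≥0 → H →L[ℝ] H, IsFormSemigroup q S ∧
      ∀ t u v, inner ℝ (S t u) v = inner ℝ u (S t v) := by
  have hQ := hq.toIsQuadraticForm
  let E : ℕ → ℝ≥0 → H →L[ℝ] H := fun n t => exp ((t : ℝ) • yosida hq n)
  have hE : ∀ n t u, ‖E n t u‖ ≤ ‖u‖ := fun n t u =>
    norm_exp_apply_le (inner_yosida_nonpos hq n) t.2 u
  have hcau : ∀ t u, CauchySeq fun n => E n t u := by
    intro t
    refine cauchySeq_of_dense_of_contractive (fun n => hE n t) (dense_graph hq hd) ?_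
    rintro u ⟨f, hf⟩
    have hY := (tendsto_yosida hq hd hf).cauchySeq
    rw [Metric.cauchySeq_iff] at hY ⊢
    intro ε hε
    have ht : (0 : ℝ) < t + 1 := by positivity
    obtain ⟨N, hN⟩ := hY (ε / (t + 1)) (by positivity)
    refine ⟨N, fun m hm n hn => ?_⟩
    have h1 := norm_exp_sub_exp_apply_le (inner_yosida_nonpos hq m) (inner_yosida_nonpos hq n)
      (yosida_comm hq m n) t.2 u
    have h2 := hN m hm n hn
    rw [dist_eq_norm] at h2 ⊢
    rw [lt_div_iff₀ ht] at h2
    have h3 := norm_nonneg (yosida hq m u - yosida hq n u)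
    refine lt_of_le_of_lt h1 (lt_of_le_of_lt ?_ h2)
    rw [mul_comm]
    exact mul_le_mul_of_nonneg_left (by simp) h3
  have hlim : ∀ t u, ∃ v, Tendsto (fun n => E n t u) atTop (𝓝 v) := fun t u =>
    cauchySeq_tendsto_of_complete (hcau t u)
  choose F hF using hlim
  let S : ℝ≥0 → H →L[ℝ] H := fun t =>
    continuousLinearMapOfTendsto (fun n => E n t) (tendsto_pi_nhds.2 (hF t))
  have hS : ∀ t u, Tendsto (fun n => E n t u) atTop (𝓝 (S t u)) := hF
  have hSc : ∀ t u, ‖S t u‖ ≤ ‖u‖ := fun t u =>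
    le_of_tendsto' (hS t u).norm fun n => hE n t u
  have hS0 : S 0 = ContinuousLinearMap.id ℝ H := by
    ext u
    refine tendsto_nhds_unique (hS 0 u) ?_
    simp [E]
  have hEadd : ∀ n s t u, E n (s + t) u = E n s (E n t u) := by
    intro n s t u
    have : E n (s + t) = E n s * E n t := by
      let _ : NormedAlgebra ℚ (H →L[ℝ] H) := NormedAlgebra.restrictScalars ℚ ℝ _
      simp only [E]
      rw [← exp_add_of_commute (((Commute.refl _).smul_left _).smul_right _), ← add_smul]
      simp
    rw [this]
    rfl
  have hSadd : ∀ s t u, S (s + t) u = S s (S t u) := by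
    intro s t u
    refine tendsto_nhds_unique (hS (s + t) u) ?_
    simp only [hEadd]
    have h1 : Tendsto (fun n => E n s (E n t u - S t u)) atTop (𝓝 0) := by
      rw [tendsto_zero_iff_norm_tendsto_zero]
      refine squeeze_zero (fun _ => norm_nonneg _) (fun n => hE n s _) ?_
      exact tendsto_iff_norm_sub_tendsto_zero.1 (hS t u)
    have h2 := h1.add (hS s (S t u))
    simpa using h2
  have hSlip : ∀ {u f}, FormOperatorGraph q u f → ∀ t, ‖S t u - u‖ ≤ t * ‖f‖ := by
    intro u f hf t
    have h1 := (tendsto_yosida hq hd hf).norm.const_mul (t : ℝ)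
    rw [norm_neg] at h1
    exact le_of_tendsto_of_tendsto' ((hS t u).sub_const u).norm h1 fun n =>
      norm_exp_sub_self_le (inner_yosida_nonpos hq n) t.2 u
  have hcont : ∀ u, Continuous fun t : ℝ≥0 => S t u := by
    intro u
    -- Orbits starting in the domain of A are Lipschitz, and by contractivity they approximate any
    -- orbit uniformly in time.
    refine continuous_of_uniform_approx_of_continuous fun U hU => ?_
    obtain ⟨ε, hε, hεU⟩ := Metric.mem_uniformity_dist.1 hU
    obtain ⟨v, ⟨f, hf⟩, huv⟩ := (dense_graph hq hd).exists_dist_lt u hε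
    refine ⟨fun t => S t v, ?_, fun t => hεU (lt_of_le_of_lt ?_ huv)⟩
    · have hle : ∀ s t : ℝ≥0, s ≤ t → dist (S s v) (S t v) ≤ ‖f‖ * dist s t := by
        intro s t hst
        obtain ⟨r, rfl⟩ := exists_add_of_le hst
        rw [hSadd, dist_comm, dist_eq_norm, ← map_sub]
        refine (hSc s _).trans ((hSlip hf r).trans ?_)
        rw [NNReal.dist_eq, mul_comm]
        simp
      refine (LipschitzWith.of_dist_le_mul (K := ⟨‖f‖, norm_nonneg f⟩) fun s t => ?_).continuous
      rcases le_total s t with h | h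
      · exact hle s t h
      · rw [dist_comm, dist_comm s t]; exact hle t s h
    · rw [dist_eq_norm, dist_eq_norm, ← map_sub]
      exact hSc t _
  have hgen : ∀ {u f}, FormOperatorGraph q u f →
      Tendsto (fun t : ℝ≥0 => (t : ℝ)⁻¹ • (u - S t u)) (𝓝[>] 0) (𝓝 f) := by
    intro u f hf
    rw [Metric.tendsto_nhds]
    intro ε hε
    obtain ⟨g, ⟨k, hk⟩, hfg⟩ := (dense_graph hq hd).exists_dist_lt f (show 0 < ε / 4 by positivity)
    -- The linearization bound for the Yosida exponentials, in the limit. Here A u = f and A g = k,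
    -- and g is a point of the domain of A close to f.
    have hest : ∀ t : ℝ≥0, ‖S t u - u - (t : ℝ) • (-f)‖ ≤ t * (2 * ‖-f - (-g)‖ + t * ‖k‖) := by
      intro t
      have hY := tendsto_yosida hq hd hf
      have hY' := (tendsto_yosida hq hd hk).norm
      rw [norm_neg] at hY'
      refine le_of_tendsto_of_tendsto' (((hS t u).sub_const u).sub (hY.const_smul (t : ℝ))).norm
        ((((hY.sub_const (-g)).norm.const_mul 2).add (hY'.const_mul (t : ℝ))).const_mul (t : ℝ))
        fun n => ?_
      have := norm_exp_sub_linear_le (inner_yosida_nonpos hq n) t.2 u (-g)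
      rw [map_neg, norm_neg (yosida hq n g)] at this
      exact this
    have hk1 : 0 < ‖k‖ + 1 := by positivity
    filter_upwards [tendsto_coe_nhdsGT_zero.eventually_lt_const
      (show 0 < ε / (2 * (‖k‖ + 1)) by positivity), self_mem_nhdsWithin] with t ht ht0
    have ht0' : (0 : ℝ) < t := ht0
    have e : (t : ℝ)⁻¹ • (u - S t u) - f = -((t : ℝ)⁻¹ • (S t u - u - (t : ℝ) • (-f))) := by
      rw [smul_sub _ (S t u - u), smul_smul, inv_mul_cancel₀ ht0'.ne', one_smul, neg_sub,
        ← neg_sub u (S t u), smul_neg]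
      abel
    rw [dist_eq_norm, e, norm_neg, norm_smul, norm_inv, Real.norm_of_nonneg ht0'.le]
    have h1 : (t : ℝ)⁻¹ * ‖S t u - u - (t : ℝ) • (-f)‖ ≤ 2 * ‖-f - (-g)‖ + t * ‖k‖ := by
      rw [inv_mul_le_iff₀ ht0']
      exact hest t
    have h2 : ‖-f - (-g)‖ = dist f g := by rw [dist_eq_norm, ← norm_neg]; congr 1; abel
    rw [lt_div_iff₀ (by positivity)] at ht
    rw [h2] at h1
    have h3 : (t : ℝ) * ‖k‖ < ε / 2 := by nlinarith
    linarith
  refine ⟨S, ⟨hS0, fun s t => ?_, hcont, fun u f => ⟨hgen, fun h => ?_⟩⟩, fun t u v => ?_⟩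
  · ext u; exact hSadd s t u
  -- Maximality of A: with v = (1 + A)⁻¹(u + f), the difference u - v has generator value -(u - v),
  -- while contractivity makes the negative generator monotone. Hence u = v lies in the domain of A.
  · have hv := graph_resolvent hq one_pos (u + f)
    set v := resolvent hq one_pos (u + f) with hvdef
    rw [one_smul] at hv
    have h1 := h.sub (hgen hv)
    have h2 : Tendsto (fun t : ℝ≥0 => inner ℝ ((t : ℝ)⁻¹ • ((u - v) - S t (u - v))) (u - v))
        (𝓝[>] 0) (𝓝 (inner ℝ (f - (u + f - v)) (u - v))) := by
      refine Tendsto.inner (h1.congr fun t => ?_) tendsto_const_nhds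
      rw [← smul_sub, map_sub]
      congr 1
      abel
    have h3 : 0 ≤ inner ℝ (f - (u + f - v)) (u - v) := by
      refine ge_of_tendsto' h2 fun t => ?_
      rw [real_inner_smul_left, inner_sub_left, real_inner_self_eq_norm_sq]
      have h4 := real_inner_le_norm (S t (u - v)) (u - v)
      have h5 := hSc t (u - v)
      refine mul_nonneg (inv_nonneg.2 t.2) ?_
      nlinarith [norm_nonneg (u - v)]
    have e : f - (u + f - v) = -(u - v) := by abel
    rw [e, inner_neg_left, real_inner_self_eq_norm_sq] at h3
    have h6 : ‖u - v‖ ^ 2 = 0 := le_antisymm (by linarith) (sq_nonneg _)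
    have h7 : u = v := sub_eq_zero.1 (norm_eq_zero.1 (pow_eq_zero_iff two_ne_zero |>.1 h6))
    rw [← h7] at hv
    simpa using hv
  · have hEsym : ∀ n, inner ℝ (E n t u) v = inner ℝ u (E n t v) := by
      intro n
      have hsa : IsSelfAdjoint ((t : ℝ) • yosida hq n) := by
        rw [ContinuousLinearMap.isSelfAdjoint_iff_isSymmetric]
        intro x y
        have := inner_yosida hq n x y
        simp only [ContinuousLinearMap.coe_coe, _root_.smul_apply, real_inner_smul_left,
          real_inner_smul_right, this]
      have hsa' : IsSelfAdjoint (E n t) := by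
        rw [isSelfAdjoint_iff, star_exp, hsa.star_eq]
      exact (ContinuousLinearMap.isSelfAdjoint_iff_isSymmetric.1 hsa') u v
    exact tendsto_nhds_unique ((hS t u).inner tendsto_const_nhds)
      ((tendsto_const_nhds.inner (hS t v)).congr fun n => (hEsym n).symm)

namespace IsFormSemigroup

variable {S : ℝ≥0 → H →L[ℝ] H}

theorem graph (hS : IsFormSemigroup q S) {u f : H} (h : FormOperatorGraph q u f) (t : ℝ≥0) :
    FormOperatorGraph q (S t u) (S t f) := by
  rw [hS.generator] at h ⊢
  refine (((S t).continuous.tendsto f).comp h).congr fun s => ?_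
  have e : S s (S t u) = S t (S s u) := by
    rw [← ContinuousLinearMap.comp_apply, ← ContinuousLinearMap.comp_apply, ← hS.add, ← hS.add,
      add_comm]
  rw [Function.comp_apply, map_smul, map_sub, e]

/-- The generator gives right derivatives only; the one-sided comparison theorems used afterwards
need no more. -/
theorem hasDerivWithinAt (hS : IsFormSemigroup q S) {u f : H} (h : FormOperatorGraph q u f)
    {t : ℝ} (ht : 0 ≤ t) :
    HasDerivWithinAt (fun s : ℝ => S s.toNNReal u) (-(S t.toNNReal f)) (Set.Ici t) t := by
  rw [← hasDerivWithinAt_Ioi_iff_Ici, hasDerivWithinAt_iff_tendsto_slope' (by simp)]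
  have h1 := (hS.generator _ _).1 (hS.graph h t.toNNReal)
  have h2 : Tendsto (fun z : ℝ => (z - t).toNNReal) (𝓝[>] t) (𝓝[>] 0) := by
    refine tendsto_nhdsWithin_iff.2 ⟨?_, ?_⟩
    · have : Tendsto (fun z : ℝ => (z - t).toNNReal) (𝓝 t) (𝓝 (t - t).toNNReal) :=
        (continuous_real_toNNReal.comp (continuous_id.sub continuous_const)).tendsto t
      rw [sub_self, Real.toNNReal_zero] at this
      exact this.mono_left nhdsWithin_le_nhds
    · filter_upwards [self_mem_nhdsWithin] with z hz
      simpa using hz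
  refine ((h1.comp h2).neg).congr' ?_
  filter_upwards [self_mem_nhdsWithin] with z hz
  have hz' : t < z := hz
  have e : z.toNNReal = (z - t).toNNReal + t.toNNReal := by
    rw [← Real.toNNReal_add (by linarith) ht]
    congr 1
    ring
  rw [slope_def_module, Function.comp_apply, Real.coe_toNNReal _ (by linarith), e, hS.add,
    ContinuousLinearMap.comp_apply, ← smul_neg, neg_sub]

theorem continuous_toNNReal (hS : IsFormSemigroup q S) (u : H) :
    Continuous fun s : ℝ => S s.toNNReal u :=
  (hS.continuous u).comp continuous_real_toNNReal

/-- The squared distance of the two orbits has right derivative -2(Aw, w) ≤ 0, where w is their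
difference. Uniqueness transfers properties of the constructed semigroup, such as symmetry, to an
arbitrary one. -/
theorem unique (hq : IsQuadraticForm q) (hd : Dense {u | ∃ f, FormOperatorGraph q u f})
    (hS : IsFormSemigroup q S) {S' : ℝ≥0 → H →L[ℝ] H} (hS' : IsFormSemigroup q S') :
    S = S' := by
  funext t
  refine ContinuousLinearMap.ext fun u => ?_
  refine congrFun (Continuous.ext_on hd (S t).continuous (S' t).continuous ?_) u
  rintro u ⟨f, hf⟩
  have h := image_le_of_deriv_right_le_deriv_boundary (a := 0) (b := t)
    (f := fun s : ℝ => ‖S s.toNNReal u - S' s.toNNReal u‖ ^ 2) (B := fun _ => 0)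
    (B' := fun _ => 0)
    (((hS.continuous_toNNReal u).sub (hS'.continuous_toNNReal u)).norm.pow 2).continuousOn
    (fun s hs => ((hS.hasDerivWithinAt hf hs.1).sub (hS'.hasDerivWithinAt hf hs.1)).norm_sq)
    (by simp [hS.zero, hS'.zero]) continuousOn_const
    (fun s _ => (hasDerivWithinAt_const _ _ _)) (fun s _ => ?_) (Set.right_mem_Icc.2 t.2)
  · simp only [Real.toNNReal_coe] at h
    have h6 : ‖S t u - S' t u‖ ^ 2 = 0 := le_antisymm h (sq_nonneg _)
    exact sub_eq_zero.1 (norm_eq_zero.1 (pow_eq_zero_iff two_ne_zero |>.1 h6))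
  · have h1 := ((hS.graph hf s.toNNReal).sub hq (hS'.graph hf s.toNNReal)).inner_nonneg hq
    rw [real_inner_comm] at h1
    have e : -(S s.toNNReal f) - -(S' s.toNNReal f) = -(S s.toNNReal f - S' s.toNNReal f) := by
      abel
    rw [e, inner_neg_right, Pi.sub_apply]
    linarith

/-- If `P` is a metric projection onto a convex set that does not increase the form, then the
semigroup does not increase the distance to that set. -/
theorem norm_sub_projection_le (hq : IsQuadraticForm q)
    (hd : Dense {u | ∃ f, FormOperatorGraph q u f}) (hS : IsFormSemigroup q S) {P : H → H}
    (hP : ∀ u v, ‖v - P v‖ ≤ ‖v - P u‖) (hqP : ∀ u, q (P u) ≤ q u) (t : ℝ≥0) (u : H) :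
    ‖S t u - P (S t u)‖ ≤ ‖u - P u‖ := by
  have hlip : LipschitzWith 1 fun u => ‖u - P u‖ := by
    refine LipschitzWith.of_le_add fun u v => ?_
    have h1 := hP v u
    have h2 := norm_sub_le_norm_sub_add_norm_sub u v (P v)
    rw [dist_eq_norm]
    linarith
  have hcl : IsClosed {u | ‖S t u - P (S t u)‖ ≤ ‖u - P u‖} :=
    isClosed_le (hlip.continuous.comp (S t).continuous) hlip.continuous
  refine hd.induction ?_ hcl u
  rintro u ⟨f, hf⟩
  let w : ℝ → H := fun s => S s.toNNReal u
  have h := image_le_of_liminf_slope_right_le_deriv_boundary (a := 0) (b := t)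
    (f := fun s : ℝ => ‖w s - P (w s)‖ ^ 2)
    (B := fun _ => ‖u - P u‖ ^ 2) (B' := fun _ => 0)
    ((hlip.continuous.comp (hS.continuous_toNNReal u)).pow 2).continuousOn
    (by simp [w, hS.zero]) continuousOn_const
    (fun s _ => (hasDerivWithinAt_const _ _ _)) (fun x hx r hr => ?_) (Set.right_mem_Icc.2 t.2)
  · simp only [w, Real.toNNReal_coe] at h
    exact (sq_le_sq₀ (norm_nonneg _) (norm_nonneg _)).1 h
  · have hgr := hS.graph hf x.toNNReal
    -- P need not be differentiable. The point P(w x) is frozen: the distance from w z to it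
    -- dominates the distance to the convex set, with equality at z = x, so upper bounds for its
    -- slope suffice.
    have hder := ((hS.hasDerivWithinAt hf hx.1).sub_const (P (w x))).norm_sq
    have hfin : q (P (w x)) ≠ ∞ := ne_top_of_le_ne_top hgr.1 (hqP _)
    have h1 := hgr.2 _ (hq.sub_ne_top hgr.1 hfin)
    -- q(w) - q(Pw, w) is at least q(w) - (q(Pw) + q(w))/2, which is nonnegative because q(Pw) ≤
    -- q(w).
    have h2 : 0 ≤ polar q (w x) (w x - P (w x)) := by
      have h3 := hq.abs_polar_le hfin hgr.1
      rw [polar_comm hq, hq.polar_sub_left hgr.1 hfin hgr.1, hq.polar_self]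
      have h4 := (ENNReal.toReal_le_toReal hfin hgr.1).2 (hqP (w x))
      have h5 := le_abs_self (polar q (P (w x)) (S x.toNNReal u))
      linarith
    have hneg : 2 * inner ℝ (S x.toNNReal u - P (w x)) (-(S x.toNNReal f)) < r := by
      rw [inner_neg_right, real_inner_comm, ← h1]
      have : 0 ≤ polar q (S x.toNNReal u) (S x.toNNReal u - P (w x)) := h2
      linarith
    refine ((hder.liminf_right_slope_le hneg).and_eventually self_mem_nhdsWithin).mono ?_
    rintro z ⟨hz, hxz⟩
    have hxz' : x < z := hxz
    refine lt_of_le_of_lt ?_ hz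
    rw [slope_def_field, slope_def_field]
    have h6 : ‖w z - P (w z)‖ ^ 2 ≤ ‖w z - P (w x)‖ ^ 2 := by
      gcongr
      exact hP _ _
    have h7 : 0 < z - x := by linarith
    gcongr

end IsFormSemigroup

end Semigroup

/-! ### Extension of symmetric sub-Markovian operators to `L_∞` -/

section LinftyExtension

open scoped Classical

variable {d : ℕ}

/-! ### Truncation of bounded functions to balls -/

theorem memLp_two_indicator_ball (n : ℕ) (f : L d ∞) :
    MemLp ((Metric.ball (0 : E d) n).indicator f) 2 volume := by
  rw [memLp_indicator_iff_restrict Metric.isOpen_ball.measurableSet]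
  have : IsFiniteMeasure ((volume : Measure (E d)).restrict (Metric.ball (0 : E d) n)) :=
    ⟨by simpa using Metric.isBounded_ball.measure_lt_top⟩
  exact ((Lp.memLp f).restrict _).mono_exponent le_top

/-- The restriction of `f ∈ L_∞` to the ball of radius `n`, as an element of `L_2`. -/
def truncate (n : ℕ) (f : L d ∞) : L d 2 := (memLp_two_indicator_ball n f).toLp _

theorem coeFn_truncate (n : ℕ) (f : L d ∞) :
    truncate n f =ᵐ[volume] (Metric.ball (0 : E d) n).indicator f :=
  (memLp_two_indicator_ball n f).coeFn_toLp

theorem ae_abs_le_norm (f : L d ∞) : ∀ᵐ x : E d, |f x| ≤ ‖f‖ := by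
  have := ae_le_eLpNormEssSup (f := f) (μ := volume)
  filter_upwards [this] with x hx
  rw [Lp.norm_def, eLpNorm_exponent_top, ← Real.norm_eq_abs, ← toReal_enorm]
  refine ENNReal.toReal_mono ?_ hx
  have := Lp.eLpNorm_ne_top f
  rwa [eLpNorm_exponent_top] at this

theorem truncate_add (n : ℕ) (f g : L d ∞) : truncate n (f + g) = truncate n f + truncate n g := by
  refine Lp.ext ?_
  filter_upwards [coeFn_truncate n (f + g), coeFn_truncate n f, coeFn_truncate n g,
    Lp.coeFn_add f g, Lp.coeFn_add (truncate n f) (truncate n g)] with x h1 h2 h3 h4 h5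
  rw [h1, h5, Pi.add_apply, h2, h3]
  simp only [Set.indicator_apply, h4, Pi.add_apply]
  split_ifs <;> simp

theorem truncate_smul (n : ℕ) (c : ℝ) (f : L d ∞) : truncate n (c • f) = c • truncate n f := by
  refine Lp.ext ?_
  filter_upwards [coeFn_truncate n (c • f), coeFn_truncate n f, Lp.coeFn_smul c f,
    Lp.coeFn_smul c (truncate n f)] with x h1 h2 h3 h4
  rw [h1, h4, Pi.smul_apply, h2]
  simp only [Set.indicator_apply, h3, Pi.smul_apply]
  split_ifs <;> simp

theorem coeFn_oneLinfty : oneLinfty d =ᵐ[volume] fun _ => (1 : ℝ) :=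
  (memLp_top_const 1).coeFn_toLp

variable {A : L d 2 →L[ℝ] L d 2}

theorem inner_eq_integral (u v : L d 2) : inner ℝ u v = ∫ x, u x * v x := by
  rw [L2.inner_def]
  exact integral_congr_ae (Eventually.of_forall fun x => by simp [mul_comm])

theorem integrable_mul_L2 (u v : L d 2) : Integrable fun x => u x * v x :=
  (Lp.memLp u).integrable_mul (Lp.memLp v)

theorem apply_mono (hpos : ∀ u : L d 2, 0 ≤ u → 0 ≤ A u) {u v : L d 2} (h : u ≤ v) :
    A u ≤ A v := by
  have := hpos (v - u) (sub_nonneg.2 h)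
  rwa [map_sub, sub_nonneg] at this

theorem truncate_one_mono {m n : ℕ} (h : m ≤ n) :
    truncate m (oneLinfty d) ≤ truncate n (oneLinfty d) := by
  rw [← Lp.coeFn_le]
  filter_upwards [coeFn_truncate m (oneLinfty d), coeFn_truncate n (oneLinfty d),
    coeFn_oneLinfty (d := d)] with x h1 h2 h3
  rw [h1, h2]
  refine Set.indicator_le_indicator_apply_of_subset (Metric.ball_subset_ball (by exact_mod_cast h))
    ?_
  rw [h3]; exact zero_le_one

theorem truncate_sub_le {m n : ℕ} (h : m ≤ n) (f : L d ∞) :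
    truncate n f - truncate m f ≤
      ‖f‖ • (truncate n (oneLinfty d) - truncate m (oneLinfty d)) := by
  rw [← Lp.coeFn_le]
  filter_upwards [coeFn_truncate m (oneLinfty d), coeFn_truncate n (oneLinfty d),
    coeFn_oneLinfty (d := d), coeFn_truncate m f, coeFn_truncate n f, ae_abs_le_norm f,
    Lp.coeFn_sub (truncate n f) (truncate m f),
    Lp.coeFn_smul ‖f‖ (truncate n (oneLinfty d) - truncate m (oneLinfty d)),
    Lp.coeFn_sub (truncate n (oneLinfty d)) (truncate m (oneLinfty d))]
    with x h1 h2 h3 h4 h5 h6 h7 h8 h9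
  rw [h7, h8, Pi.smul_apply, h9, Pi.sub_apply, Pi.sub_apply, h1, h2, h4, h5]
  have hsub : Metric.ball (0 : E d) m ⊆ Metric.ball 0 n :=
    Metric.ball_subset_ball (by exact_mod_cast h)
  simp only [Set.indicator_apply, h3]
  by_cases hm : x ∈ Metric.ball (0 : E d) m
  · simp [hm, hsub hm]
  · by_cases hn : x ∈ Metric.ball (0 : E d) n
    · simpa [hm, hn] using (le_abs_self _).trans h6
    · simp [hm, hn]

theorem truncate_neg (n : ℕ) (f : L d ∞) : truncate n (-f) = -truncate n f := by
  simpa using truncate_smul n (-1) f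

/-- For the constant 1 the sequence is monotone and bounded. For general f, positivity dominates the
increments, for f and for -f, by ‖f‖ times those for 1, so the sequence is Cauchy. -/
theorem ae_exists_tendsto_truncate (hpos : ∀ u : L d 2, 0 ≤ u → 0 ≤ A u)
    (hbd : ∀ (u : L d 2) (c : ℝ), (∀ᵐ x, |u x| ≤ c) → ∀ᵐ x, |A u x| ≤ c) (f : L d ∞) :
    ∀ᵐ x, ∃ l, Tendsto (fun n => A (truncate n f) x) atTop (𝓝 l) := by
  have hmono : ∀ᵐ x, ∀ m n : ℕ, m ≤ n →
      A (truncate m (oneLinfty d)) x ≤ A (truncate n (oneLinfty d)) x := by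
    rw [ae_all_iff]; intro m
    rw [ae_all_iff]; intro n
    by_cases h : m ≤ n
    · filter_upwards [(Lp.coeFn_le _ _).2 (apply_mono hpos (truncate_one_mono (d := d) h))]
        with x hx _
      exact hx
    · exact Eventually.of_forall fun x h' => absurd h' h
  have hle : ∀ g : L d ∞, ∀ᵐ x, ∀ m n : ℕ, m ≤ n →
      A (truncate n g) x - A (truncate m g) x ≤
        ‖g‖ * (A (truncate n (oneLinfty d)) x - A (truncate m (oneLinfty d)) x) := by
    intro g
    rw [ae_all_iff]; intro m
    rw [ae_all_iff]; intro n
    by_cases h : m ≤ n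
    · have h1 := (Lp.coeFn_le _ _).2 (apply_mono hpos (truncate_sub_le h g))
      rw [map_sub, map_smul, map_sub] at h1
      filter_upwards [h1, Lp.coeFn_sub (A (truncate n g)) (A (truncate m g)),
        Lp.coeFn_smul ‖g‖ (A (truncate n (oneLinfty d)) - A (truncate m (oneLinfty d))),
        Lp.coeFn_sub (A (truncate n (oneLinfty d))) (A (truncate m (oneLinfty d)))]
        with x h2 h3 h4 h5 _
      rw [h3, h4, Pi.smul_apply, h5] at h2
      exact h2
    · exact Eventually.of_forall fun x h' => absurd h' h
  have hone : ∀ᵐ x, ∀ n : ℕ, |A (truncate n (oneLinfty d)) x| ≤ 1 := by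
    rw [ae_all_iff]; intro n
    refine hbd _ 1 ?_
    filter_upwards [coeFn_truncate n (oneLinfty d), coeFn_oneLinfty (d := d)] with x h1 h2
    rw [h1, Set.indicator_apply, h2]
    split_ifs <;> simp
  have hneg : ∀ᵐ x, ∀ n : ℕ, A (truncate n (-f)) x = -A (truncate n f) x := by
    rw [ae_all_iff]; intro n
    rw [truncate_neg, map_neg]
    exact Lp.coeFn_neg _
  filter_upwards [hmono, hle f, hle (-f), hone, hneg] with x h1 h2 h3 h4 h5
  have hconv : CauchySeq fun n => A (truncate n (oneLinfty d)) x :=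
    (tendsto_atTop_ciSup (fun m n h => h1 m n h)
      ⟨1, by rintro _ ⟨n, rfl⟩; exact (abs_le.1 (h4 n)).2⟩).cauchySeq
  refine cauchySeq_tendsto_of_complete ?_
  rw [Metric.cauchySeq_iff'] at hconv ⊢
  intro ε hε
  have hf1 : 0 < ‖f‖ + 1 := by positivity
  obtain ⟨N, hN⟩ := hconv (ε / (‖f‖ + 1)) (by positivity)
  refine ⟨N, fun n hn => ?_⟩
  have h6 := hN n hn
  rw [Real.dist_eq, lt_div_iff₀ hf1] at h6
  have h7 := h2 N n hn
  have h8 := h3 N n hn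
  rw [norm_neg, h5, h5] at h8
  have h9 := le_abs_self (A (truncate n (oneLinfty d)) x - A (truncate N (oneLinfty d)) x)
  have h10 := abs_nonneg (A (truncate n (oneLinfty d)) x - A (truncate N (oneLinfty d)) x)
  have h11 := mul_le_mul_of_nonneg_left h9 (norm_nonneg f)
  rw [Real.dist_eq, abs_lt]
  constructor <;> linarith

theorem exists_limit_truncate (hpos : ∀ u : L d 2, 0 ≤ u → 0 ≤ A u)
    (hbd : ∀ (u : L d 2) (c : ℝ), (∀ᵐ x, |u x| ≤ c) → ∀ᵐ x, |A u x| ≤ c) (f : L d ∞) :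
    ∃ g : L d ∞, (∀ᵐ x, Tendsto (fun n => A (truncate n f) x) atTop (𝓝 (g x))) ∧
      ‖g‖ ≤ ‖f‖ := by
  obtain ⟨g, hgm, hg⟩ := measurable_limit_of_tendsto_metrizable_ae
    (fun n => (Lp.aestronglyMeasurable (A (truncate n f))).aemeasurable)
    (ae_exists_tendsto_truncate hpos hbd f)
  have hb : ∀ᵐ x, ∀ n : ℕ, |A (truncate n f) x| ≤ ‖f‖ := by
    rw [ae_all_iff]; intro n
    refine hbd _ _ ?_
    filter_upwards [coeFn_truncate n f, ae_abs_le_norm f] with x h1 h2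
    rw [h1, Set.indicator_apply]
    split_ifs
    · exact h2
    · simp
  have hgb : ∀ᵐ x, ‖g x‖ ≤ ‖f‖ := by
    filter_upwards [hg, hb] with x h1 h2
    exact le_of_tendsto' h1.norm h2
  have hgL : MemLp g ∞ volume := memLp_top_of_bound hgm.aestronglyMeasurable _ hgb
  refine ⟨hgL.toLp g, ?_, ?_⟩
  · filter_upwards [hg, hgL.coeFn_toLp] with x h1 h2
    rwa [h2]
  · rw [Lp.norm_toLp, eLpNorm_exponent_top]
    refine ENNReal.toReal_le_of_le_ofReal (norm_nonneg f) ?_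
    exact eLpNormEssSup_le_of_ae_bound hgb

/-- Duality: the L_1-norm of Ag is its pairing with sign(Ag), and symmetry moves A onto the sign
function. Balls are used because the sign function need not lie in L_2. -/
theorem integral_abs_apply_le (hsym : ∀ u v, inner ℝ (A u) v = inner ℝ u (A v))
    (hbd : ∀ (u : L d 2) (c : ℝ), (∀ᵐ x, |u x| ≤ c) → ∀ᵐ x, |A u x| ≤ c) (g : L d 2)
    (hg : Integrable g) : Integrable (A g) ∧ ∫ x, |A g x| ≤ ∫ x, |g x| := by
  have hbound : ∀ n : ℕ, ∫ x in Metric.ball (0 : E d) n, |A g x| ≤ ∫ x, |g x| := by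
    intro n
    have hm : AEStronglyMeasurable (fun x => (SignType.sign (A g x) : ℝ)) volume := by
      have : Measurable fun y : ℝ => (SignType.sign y : ℝ) := by
        have h : (fun y : ℝ => (SignType.sign y : ℝ)) =
            fun y => if 0 < y then 1 else if y < 0 then -1 else 0 := by
          funext y
          rw [sign_apply]
          split_ifs <;> simp
        rw [h]
        exact Measurable.ite measurableSet_Ioi measurable_const
          (Measurable.ite measurableSet_Iio measurable_const measurable_const)
      exact (this.comp_aemeasurable
        (Lp.aestronglyMeasurable (A g)).aemeasurable).aestronglyMeasurable
    have hs1 : ∀ y : ℝ, |(SignType.sign y : ℝ)| ≤ 1 := fun y => by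
      rw [sign_apply]
      split_ifs <;> simp
    have hsL : MemLp (fun x => (SignType.sign (A g x) : ℝ)) ∞ (volume : Measure (E d)) :=
      memLp_top_of_bound hm 1 (Eventually.of_forall fun x => hs1 _)
    set s : L d ∞ := hsL.toLp _
    have h1 : ∫ x in Metric.ball (0 : E d) n, |A g x| = inner ℝ (truncate n s) (A g) := by
      rw [inner_eq_integral, ← integral_indicator Metric.isOpen_ball.measurableSet]
      refine integral_congr_ae ?_
      filter_upwards [coeFn_truncate n s, hsL.coeFn_toLp] with x h1 h2
      rw [h1, Set.indicator_apply, Set.indicator_apply, h2]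
      split_ifs
      · exact (sign_mul_self _).symm
      · simp
    rw [h1, ← hsym, inner_eq_integral]
    have h2 : ∀ᵐ x, |A (truncate n s) x| ≤ 1 := by
      refine hbd _ 1 ?_
      filter_upwards [coeFn_truncate n s, hsL.coeFn_toLp] with x h1 h2
      rw [h1, Set.indicator_apply, h2]
      split_ifs
      · exact hs1 _
      · simp
    refine integral_mono_ae (integrable_mul_L2 _ _) hg.abs ?_
    filter_upwards [h2] with x hx
    refine (le_abs_self _).trans ?_
    rw [abs_mul]
    exact mul_le_of_le_one_left (abs_nonneg _) hx
  have hcov : AECover (volume : Measure (E d)) atTop fun n : ℕ => Metric.ball (0 : E d) n :=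
    aecover_ball tendsto_natCast_atTop_atTop
  have hintg : Integrable (A g) := by
    refine hcov.integrable_of_integral_norm_bounded (∫ x, |g x|) (fun n => ?_)
      (Eventually.of_forall hbound)
    have : IsFiniteMeasure ((volume : Measure (E d)).restrict (Metric.ball (0 : E d) n)) :=
      ⟨by simpa using Metric.isBounded_ball.measure_lt_top⟩
    exact ((Lp.memLp (A g)).restrict _).integrable one_le_two
  exact ⟨hintg, le_of_tendsto' (hcov.integral_tendsto_of_countably_generated hintg.abs) hbound⟩

/-- A symmetric, positivity preserving operator on `L_2` that is a contraction for the `L_∞`-norm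
extends to `L_∞`. -/
theorem exists_isLinftyExtension (hsym : ∀ u v, inner ℝ (A u) v = inner ℝ u (A v))
    (hpos : ∀ u : L d 2, 0 ≤ u → 0 ≤ A u)
    (hbd : ∀ (u : L d 2) (c : ℝ), (∀ᵐ x, |u x| ≤ c) → ∀ᵐ x, |A u x| ≤ c) :
    ∃ T : L d ∞ →L[ℝ] L d ∞, IsLinftyExtension A T := by
  choose F hF hFn using exists_limit_truncate hpos hbd
  let T : L d ∞ →L[ℝ] L d ∞ := LinearMap.mkContinuous
    { toFun := F
      map_add' := fun f g => by
        have hn : ∀ᵐ x, ∀ n : ℕ,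
            A (truncate n (f + g)) x = A (truncate n f) x + A (truncate n g) x := by
          rw [ae_all_iff]; intro n
          rw [truncate_add, map_add]
          exact Lp.coeFn_add _ _
        refine Lp.ext ?_
        filter_upwards [hF (f + g), hF f, hF g, hn, Lp.coeFn_add (F f) (F g)] with x h1 h2 h3 h4 h5
        rw [h5]
        exact tendsto_nhds_unique h1 ((h2.add h3).congr fun n => (h4 n).symm)
      map_smul' := fun c f => by
        have hn : ∀ᵐ x, ∀ n : ℕ, A (truncate n (c • f)) x = c • A (truncate n f) x := by
          rw [ae_all_iff]; intro n
          rw [truncate_smul, map_smul]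
          exact Lp.coeFn_smul _ _
        refine Lp.ext ?_
        filter_upwards [hF (c • f), hF f, hn, Lp.coeFn_smul c (F f)] with x h1 h2 h3 h4
        rw [RingHom.id_apply, h4]
        exact tendsto_nhds_unique h1 ((h2.const_smul c).congr fun n => (h3 n).symm) }
    1 (fun f => by simpa using hFn f)
  have hT : ∀ f, ∀ᵐ x, Tendsto (fun n => A (truncate n f) x) atTop (𝓝 (T f x)) := hF
  -- T is the transpose of A on L_1 ∩ L_2: symmetry for the truncations, then dominated convergence
  -- on both sides.
  have hpair : ∀ (g : L d 2), Integrable g → ∀ f : L d ∞,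
      ∫ x, T f x * g x = ∫ x, f x * A g x := by
    intro g hg f
    have hAg := (integral_abs_apply_le hsym hbd g hg).1
    have h1 : Tendsto (fun n => ∫ x, A (truncate n f) x * g x) atTop (𝓝 (∫ x, T f x * g x)) := by
      refine tendsto_integral_of_dominated_convergence (fun x => ‖f‖ * |g x|)
        (fun n => (integrable_mul_L2 _ _).aestronglyMeasurable) (hg.abs.const_mul _) ?_ ?_
      · intro n
        have : ∀ᵐ x, |A (truncate n f) x| ≤ ‖f‖ := by
          refine hbd _ _ ?_
          filter_upwards [coeFn_truncate n f, ae_abs_le_norm f] with x h1 h2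
          rw [h1, Set.indicator_apply]
          split_ifs
          · exact h2
          · simp
        filter_upwards [this] with x hx
        rw [Real.norm_eq_abs, abs_mul]
        gcongr
      · filter_upwards [hT f] with x hx
        exact hx.mul_const _
    have h2 : Tendsto (fun n => ∫ x, truncate n f x * A g x) atTop (𝓝 (∫ x, f x * A g x)) := by
      refine tendsto_integral_of_dominated_convergence (fun x => ‖f‖ * |A g x|)
        (fun n => (integrable_mul_L2 _ _).aestronglyMeasurable) (hAg.abs.const_mul _) ?_ ?_
      · intro n
        filter_upwards [coeFn_truncate n f, ae_abs_le_norm f] with x h1 h2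
        rw [h1, Set.indicator_apply, Real.norm_eq_abs, abs_mul]
        gcongr
        split_ifs
        · exact h2
        · simp
      · have hall : ∀ᵐ x, ∀ n : ℕ, truncate n f x = (Metric.ball (0 : E d) n).indicator f x :=
          ae_all_iff.2 fun n => coeFn_truncate n f
        filter_upwards [hall] with x hx
        refine Tendsto.mul_const _ (tendsto_const_nhds.congr' ?_)
        obtain ⟨N, hN⟩ := exists_nat_gt ‖x‖
        filter_upwards [eventually_ge_atTop N] with n hn
        have hNn : (N : ℝ) ≤ n := by exact_mod_cast hn
        rw [hx, Set.indicator_of_mem (mem_ball_zero_iff.2 (hN.trans_le hNn))]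
    refine tendsto_nhds_unique h1 (h2.congr fun n => ?_)
    rw [← inner_eq_integral, ← inner_eq_integral, hsym]
  refine ⟨T, ⟨fun u f huf => ?_, fun g => ?_⟩⟩
  · refine ae_eq_of_integral_contDiff_smul_eq
      ((Lp.memLp (A u)).locallyIntegrable one_le_two)
      ((Lp.memLp (T f)).locallyIntegrable le_top) fun η hη hηc => ?_
    have hη2 : MemLp η 2 (volume : Measure (E d)) :=
      hη.continuous.memLp_of_hasCompactSupport hηc
    have hηi : Integrable (hη2.toLp η) := by
      rw [integrable_congr hη2.coeFn_toLp]
      exact hη.continuous.integrable_of_hasCompactSupport hηc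
    have h1 := hpair (hη2.toLp η) hηi f
    have h2 := hsym u (hη2.toLp η)
    rw [inner_eq_integral, inner_eq_integral] at h2
    have h3 : ∫ x, f x * A (hη2.toLp η) x = ∫ x, u x * A (hη2.toLp η) x := by
      refine integral_congr_ae ?_
      filter_upwards [huf] with x hx
      rw [hx]
    have h4 : ∀ w : E d → ℝ, ∫ x, η x • w x = ∫ x, w x * hη2.toLp η x := fun w => by
      refine integral_congr_ae ?_
      filter_upwards [hη2.coeFn_toLp] with x hx
      rw [hx, smul_eq_mul, mul_comm]
    rw [h4, h4, h2, h1, h3]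
  · let pr := ContinuousLinearMap.lpPairing (p := ∞) (q := 1) (volume : Measure (E d))
      (ContinuousLinearMap.mul ℝ ℝ)
    have hpr : ∀ (f : L d ∞) (g : L d 1), pr f g = ∫ x, f x * g x := fun f g =>
      ContinuousLinearMap.lpPairing_eq_integral _ f g
    -- The preadjoint on all of L_1 is built by density: g is approximated from L_1 ∩ L_2, and the
    -- images under A are Cauchy by the L_1-contraction.
    have hmem : ∀ n : ℕ, ∃ a : L d 1, dist g a < 1 / ((n : ℝ) + 1) ∧
        ∃ h : L d 2, a =ᵐ[volume] h := by
      intro n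
      obtain ⟨a, ⟨η, haη, hηc, hη⟩, hga⟩ :=
        (Lp.dense_hasCompactSupport_contDiff (F := ℝ) (μ := (volume : Measure (E d))) (p := 1)
          ENNReal.one_ne_top).exists_dist_lt g (Nat.one_div_pos_of_nat (n := n))
      have hη2 : MemLp η 2 (volume : Measure (E d)) :=
        hη.continuous.memLp_of_hasCompactSupport hηc
      exact ⟨a, hga, hη2.toLp η, haη.trans hη2.coeFn_toLp.symm⟩
    choose a ha h hah using hmem
    have hag : Tendsto a atTop (𝓝 g) := by
      rw [tendsto_iff_dist_tendsto_zero]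
      exact squeeze_zero (fun _ => dist_nonneg) (fun n => by rw [dist_comm]; exact (ha n).le)
        tendsto_one_div_add_atTop_nhds_zero_nat
    have hhi : ∀ n, Integrable (h n) := fun n =>
      (integrable_congr (hah n)).1 (L1.integrable_coeFn (a n))
    have hAh : ∀ n, MemLp (A (h n)) 1 volume := fun n =>
      memLp_one_iff_integrable.2 (integral_abs_apply_le hsym hbd (h n) (hhi n)).1
    let b : ℕ → L d 1 := fun n => (hAh n).toLp _
    have hb : ∀ n, b n =ᵐ[volume] A (h n) := fun n => (hAh n).coeFn_toLp
    have hdist : ∀ m n, dist (b m) (b n) ≤ dist (a m) (a n) := by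
      intro m n
      rw [dist_eq_norm, dist_eq_norm, L1.norm_eq_integral_norm, L1.norm_eq_integral_norm]
      have hdi : Integrable (h m - h n : L d 2) :=
        (integrable_congr (Lp.coeFn_sub (h m) (h n))).2 ((hhi m).sub (hhi n))
      have h1 := (integral_abs_apply_le hsym hbd (h m - h n) hdi).2
      have h2 : ∫ x, ‖(b m - b n : L d 1) x‖ = ∫ x, |A (h m - h n) x| := by
        refine integral_congr_ae ?_
        rw [map_sub]
        filter_upwards [Lp.coeFn_sub (b m) (b n), hb m, hb n, Lp.coeFn_sub (A (h m)) (A (h n))]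
          with x h3 h4 h5 h6
        rw [h3, h6, Pi.sub_apply, Pi.sub_apply, h4, h5, Real.norm_eq_abs]
      have h3 : ∫ x, ‖(a m - a n : L d 1) x‖ = ∫ x, |(h m - h n : L d 2) x| := by
        refine integral_congr_ae ?_
        filter_upwards [Lp.coeFn_sub (a m) (a n), hah m, hah n, Lp.coeFn_sub (h m) (h n)]
          with x h3 h4 h5 h6
        rw [h3, h6, Pi.sub_apply, Pi.sub_apply, h4, h5, Real.norm_eq_abs]
      rw [h2, h3]
      exact h1
    have hbc : CauchySeq b := by
      have := hag.cauchySeq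
      rw [Metric.cauchySeq_iff] at this ⊢
      intro ε hε
      obtain ⟨N, hN⟩ := this ε hε
      exact ⟨N, fun m hm n hn => (hdist m n).trans_lt (hN m hm n hn)⟩
    obtain ⟨g', hg'⟩ := cauchySeq_tendsto_of_complete hbc
    refine ⟨g', fun f => ?_⟩
    rw [← hpr, ← hpr]
    refine tendsto_nhds_unique (((pr (T f)).continuous.tendsto g).comp hag)
      ((((pr f).continuous.tendsto g').comp hg').congr fun n => ?_)
    rw [Function.comp_apply, Function.comp_apply, hpr, hpr]
    have h1 := hpair (h n) (hhi n) f
    have h2 : ∫ x, T f x * a n x = ∫ x, T f x * h n x := by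
      refine integral_congr_ae ?_
      filter_upwards [hah n] with x hx
      rw [hx]
    have h3 : ∫ x, f x * b n x = ∫ x, f x * A (h n) x := by
      refine integral_congr_ae ?_
      filter_upwards [hb n] with x hx
      rw [hx]
    rw [h2, h3, h1]

theorem IsLinftyExtension.id :
    IsLinftyExtension (ContinuousLinearMap.id ℝ (L d 2)) (ContinuousLinearMap.id ℝ (L d ∞)) :=
  ⟨fun _ _ h => h, fun g => ⟨g, fun _ => rfl⟩⟩

theorem IsLinftyExtension.comp {B : L d 2 →L[ℝ] L d 2} {T U : L d ∞ →L[ℝ] L d ∞}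
    (hA : IsLinftyExtension A T) (hB : IsLinftyExtension B U) :
    IsLinftyExtension (A.comp B) (T.comp U) := by
  refine ⟨fun u f h => hA.agrees _ _ (hB.agrees _ _ h), fun g => ?_⟩
  obtain ⟨g', hg'⟩ := hA.weakStar g
  obtain ⟨g'', hg''⟩ := hB.weakStar g'
  exact ⟨g'', fun f => (hg' (U f)).trans (hg'' f)⟩

end LinftyExtension

/-! ### Energy densities of Lipschitz functions -/

section Energy

open Gradient

variable {d : ℕ}

/-- The bilinear form on `ℝᵈ` given by the matrix `M`. -/
def cInner (M : Matrix (Fin d) (Fin d) ℝ) (a b : E d) : ℝ :=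
  inner ℝ a (Matrix.toEuclideanCLM (𝕜 := ℝ) M b)

theorem cInner_eq_sum (M : Matrix (Fin d) (Fin d) ℝ) (a b : E d) :
    cInner M a b = ∑ i, ∑ j, a i * (M i j * b j) := by
  rw [cInner, Matrix.inner_toEuclideanCLM]
  simp only [dotProduct, Matrix.mulVec, Finset.mul_sum]

/-! ### Algebra of the bilinear form of a matrix -/

section cInner

variable {M : Matrix (Fin d) (Fin d) ℝ} {a b c : E d}

theorem cInner_add_left : cInner M (a + b) c = cInner M a c + cInner M b c := inner_add_left _ _ _

theorem cInner_sub_left : cInner M (a - b) c = cInner M a c - cInner M b c := inner_sub_left _ _ _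

theorem cInner_smul_left (s : ℝ) : cInner M (s • a) b = s * cInner M a b :=
  real_inner_smul_left _ _ _

theorem cInner_add_right : cInner M a (b + c) = cInner M a b + cInner M a c := by
  simp [cInner, inner_add_right]

theorem cInner_sub_right : cInner M a (b - c) = cInner M a b - cInner M a c := by
  simp [cInner, inner_sub_right]

theorem cInner_smul_right (s : ℝ) : cInner M a (s • b) = s * cInner M a b := by
  simp [cInner, real_inner_smul_right]

theorem cInner_comm (hM : M.PosSemidef) : cInner M a b = cInner M b a := by
  rw [cInner_eq_sum, cInner_eq_sum, Finset.sum_comm]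
  refine Finset.sum_congr rfl fun i _ => Finset.sum_congr rfl fun j _ => ?_
  have := hM.isHermitian.apply i j
  rw [star_trivial] at this
  rw [this]
  ring

theorem cInner_self_nonneg (hM : M.PosSemidef) : 0 ≤ cInner M a a := by
  rw [cInner, Matrix.inner_toEuclideanCLM]
  simpa using hM.dotProduct_mulVec_nonneg a

theorem abs_cInner_le :
    |cInner M a b| ≤ ‖Matrix.toEuclideanCLM (𝕜 := ℝ) M‖ * (‖a‖ * ‖b‖) := by
  refine (abs_real_inner_le_norm _ _).trans ?_
  have := (Matrix.toEuclideanCLM (𝕜 := ℝ) M).le_opNorm b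
  nlinarith [norm_nonneg a]

end cInner

/-- A crude bound, from expanding ‖Mb‖² = (Mb, Mb) into d² terms. -/
theorem opNorm_le_of_entries {M : Matrix (Fin d) (Fin d) ℝ} {B : ℝ} (hB : 0 ≤ B)
    (h : ∀ i j, |M i j| ≤ B) : ‖Matrix.toEuclideanCLM (𝕜 := ℝ) M‖ ≤ d * d * B := by
  refine ContinuousLinearMap.opNorm_le_bound _ (by positivity) fun b => ?_
  set w := Matrix.toEuclideanCLM (𝕜 := ℝ) M b with hw
  have h1 : ‖w‖ ^ 2 = ∑ i, ∑ j, w i * (M i j * b j) := by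
    rw [← cInner_eq_sum, cInner, ← hw, real_inner_self_eq_norm_sq]
  have h2 : ∑ i, ∑ j, w i * (M i j * b j) ≤ ∑ _i : Fin d, ∑ _j : Fin d, ‖w‖ * (B * ‖b‖) := by
    refine Finset.sum_le_sum fun i _ => Finset.sum_le_sum fun j _ => ?_
    refine (le_abs_self _).trans ?_
    rw [abs_mul, abs_mul]
    have h3 : |w i| ≤ ‖w‖ := PiLp.norm_apply_le w i
    have h4 : |b j| ≤ ‖b‖ := PiLp.norm_apply_le b j
    have h5 := h i j
    gcongr
  simp only [Finset.sum_const, Finset.card_univ, Fintype.card_fin, nsmul_eq_mul] at h2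
  rcases eq_or_lt_of_le (norm_nonneg w) with h0 | h0
  · rw [← h0]; positivity
  · have : ‖w‖ * ‖w‖ ≤ ‖w‖ * (d * d * B * ‖b‖) := by nlinarith
    exact le_of_mul_le_mul_left this h0

variable {C : E d → Matrix (Fin d) (Fin d) ℝ}

namespace IsCoefficientMatrix

theorem aestronglyMeasurable (hC : IsCoefficientMatrix C) (i j : Fin d) :
    AEStronglyMeasurable (fun x => C x i j) volume := by
  have h : ∀ n : ℕ, AEStronglyMeasurable (fun x => C x i j)
      (volume.restrict (Metric.closedBall (0 : E d) n)) := fun n =>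
    (hC.locallyBounded i j _ (isCompact_closedBall 0 n)).1
  have := aestronglyMeasurable_iUnion_iff.2 h
  rwa [Metric.iUnion_closedBall_nat, Measure.restrict_univ] at this

theorem exists_opNorm_bound (hC : IsCoefficientMatrix C) {K : Set (E d)} (hK : IsCompact K) :
    ∃ M : ℝ, 0 ≤ M ∧ ∀ᵐ x, x ∈ K → ‖Matrix.toEuclideanCLM (𝕜 := ℝ) (C x)‖ ≤ M := by
  have h : ∀ i j, ∃ B : ℝ, 0 ≤ B ∧ ∀ᵐ x, x ∈ K → |C x i j| ≤ B := by
    intro i j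
    have hL := hC.locallyBounded i j K hK
    refine ⟨(eLpNormEssSup (fun x => C x i j) (volume.restrict K)).toReal,
      ENNReal.toReal_nonneg, ?_⟩
    rw [← ae_restrict_iff' hK.measurableSet]
    have hne := hL.2.ne
    rw [eLpNorm_exponent_top] at hne
    filter_upwards [ae_le_eLpNormEssSup (f := fun x => C x i j) (μ := volume.restrict K)] with x hx
    rw [← Real.norm_eq_abs, ← toReal_enorm]
    exact ENNReal.toReal_mono hne hx
  choose B hB hBx using h
  refine ⟨d * d * ∑ i, ∑ j, B i j, ?_, ?_⟩
  · have : 0 ≤ ∑ i, ∑ j, B i j := Finset.sum_nonneg fun i _ => Finset.sum_nonneg fun j _ => hB i j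
    positivity
  · have hall : ∀ᵐ x, ∀ i j, x ∈ K → |C x i j| ≤ B i j :=
      ae_all_iff.2 fun i => ae_all_iff.2 fun j => hBx i j
    filter_upwards [hall] with x hx hxK
    refine opNorm_le_of_entries
      (Finset.sum_nonneg fun i _ => Finset.sum_nonneg fun j _ => hB i j) fun i j => ?_
    refine (hx i j hxK).trans ?_
    refine (Finset.single_le_sum (f := fun j => B i j) (fun j _ => hB i j)
      (Finset.mem_univ j)).trans ?_
    exact Finset.single_le_sum (f := fun i => ∑ j, B i j)
      (fun i _ => Finset.sum_nonneg fun j _ => hB i j) (Finset.mem_univ i)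

theorem aestronglyMeasurable_cInner (hC : IsCoefficientMatrix C) {a b : E d → E d}
    (ha : AEStronglyMeasurable a volume) (hb : AEStronglyMeasurable b volume) :
    AEStronglyMeasurable (fun x => cInner (C x) (a x) (b x)) volume := by
  simp only [cInner_eq_sum]
  have hcoord : ∀ {a : E d → E d}, AEStronglyMeasurable a volume → ∀ i,
      AEStronglyMeasurable (fun x => a x i) volume := fun {a} ha i =>
    (EuclideanSpace.proj (𝕜 := ℝ) i).continuous.comp_aestronglyMeasurable ha
  refine Finset.aestronglyMeasurable_fun_sum _ fun i _ =>
    Finset.aestronglyMeasurable_fun_sum _ fun j _ => ?_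
  exact (hcoord ha i).mul ((hC.aestronglyMeasurable i j).mul (hcoord hb j))

theorem integrable_cInner (hC : IsCoefficientMatrix C) {a b : E d → E d}
    (ha : MemLp a 2 volume) (hb : MemLp b 2 volume) {K : Set (E d)} (hK : IsCompact K)
    (ha0 : ∀ᵐ x, x ∉ K → a x = 0) : Integrable fun x => cInner (C x) (a x) (b x) := by
  obtain ⟨M, hM, hMx⟩ := hC.exists_opNorm_bound hK
  refine Integrable.mono' ((ha.norm.integrable_mul hb.norm).const_mul M)
    (hC.aestronglyMeasurable_cInner ha.1 hb.1) ?_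
  filter_upwards [hMx, ha0] with x h1 h2
  by_cases hx : x ∈ K
  · refine abs_cInner_le.trans ?_
    exact mul_le_mul_of_nonneg_right (h1 hx) (by positivity)
  · have h3 : cInner (C x) (a x) (b x) = 0 := by simp [cInner, h2 hx]
    rw [h3, norm_zero]
    simp only [Pi.mul_apply]
    positivity

end IsCoefficientMatrix

/-- Lipschitz continuous functions with compact support. -/
def IsLipc (f : E d → ℝ) : Prop := (∃ K, LipschitzWith K f) ∧ HasCompactSupport f

/-- The energy density `∑ ∂_i f c_ij ∂_j g`. -/
def energyDensity (C : E d → Matrix (Fin d) (Fin d) ℝ) (f g : E d → ℝ) (x : E d) : ℝ :=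
  cInner (C x) (∇ f x) (∇ g x)

/-- The energy form `∑ (∂_i f, c_ij ∂_j g)`. -/
def energy (C : E d → Matrix (Fin d) (Fin d) ℝ) (f g : E d → ℝ) : ℝ :=
  ∫ x, energyDensity C f g x

/-! ### Calculus of pointwise gradients and Lipschitz functions -/

theorem gradient_add {f g : E d → ℝ} {x : E d} (hf : DifferentiableAt ℝ f x)
    (hg : DifferentiableAt ℝ g x) : ∇ (fun y => f y + g y) x = ∇ f x + ∇ g x := by
  simp only [gradient]
  rw [fderiv_fun_add hf hg, map_add]

theorem gradient_sub {f g : E d → ℝ} {x : E d} (hf : DifferentiableAt ℝ f x)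
    (hg : DifferentiableAt ℝ g x) : ∇ (fun y => f y - g y) x = ∇ f x - ∇ g x := by
  simp only [gradient]
  rw [fderiv_fun_sub hf hg, map_sub]

theorem gradient_mul {f g : E d → ℝ} {x : E d} (hf : DifferentiableAt ℝ f x)
    (hg : DifferentiableAt ℝ g x) :
    ∇ (fun y => f y * g y) x = f x • ∇ g x + g x • ∇ f x := by
  simp only [gradient]
  rw [fderiv_fun_mul hf hg, map_add, map_smulₛₗ, map_smulₛₗ]
  simp

theorem gradient_const_mul {f : E d → ℝ} {x : E d} (c : ℝ) (hf : DifferentiableAt ℝ f x) :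
    ∇ (fun y => c * f y) x = c • ∇ f x := by
  rw [gradient_mul (differentiableAt_const c) hf]
  simp [gradient]

theorem norm_gradient (f : E d → ℝ) (x : E d) : ‖∇ f x‖ = ‖fderiv ℝ f x‖ := by
  simp [gradient]

theorem gradient_apply (f : E d → ℝ) (x : E d) (i : Fin d) :
    ∇ f x i = fderiv ℝ f x (EuclideanSpace.single i 1) := by
  rw [← inner_gradient_left, EuclideanSpace.inner_single_right]
  simp

theorem measurable_gradient (f : E d → ℝ) : Measurable (∇ f) :=
  (InnerProductSpace.toDual ℝ (E d)).symm.continuous.measurable.comp (measurable_fderiv ℝ f)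

theorem gradient_eq_zero_of_notMem_tsupport {f : E d → ℝ} {x : E d} (hx : x ∉ tsupport f) :
    ∇ f x = 0 := by
  have h : fderiv ℝ f x = 0 := by
    by_contra hne
    exact hx (support_fderiv_subset ℝ hne)
  rw [gradient, h, map_zero]

theorem ae_differentiableAt_of_lipschitz {f : E d → ℝ} {K : ℝ≥0} (hf : LipschitzWith K f) :
    ∀ᵐ x, DifferentiableAt ℝ f x := hf.ae_differentiableAt_of_real

namespace IsLipc

variable {f g : E d → ℝ}

theorem continuous (hf : IsLipc f) : Continuous f := hf.1.choose_spec.continuous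

theorem ae_differentiableAt (hf : IsLipc f) : ∀ᵐ x, DifferentiableAt ℝ f x :=
  ae_differentiableAt_of_lipschitz hf.1.choose_spec

theorem memLp (hf : IsLipc f) (p : ℝ≥0∞) : MemLp f p (volume : Measure (E d)) :=
  hf.continuous.memLp_of_hasCompactSupport hf.2

theorem memLp_gradient (hf : IsLipc f) : MemLp (∇ f) 2 (volume : Measure (E d)) := by
  obtain ⟨K, hK⟩ := hf.1
  have hb : ∀ x, ‖∇ f x‖ ≤ K := fun x => by
    rw [norm_gradient]
    exact norm_fderiv_le_of_lipschitz ℝ hK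
  have h1 : MemLp (∇ f) 2 (volume.restrict (tsupport f)) := by
    have : IsFiniteMeasure ((volume : Measure (E d)).restrict (tsupport f)) :=
      ⟨by simpa using hf.2.measure_lt_top⟩
    exact MemLp.of_bound (measurable_gradient f).aestronglyMeasurable K (Eventually.of_forall hb)
  have h2 : (tsupport f).indicator (∇ f) = ∇ f := by
    rw [Set.indicator_eq_self]
    intro x hx
    by_contra hn
    exact hx (gradient_eq_zero_of_notMem_tsupport hn)
  rw [← h2, memLp_indicator_iff_restrict (isClosed_tsupport f).measurableSet]
  exact h1

theorem add (hf : IsLipc f) (hg : IsLipc g) : IsLipc fun x => f x + g x := by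
  obtain ⟨⟨K, hK⟩, hfc⟩ := hf
  obtain ⟨⟨K', hK'⟩, hgc⟩ := hg
  exact ⟨⟨_, hK.add hK'⟩, hfc.add hgc⟩

theorem const_mul (hf : IsLipc f) (c : ℝ) : IsLipc fun x => c * f x := by
  obtain ⟨⟨K, hK⟩, hfc⟩ := hf
  refine ⟨⟨‖c‖₊ * K, ?_⟩, hfc.mul_left⟩
  refine LipschitzWith.of_dist_le_mul fun x y => ?_
  rw [Real.dist_eq, ← mul_sub, abs_mul, NNReal.coe_mul, coe_nnnorm, Real.norm_eq_abs, mul_assoc]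
  gcongr
  rw [← Real.dist_eq]
  exact hK.dist_le_mul x y

theorem sub (hf : IsLipc f) (hg : IsLipc g) : IsLipc fun x => f x - g x := by
  simpa [sub_eq_add_neg] using hf.add (hg.const_mul (-1))

/-- The product with a bounded Lipschitz function. -/
theorem bounded_mul (hf : IsLipc f) {ψ : E d → ℝ} {K : ℝ≥0} (hψ : LipschitzWith K ψ) {B : ℝ}
    (hB : ∀ x, |ψ x| ≤ B) : IsLipc fun x => ψ x * f x := by
  obtain ⟨⟨K', hK'⟩, hfc⟩ := hf
  obtain ⟨A, hA⟩ := hfc.exists_bound_of_continuous hK'.continuous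
  have hA0 : 0 ≤ A := (norm_nonneg _).trans (hA 0)
  have hB0 : 0 ≤ B := (abs_nonneg _).trans (hB 0)
  refine ⟨⟨B.toNNReal * K' + A.toNNReal * K, ?_⟩, hfc.mul_left⟩
  refine LipschitzWith.of_dist_le_mul fun x y => ?_
  have h1 : |f x - f y| ≤ K' * dist x y := by rw [← Real.dist_eq]; exact hK'.dist_le_mul x y
  have h2 : |ψ x - ψ y| ≤ K * dist x y := by rw [← Real.dist_eq]; exact hψ.dist_le_mul x y
  have e : ψ x * f x - ψ y * f y = ψ x * (f x - f y) + f y * (ψ x - ψ y) := by ring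
  rw [Real.dist_eq, e]
  refine (abs_add_le _ _).trans ?_
  rw [abs_mul, abs_mul]
  have h3 : |ψ x| * |f x - f y| ≤ B * (K' * dist x y) := by
    gcongr
    exact hB x
  have h4 : |f y| * |ψ x - ψ y| ≤ A * (K * dist x y) := by
    gcongr
    exact hA y
  refine (add_le_add h3 h4).trans (le_of_eq ?_)
  push_cast
  rw [Real.coe_toNNReal B hB0, Real.coe_toNNReal A hA0]
  ring

/-- Composition with a Lipschitz function that vanishes at `0`. -/
theorem comp (hf : IsLipc f) {F : ℝ → ℝ} {K : ℝ≥0} (hF : LipschitzWith K F) (hF0 : F 0 = 0) :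
    IsLipc fun x => F (f x) := by
  obtain ⟨⟨K', hK'⟩, hfc⟩ := hf
  exact ⟨⟨_, hF.comp hK'⟩, hfc.comp_left hF0⟩

theorem integrable_energyDensity (hC : IsCoefficientMatrix C) (hf : IsLipc f) (hg : IsLipc g) :
    Integrable (energyDensity C f g) :=
  hC.integrable_cInner hf.memLp_gradient hg.memLp_gradient hf.2
    (Eventually.of_forall fun _ hx => gradient_eq_zero_of_notMem_tsupport hx)

theorem energy_nonneg (hC : IsCoefficientMatrix C) (f : E d → ℝ) :
    0 ≤ energy C f f :=
  integral_nonneg_of_ae (hC.posSemidef.mono fun _ hx => cInner_self_nonneg hx)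

end IsLipc

/-! ### The form on Lipschitz functions with compact support -/

open Classical in
/-- The energy form with domain the Lipschitz functions with compact support. -/
def lipForm (C : E d → Matrix (Fin d) (Fin d) ℝ) (u : L d 2) : ℝ≥0∞ :=
  if h : ∃ f : E d → ℝ, IsLipc f ∧ u =ᵐ[volume] f then
    ENNReal.ofReal (energy C h.choose h.choose) else ∞

/-- The chosen representative is irrelevant, since continuous functions that agree almost everywhere
are equal. -/
theorem lipForm_eq {u : L d 2} {f : E d → ℝ} (hf : IsLipc f) (hu : u =ᵐ[volume] f) :
    lipForm C u = ENNReal.ofReal (energy C f f) := by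
  have h : ∃ f : E d → ℝ, IsLipc f ∧ u =ᵐ[volume] f := ⟨f, hf, hu⟩
  have he : h.choose = f :=
    (Continuous.ae_eq_iff_eq volume h.choose_spec.1.continuous hf.continuous).1
      (h.choose_spec.2.symm.trans hu)
  rw [lipForm, dif_pos h, he]

theorem lipForm_ne_top_iff {u : L d 2} :
    lipForm C u ≠ ∞ ↔ ∃ f : E d → ℝ, IsLipc f ∧ u =ᵐ[volume] f := by
  constructor
  · intro h
    by_contra hn
    exact h (by rw [lipForm, dif_neg hn])
  · rintro ⟨f, hf, hu⟩
    rw [lipForm_eq hf hu]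
    exact ENNReal.ofReal_ne_top

theorem coeFn_add_of {u v : L d 2} {f g : E d → ℝ} (hu : u =ᵐ[volume] f) (hv : v =ᵐ[volume] g) :
    (u + v : L d 2) =ᵐ[volume] fun x => f x + g x :=
  (Lp.coeFn_add u v).trans (hu.add hv)

theorem coeFn_sub_of {u v : L d 2} {f g : E d → ℝ} (hu : u =ᵐ[volume] f) (hv : v =ᵐ[volume] g) :
    (u - v : L d 2) =ᵐ[volume] fun x => f x - g x :=
  (Lp.coeFn_sub u v).trans (hu.sub hv)

theorem coeFn_smul_of {u : L d 2} {f : E d → ℝ} (c : ℝ) (hu : u =ᵐ[volume] f) :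
    (c • u : L d 2) =ᵐ[volume] fun x => c * f x := by
  filter_upwards [Lp.coeFn_smul c u, hu] with x h1 h2
  rw [h1, Pi.smul_apply, h2, smul_eq_mul]

theorem energy_add_sub (hC : IsCoefficientMatrix C) {f g : E d → ℝ} (hf : IsLipc f)
    (hg : IsLipc g) :
    energy C (fun x => f x + g x) (fun x => f x + g x) =
        energy C f f + 2 * energy C f g +
          energy C g g ∧
      energy C (fun x => f x - g x) (fun x => f x - g x) =
        energy C f f - 2 * energy C f g +
          energy C g g := by
  have h1 := hf.integrable_energyDensity hC hf
  have h2 := hf.integrable_energyDensity hC hg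
  have h3 := hg.integrable_energyDensity hC hg
  simp only [energy]
  constructor
  · rw [← integral_const_mul, ← integral_add h1 (h2.const_mul 2),
      ← integral_add (f := fun x => energyDensity C f f x + 2 * energyDensity C f g x)
        (h1.add (h2.const_mul 2)) h3]
    refine integral_congr_ae ?_
    filter_upwards [hC.posSemidef, hf.ae_differentiableAt, hg.ae_differentiableAt] with x hx hd hd'
    simp only [energyDensity, gradient_add hd hd', cInner_add_left, cInner_add_right,
      cInner_comm hx (a := ∇ g x) (b := ∇ f x)]
    ring
  · rw [← integral_const_mul, ← integral_sub h1 (h2.const_mul 2),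
      ← integral_add (f := fun x => energyDensity C f f x - 2 * energyDensity C f g x)
        (h1.sub (h2.const_mul 2)) h3]
    refine integral_congr_ae ?_
    filter_upwards [hC.posSemidef, hf.ae_differentiableAt, hg.ae_differentiableAt] with x hx hd hd'
    simp only [energyDensity, gradient_sub hd hd', cInner_sub_left, cInner_sub_right,
      cInner_comm hx (a := ∇ g x) (b := ∇ f x)]
    ring

theorem energy_const_mul {f : E d → ℝ} (hf : IsLipc f) (c : ℝ) :
    energy C (fun x => c * f x) (fun x => c * f x) =
      c ^ 2 * energy C f f := by
  rw [energy, energy, ← integral_const_mul]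
  refine integral_congr_ae ?_
  filter_upwards [hf.ae_differentiableAt] with x hd
  simp only [energyDensity, gradient_const_mul c hd, cInner_smul_left, cInner_smul_right]
  ring

theorem isQuadraticForm_lipForm (hC : IsCoefficientMatrix C) : IsQuadraticForm (lipForm C) := by
  have hsmul : ∀ (c : ℝ) (u : L d 2), lipForm C u ≠ ∞ →
      lipForm C (c • u) = ENNReal.ofReal (c ^ 2) * lipForm C u := by
    intro c u hu
    obtain ⟨f, hf, huf⟩ := lipForm_ne_top_iff.1 hu
    rw [lipForm_eq hf huf, lipForm_eq (hf.const_mul c) (coeFn_smul_of c huf),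
      energy_const_mul hf, ENNReal.ofReal_mul (sq_nonneg c)]
  have hadd : ∀ u v : L d 2, lipForm C u ≠ ∞ → lipForm C v ≠ ∞ → lipForm C (u + v) ≠ ∞ := by
    intro u v hu hv
    obtain ⟨f, hf, huf⟩ := lipForm_ne_top_iff.1 hu
    obtain ⟨g, hg, hvg⟩ := lipForm_ne_top_iff.1 hv
    exact lipForm_ne_top_iff.2 ⟨_, hf.add hg, coeFn_add_of huf hvg⟩
  have hsub : ∀ u v : L d 2, lipForm C u ≠ ∞ → lipForm C v ≠ ∞ → lipForm C (u - v) ≠ ∞ := by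
    intro u v hu hv
    obtain ⟨f, hf, huf⟩ := lipForm_ne_top_iff.1 hu
    obtain ⟨g, hg, hvg⟩ := lipForm_ne_top_iff.1 hv
    exact lipForm_ne_top_iff.2 ⟨_, hf.sub hg, coeFn_sub_of huf hvg⟩
  have hs : ∀ (c : ℝ) (u : L d 2), lipForm C u ≠ ∞ → lipForm C (c • u) ≠ ∞ := by
    intro c u hu
    rw [hsmul c u hu]
    exact ENNReal.mul_ne_top ENNReal.ofReal_ne_top hu
  refine ⟨fun c u => ?_, fun u v => ?_⟩
  · by_cases hu : lipForm C u = ∞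
    · rcases eq_or_ne c 0 with rfl | hc
      · have h0 : lipForm C (0 : L d 2) ≠ ∞ := lipForm_ne_top_iff.2
          ⟨fun _ => 0, ⟨⟨0, LipschitzWith.const 0⟩, HasCompactSupport.zero⟩, Lp.coeFn_zero _ _ _⟩
        have := hsmul 0 0 h0
        rw [smul_zero] at this
        rw [zero_smul, this]
        simp
      · rw [hu, ENNReal.mul_top (by simp; positivity)]
        by_contra hne
        have := hs c⁻¹ _ hne
        rw [smul_smul, inv_mul_cancel₀ hc, one_smul] at this
        exact this hu
    · exact hsmul c u hu
  · by_cases hu : lipForm C u ≠ ∞ ∧ lipForm C v ≠ ∞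
    · obtain ⟨f, hf, huf⟩ := lipForm_ne_top_iff.1 hu.1
      obtain ⟨g, hg, hvg⟩ := lipForm_ne_top_iff.1 hu.2
      obtain ⟨e1, e2⟩ := energy_add_sub hC hf hg
      rw [lipForm_eq hf huf, lipForm_eq hg hvg, lipForm_eq (hf.add hg) (coeFn_add_of huf hvg),
        lipForm_eq (hf.sub hg) (coeFn_sub_of huf hvg),
        ← ENNReal.ofReal_add (IsLipc.energy_nonneg hC _) (IsLipc.energy_nonneg hC _), e1, e2]
      have h2 : ∀ r : ℝ, 2 * ENNReal.ofReal r = ENNReal.ofReal (2 * r) := fun r => by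
        rw [ENNReal.ofReal_mul (by norm_num), ENNReal.ofReal_ofNat]
      rw [h2, h2, ← ENNReal.ofReal_add (mul_nonneg (by norm_num) (IsLipc.energy_nonneg hC _))
          (mul_nonneg (by norm_num) (IsLipc.energy_nonneg hC _))]
      congr 1
      ring
    -- If u + v and u - v were both in the domain, half their sum and half their difference would be
    -- too, and these are u and v.
    · have hr : 2 * lipForm C u + 2 * lipForm C v = ∞ := by
        rw [not_and_or, not_not, not_not] at hu
        rcases hu with h | h <;> simp [h]
      rw [hr]
      by_contra hne
      have h1 : lipForm C (u + v) ≠ ∞ := fun h => hne (by simp [h])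
      have h2 : lipForm C (u - v) ≠ ∞ := fun h => hne (by simp [h])
      refine hu ⟨?_, ?_⟩
      · have := hs 2⁻¹ _ (hadd _ _ h1 h2)
        rwa [add_add_sub_cancel, ← two_smul ℝ u, smul_smul, inv_mul_cancel₀ two_ne_zero,
          one_smul] at this
      · have := hs 2⁻¹ _ (hsub _ _ h1 h2)
        rwa [add_sub_sub_cancel, ← two_smul ℝ v, smul_smul, inv_mul_cancel₀ two_ne_zero,
          one_smul] at this

theorem polar_lipForm (hC : IsCoefficientMatrix C) {u v : L d 2} {f g : E d → ℝ}
    (hf : IsLipc f) (hg : IsLipc g) (hu : u =ᵐ[volume] f) (hv : v =ᵐ[volume] g) :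
    polar (lipForm C) u v = energy C f g := by
  obtain ⟨e1, e2⟩ := energy_add_sub hC hf hg
  rw [polar, lipForm_eq (hf.add hg) (coeFn_add_of hu hv),
    lipForm_eq (hf.sub hg) (coeFn_sub_of hu hv),
    ENNReal.toReal_ofReal (IsLipc.energy_nonneg hC _),
    ENNReal.toReal_ofReal (IsLipc.energy_nonneg hC _), e1, e2]
  ring

theorem dense_lipForm (C : E d → Matrix (Fin d) (Fin d) ℝ) :
    Dense {u : L d 2 | lipForm C u ≠ ∞} := by
  refine (Lp.dense_hasCompactSupport_contDiff (F := ℝ) (μ := (volume : Measure (E d))) (p := 2)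
    ENNReal.ofNat_ne_top).mono ?_
  rintro u ⟨g, hug, hgc, hg⟩
  exact lipForm_ne_top_iff.2 ⟨g, ⟨⟨_, (ContDiff.lipschitzWith_of_hasCompactSupport hgc hg
    (by simp)).choose_spec⟩, hgc⟩, hug⟩

end Energy

/-! ### Weak gradients -/

section WeakGradient

open Gradient

variable {d : ℕ} {C : E d → Matrix (Fin d) (Fin d) ℝ}

theorem memLp_coord (G : Lp (E d) 2 (volume : Measure (E d))) (i : Fin d) :
    MemLp (fun x => G x i) 2 volume :=
  MemLp.eval_piLp (Lp.memLp G) i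

theorem IsWeakGradient.unique {u : L d 2} {G G' : Lp (E d) 2 (volume : Measure (E d))}
    (hG : IsWeakGradient u G) (hG' : IsWeakGradient u G') : G = G' := by
  have h : ∀ i, ∀ᵐ x, G x i = G' x i := fun i => by
    refine ae_eq_of_integral_contDiff_smul_eq ((memLp_coord G i).locallyIntegrable one_le_two)
      ((memLp_coord G' i).locallyIntegrable one_le_two) fun η hη hηc => ?_
    have h1 := hG η hη hηc i
    rw [hG' η hη hηc i, neg_inj] at h1
    simp only [smul_eq_mul, mul_comm (η _)]
    exact h1.symm
  refine Lp.ext ?_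
  filter_upwards [ae_all_iff.2 h] with x hx
  ext i
  exact hx i

theorem weakGradient_eq {u : L d 2} {G : Lp (E d) 2 (volume : Measure (E d))}
    (hG : IsWeakGradient u G) : weakGradient u = G := by
  have h : ∃ G, IsWeakGradient u G := ⟨G, hG⟩
  rw [weakGradient, dif_pos h]
  exact h.choose_spec.unique hG

theorem IsWeakGradient.ae_eq_zero {u : L d 2} {G : Lp (E d) 2 (volume : Measure (E d))}
    (hG : IsWeakGradient u G) {K : Set (E d)} (hK : IsCompact K)
    (hu : ∀ᵐ x, x ∉ K → u x = 0) : ∀ᵐ x, x ∉ K → G x = 0 := by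
  have h : ∀ i, ∀ᵐ x, x ∈ Kᶜ → G x i = 0 := fun i => by
    refine hK.isClosed.isOpen_compl.ae_eq_zero_of_integral_contDiff_smul_eq_zero
      (((memLp_coord G i).locallyIntegrable one_le_two).locallyIntegrableOn _)
      fun η hη hηc hsupp => ?_
    have h1 := hG η hη hηc i
    have h2 : ∫ x, u x * fderiv ℝ η x (EuclideanSpace.single i 1) = 0 := by
      rw [← integral_zero (E d) ℝ]
      refine integral_congr_ae ?_
      filter_upwards [hu] with x hx
      by_cases hxK : x ∈ K
      · have : x ∉ tsupport η := fun h => hsupp h hxK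
        have h3 : fderiv ℝ η x = 0 := by
          by_contra hne
          exact this (support_fderiv_subset ℝ hne)
        simp [h3]
      · simp [hx hxK]
    rw [h2] at h1
    simp only [smul_eq_mul, mul_comm (η _)]
    linarith
  filter_upwards [ae_all_iff.2 h] with x hx hxK
  ext i
  exact hx i hxK

/-- Rademacher's theorem and integration by parts for line derivatives of Lipschitz functions. -/
theorem IsLipc.isWeakGradient {f : E d → ℝ} (hf : IsLipc f) {u : L d 2} (hu : u =ᵐ[volume] f) :
    IsWeakGradient u hf.memLp_gradient.toLp := by
  intro η hη hηc i
  obtain ⟨K, hK⟩ := hf.1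
  obtain ⟨K', hK'⟩ := ContDiff.lipschitzWith_of_hasCompactSupport hηc hη (by simp)
  have h := hK.integral_lineDeriv_mul_eq (μ := (volume : Measure (E d))) hK' hηc
    (EuclideanSpace.single i 1)
  have h1 : ∫ x, u x * fderiv ℝ η x (EuclideanSpace.single i 1) =
      -∫ x, lineDeriv ℝ η x (-(EuclideanSpace.single i 1)) * f x := by
    rw [← integral_neg]
    refine integral_congr_ae ?_
    filter_upwards [hu] with x hx
    rw [hx, ((hη.differentiable (by simp)).differentiableAt).lineDeriv_eq_fderiv, map_neg]
    ring
  rw [h1, ← h]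
  congr 1
  refine integral_congr_ae ?_
  filter_upwards [hf.ae_differentiableAt, hf.memLp_gradient.coeFn_toLp] with x hd hx
  rw [hx, gradient_apply, hd.lineDeriv_eq_fderiv]

theorem sum_integral_eq_integral_cInner (hC : IsCoefficientMatrix C)
    (G : Lp (E d) 2 (volume : Measure (E d))) {K : Set (E d)} (hK : IsCompact K)
    (hG : ∀ᵐ x, x ∉ K → G x = 0) :
    ∑ i, ∑ j, ∫ x, G x i * (C x i j * G x j) = ∫ x, cInner (C x) (G x) (G x) := by
  obtain ⟨M, hM, hMx⟩ := hC.exists_opNorm_bound hK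
  have hintg : ∀ i j, Integrable fun x => G x i * (C x i j * G x j) := by
    intro i j
    have hn := (Lp.memLp G).norm
    refine Integrable.mono' ((hn.integrable_mul hn).const_mul M)
      ((memLp_coord G i).1.mul ((hC.aestronglyMeasurable i j).mul (memLp_coord G j).1)) ?_
    filter_upwards [hMx, hG] with x h1 h2
    simp only [Pi.mul_apply]
    by_cases hx : x ∈ K
    · have h3 : |C x i j| ≤ M := by
        refine le_trans ?_ (h1 hx)
        have h4 := abs_cInner_le (M := C x) (a := EuclideanSpace.single i 1)
          (b := EuclideanSpace.single j 1)
        simpa [cInner_eq_sum, Pi.single_apply] using h4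
      have h5 : |G x i| ≤ ‖G x‖ := PiLp.norm_apply_le (G x) i
      have h6 : |G x j| ≤ ‖G x‖ := PiLp.norm_apply_le (G x) j
      rw [Real.norm_eq_abs, abs_mul, abs_mul]
      calc |G x i| * (|C x i j| * |G x j|) ≤ ‖G x‖ * (M * ‖G x‖) := by gcongr
        _ = M * (‖G x‖ * ‖G x‖) := by ring
    · simp [h2 hx]
  simp only [cInner_eq_sum]
  rw [integral_finsetSum _ fun i _ => integrable_finsetSum _ fun j _ => hintg i j]
  refine Finset.sum_congr rfl fun i _ => ?_
  rw [integral_finsetSum _ fun j _ => hintg i j]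

theorem form_eq (hC : IsCoefficientMatrix C) {u : L d 2}
    {G : Lp (E d) 2 (volume : Measure (E d))} (hG : IsWeakGradient u G) {K : Set (E d)}
    (hK : IsCompact K) (hu : ∀ᵐ x, x ∉ K → u x = 0) :
    form C u = ENNReal.ofReal (∫ x, cInner (C x) (G x) (G x)) := by
  have hW : u ∈ W₀ d := ⟨⟨G, hG⟩, K, hK, hu⟩
  rw [form, if_pos hW, weakGradient_eq hG,
    sum_integral_eq_integral_cInner hC G hK (hG.ae_eq_zero hK hu)]

theorem form_le_lipForm (hC : IsCoefficientMatrix C) : form C ≤ lipForm C := by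
  intro u
  by_cases hu : lipForm C u = ∞
  · rw [hu]; exact le_top
  obtain ⟨f, hf, huf⟩ := lipForm_ne_top_iff.1 hu
  rw [lipForm_eq hf huf, form_eq hC (hf.isWeakGradient huf) hf.2]
  · refine le_of_eq (congrArg _ (integral_congr_ae ?_))
    filter_upwards [hf.memLp_gradient.coeFn_toLp] with x hx
    rw [hx]
    rfl
  · filter_upwards [huf] with x hx hxK
    rw [hx, image_eq_zero_of_notMem_tsupport hxK]

theorem integral_norm_mul_norm_le (A B : Lp (E d) 2 (volume : Measure (E d))) :
    ∫ x, ‖A x‖ * ‖B x‖ ≤ ‖A‖ * ‖B‖ := by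
  have hA := (Lp.memLp A).norm
  have hB := (Lp.memLp B).norm
  have h1 : ∫ x, ‖A x‖ * ‖B x‖ = inner ℝ (hA.toLp _ : L d 2) (hB.toLp _) := by
    rw [inner_eq_integral]
    refine integral_congr_ae ?_
    filter_upwards [hA.coeFn_toLp, hB.coeFn_toLp] with x h2 h3
    rw [h2, h3]
  have h2 : ∀ (A : Lp (E d) 2 (volume : Measure (E d))) (hA : MemLp (fun x => ‖A x‖) 2 volume),
      ‖(hA.toLp _ : L d 2)‖ = ‖A‖ := fun A hA => by
    rw [Lp.norm_toLp, Lp.norm_def, eLpNorm_norm]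
  rw [h1, ← h2 A hA, ← h2 B hB]
  exact real_inner_le_norm _ _

/-- All fields vanish off one compact set, where C is bounded; there the energy is continuous for
L_2-convergence of the fields. -/
theorem tendsto_integral_cInner (hC : IsCoefficientMatrix C) {K : Set (E d)} (hK : IsCompact K)
    {A : ℕ → Lp (E d) 2 (volume : Measure (E d))} {G : Lp (E d) 2 (volume : Measure (E d))}
    (hA : ∀ n, ∀ᵐ x, x ∉ K → A n x = 0) (hG : ∀ᵐ x, x ∉ K → G x = 0)
    (hlim : Tendsto A atTop (𝓝 G)) :
    Tendsto (fun n => ∫ x, cInner (C x) (A n x) (A n x)) atTop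
      (𝓝 (∫ x, cInner (C x) (G x) (G x))) := by
  obtain ⟨M, hM, hMx⟩ := hC.exists_opNorm_bound hK
  rw [tendsto_iff_norm_sub_tendsto_zero]
  refine squeeze_zero (g := fun n => M * (‖A n - G‖ * ‖A n‖ + ‖G‖ * ‖A n - G‖))
    (fun _ => norm_nonneg _) (fun n => ?_) ?_
  · have hi1 := hC.integrable_cInner (Lp.memLp (A n)) (Lp.memLp (A n)) hK (hA n)
    have hi2 := hC.integrable_cInner (Lp.memLp G) (Lp.memLp G) hK hG
    have hn1 := (Lp.memLp (A n - G)).norm.integrable_mul (Lp.memLp (A n)).norm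
    have hn2 := (Lp.memLp G).norm.integrable_mul (Lp.memLp (A n - G)).norm
    rw [← integral_sub hi1 hi2]
    refine (norm_integral_le_integral_norm _).trans ?_
    refine le_trans (integral_mono_ae (hi1.sub hi2).norm ((hn1.add hn2).const_mul M) ?_) ?_
    · filter_upwards [hMx, hA n, hG, Lp.coeFn_sub (A n) G] with x h1 h2 h3 h4
      simp only [Pi.sub_apply, Pi.add_apply, Pi.mul_apply, h4]
      by_cases hx : x ∈ K
      · have e : cInner (C x) (A n x) (A n x) - cInner (C x) (G x) (G x) =
            cInner (C x) (A n x - G x) (A n x) + cInner (C x) (G x) (A n x - G x) := by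
          rw [cInner_sub_left, cInner_sub_right]; ring
        rw [e, Real.norm_eq_abs]
        refine (abs_add_le _ _).trans ?_
        rw [mul_add]
        refine add_le_add (abs_cInner_le.trans ?_) (abs_cInner_le.trans ?_)
        · exact mul_le_mul_of_nonneg_right (h1 hx) (by positivity)
        · exact mul_le_mul_of_nonneg_right (h1 hx) (by positivity)
      · simp [h2 hx, h3 hx]
    · rw [integral_const_mul]
      refine mul_le_mul_of_nonneg_left ?_ hM
      have h1 := integral_norm_mul_norm_le (A n - G) (A n)
      have h2 := integral_norm_mul_norm_le G (A n - G)
      have h3 := integral_add hn1 hn2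
      simp only [Pi.mul_apply] at h3
      simp only [Pi.add_apply, Pi.mul_apply]
      rw [h3]
      exact add_le_add h1 h2
  · have h1 : Tendsto (fun n => ‖A n - G‖) atTop (𝓝 0) := tendsto_iff_norm_sub_tendsto_zero.1 hlim
    have := ((h1.mul hlim.norm).add (h1.const_mul ‖G‖)).const_mul M
    simpa using this

end WeakGradient

/-! ### Mollification -/

section Mollification

open Gradient Convolution ContinuousLinearMap Pointwise

variable {d : ℕ} {C : E d → Matrix (Fin d) (Fin d) ℝ}

theorem tendsto_translate {F : Type*} [NormedAddCommGroup F] {g : E d → F}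
    (hg : MemLp g 2 (volume : Measure (E d))) :
    Tendsto (fun t : E d => eLpNorm (fun x => g (x - t) - g x) 2 volume) (𝓝 0) (𝓝 0) := by
  let τ : C(E d, C(E d, E d)) :=
    (ContinuousMap.mk (fun p : E d × E d => p.2 - p.1) (by fun_prop)).curry
  have hτ : ∀ t, MeasurePreserving (τ t) (volume : Measure (E d)) volume := fun t =>
    measurePreserving_sub_right volume t
  have h := Filter.Tendsto.compMeasurePreservingLp (p := 2)
    (tendsto_const_nhds (x := hg.toLp g) (f := 𝓝 (0 : E d))) (τ.continuous.tendsto 0) hτ (hτ 0)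
    ENNReal.ofNat_ne_top
  have h0 : Lp.compMeasurePreserving (τ 0) (hτ 0) (hg.toLp g) = hg.toLp g := by
    refine Lp.ext ((Lp.coeFn_compMeasurePreserving _ (hτ 0)).trans
      (Eventually.of_forall fun x => ?_))
    simp [τ]
  rw [h0, Lp.tendsto_Lp_iff_tendsto_eLpNorm'] at h
  refine h.congr fun t => eLpNorm_congr_ae ?_
  filter_upwards [Lp.coeFn_compMeasurePreserving (hg.toLp g) (hτ t), hg.coeFn_toLp,
    (hτ t).quasiMeasurePreserving.ae hg.coeFn_toLp] with x h1 h2 h3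
  rw [Pi.sub_apply, h1, h2, Function.comp_apply, h3]
  rfl

theorem eLpNorm_two_sq {X F : Type*} [MeasurableSpace X] [NormedAddCommGroup F] (μ : Measure X)
    (f : X → F) : eLpNorm f 2 μ ^ 2 = ∫⁻ x, ‖f x‖ₑ ^ 2 ∂μ := by
  have h4 := eLpNorm_nnreal_pow_eq_lintegral (p := 2) (μ := μ) (f := f) two_ne_zero
  have h5 : ((2 : ℝ≥0) : ℝ) = ((2 : ℕ) : ℝ) := by norm_num
  simpa only [h5, ENNReal.rpow_natCast, ENNReal.coe_ofNat] using h4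

variable {F : Type*} [NormedAddCommGroup F] [NormedSpace ℝ F] [CompleteSpace F]

theorem lintegral_normed (φ : ContDiffBump (0 : E d)) :
    ∫⁻ t, ENNReal.ofReal (φ.normed volume t) = 1 := by
  rw [← ofReal_integral_eq_lintegral_ofReal φ.integrable_normed
    (Eventually.of_forall φ.nonneg_normed), φ.integral_normed, ENNReal.ofReal_one]

/-- Jensen: the normalized bump is a probability density, so the L_1-norm for it is at most the
L_2-norm. -/
theorem enorm_convolution_sub_sq_le {g : E d → F} (hgm : StronglyMeasurable g)
    (hg : MemLp g 2 (volume : Measure (E d))) (φ : ContDiffBump (0 : E d)) (x : E d) :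
    ‖(φ.normed volume ⋆[lsmul ℝ ℝ, volume] g : E d → F) x - g x‖ₑ ^ 2 ≤
      ∫⁻ t, ENNReal.ofReal (φ.normed volume t) * ‖g (x - t) - g x‖ₑ ^ 2 := by
  set w : E d → ℝ≥0∞ := fun t => ENNReal.ofReal (φ.normed volume t) with hw
  have hwm : Measurable w := φ.continuous_normed.measurable.ennreal_ofReal
  have hw1 : ∫⁻ t, w t = 1 := lintegral_normed φ
  have hν : IsProbabilityMeasure (volume.withDensity w) :=
    ⟨by rw [withDensity_apply _ MeasurableSet.univ]; simpa using hw1⟩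
  have hi : Integrable (fun t => φ.normed volume t • g (x - t)) :=
    (φ.hasCompactSupport_normed (μ := volume)).convolutionExists_left (lsmul ℝ ℝ)
      φ.continuous_normed (hg.locallyIntegrable one_le_two) x
  have e : (φ.normed volume ⋆[lsmul ℝ ℝ, volume] g : E d → F) x - g x =
      ∫ t, φ.normed volume t • (g (x - t) - g x) := by
    rw [convolution_lsmul]
    simp only [smul_sub]
    rw [integral_sub hi (φ.integrable_normed.smul_const _), φ.integral_normed_smul]
  have hm : StronglyMeasurable (fun t => g (x - t) - g x) :=
    (hgm.comp_measurable (measurable_const.sub measurable_id)).sub stronglyMeasurable_const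
  have h1 : ‖(φ.normed volume ⋆[lsmul ℝ ℝ, volume] g : E d → F) x - g x‖ₑ ≤
      eLpNorm (fun t => g (x - t) - g x) 1 (volume.withDensity w) := by
    rw [e, eLpNorm_one_eq_lintegral_enorm]
    refine (enorm_integral_le_lintegral_enorm _).trans (le_of_eq ?_)
    rw [lintegral_withDensity_eq_lintegral_mul _ hwm hm.enorm]
    refine lintegral_congr fun t => ?_
    rw [enorm_smul, Pi.mul_apply, hw, Real.enorm_eq_ofReal (φ.nonneg_normed t)]
  have h2 := eLpNorm_le_eLpNorm_of_exponent_le (p := 1) (q := 2) one_le_two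
    (hm.aestronglyMeasurable (μ := volume.withDensity w))
  have h3 : eLpNorm (fun t => g (x - t) - g x) 2 (volume.withDensity w) ^ 2 =
      ∫⁻ t, w t * ‖g (x - t) - g x‖ₑ ^ 2 := by
    rw [eLpNorm_two_sq, lintegral_withDensity_eq_lintegral_mul _ hwm (hm.enorm.pow_const 2)]
    rfl
  rw [← h3]
  exact pow_le_pow_left₀ zero_le (h1.trans h2) 2

/-- Tonelli turns the inner integral into squared L_2-norms of translation differences, averaged
over t with total weight 1. -/
theorem lintegral_translate_le {X : Type*} [NormedAddCommGroup X] {g : E d → X}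
    (hgm : StronglyMeasurable g) {w : E d → ℝ≥0∞} (hwm : Measurable w) (hw1 : ∫⁻ t, w t = 1)
    {ε : ℝ≥0∞}
    (hε : ∀ t, w t ≠ 0 → eLpNorm (fun x => g (x - t) - g x) 2 volume ≤ ε) :
    ∫⁻ x, ∫⁻ t, w t * ‖g (x - t) - g x‖ₑ ^ 2 ≤ ε ^ 2 := by
  have hhm : StronglyMeasurable fun p : E d × E d => g (p.1 - p.2) - g p.1 :=
    (hgm.comp_measurable (measurable_fst.sub measurable_snd)).sub
      (hgm.comp_measurable measurable_fst)
  have hsq : Measurable fun p : E d × E d => ‖g (p.1 - p.2) - g p.1‖ₑ ^ 2 :=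
    hhm.enorm.pow_const 2
  have hsq1 : ∀ t, Measurable fun x : E d => ‖g (x - t) - g x‖ₑ ^ 2 := fun t =>
    ((hgm.comp_measurable (measurable_id.sub measurable_const)).sub hgm).enorm.pow_const 2
  have hwsq : Measurable fun p : E d × E d => w p.2 * ‖g (p.1 - p.2) - g p.1‖ₑ ^ 2 :=
    (hwm.comp measurable_snd).mul hsq
  rw [lintegral_lintegral_swap hwsq.aemeasurable]
  have h : ∀ t, ∫⁻ x, w t * ‖g (x - t) - g x‖ₑ ^ 2 ≤ w t * ε ^ 2 := by
    intro t
    rw [lintegral_const_mul _ (hsq1 t), ← eLpNorm_two_sq]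
    by_cases ht : w t = 0
    · simp [ht]
    · gcongr
      exact hε t ht
  refine (lintegral_mono h).trans (le_of_eq ?_)
  rw [lintegral_mul_const _ hwm, hw1, one_mul]

theorem eLpNorm_convolution_sub_le {g : E d → F} (hgm : StronglyMeasurable g)
    (hg : MemLp g 2 (volume : Measure (E d))) (φ : ContDiffBump (0 : E d)) {ε : ℝ≥0∞}
    (hε : ∀ t ∈ Metric.ball (0 : E d) φ.rOut, eLpNorm (fun x => g (x - t) - g x) 2 volume ≤ ε) :
    eLpNorm (fun x => (φ.normed volume ⋆[lsmul ℝ ℝ, volume] g : E d → F) x - g x) 2 volume ≤ ε := by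
  have hwm : Measurable fun t => ENNReal.ofReal (φ.normed volume t) :=
    φ.continuous_normed.measurable.ennreal_ofReal
  refine (ENNReal.pow_le_pow_left_iff two_ne_zero).1 ?_
  rw [eLpNorm_two_sq]
  refine (lintegral_mono (enorm_convolution_sub_sq_le hgm hg φ)).trans
    (lintegral_translate_le hgm hwm (lintegral_normed φ) fun t ht => hε t ?_)
  rw [← φ.support_normed_eq (μ := volume)]
  intro h0
  exact ht (by rw [h0, ENNReal.ofReal_zero])

theorem gradient_convolution {u : L d 2} {G : Lp (E d) 2 (volume : Measure (E d))}
    (hG : IsWeakGradient u G) (φ : ContDiffBump (0 : E d)) (x : E d) :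
    ∇ (φ.normed volume ⋆[lsmul ℝ ℝ, volume] u : E d → ℝ) x =
      (φ.normed volume ⋆[lsmul ℝ ℝ, volume] G : E d → E d) x := by
  have hφc := φ.hasCompactSupport_normed (μ := (volume : Measure (E d)))
  have hφ1 : ContDiff ℝ 1 (φ.normed (volume : Measure (E d))) := φ.contDiff_normed (n := 1)
  have hu := (Lp.memLp u).locallyIntegrable one_le_two
  have hfd := hφc.hasFDerivAt_convolution_left (lsmul ℝ ℝ) hφ1 hu x
  ext i
  rw [gradient_apply, hfd.fderiv]
  set e : E d := EuclideanSpace.single i 1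
  have h1 : ((fderiv ℝ (φ.normed volume) ⋆[(lsmul ℝ ℝ).precompL (E d), volume] u) x) e =
      ∫ t, fderiv ℝ (φ.normed volume) t e * u (x - t) := by
    have hi : Integrable (fun t => ((lsmul ℝ ℝ).precompL (E d)) (fderiv ℝ (φ.normed volume) t)
        (u (x - t))) := (hφc.fderiv ℝ).convolutionExists_left _
          (hφ1.continuous_fderiv one_ne_zero) hu x
    rw [convolution_def, ContinuousLinearMap.integral_apply hi]
    rfl
  have h2 : (φ.normed volume ⋆[lsmul ℝ ℝ, volume] G : E d → E d) x i =
      ∫ t, φ.normed volume t * G (x - t) i := by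
    have hi : Integrable (fun t => φ.normed volume t • G (x - t)) :=
      hφc.convolutionExists_left (lsmul ℝ ℝ) φ.continuous_normed
        ((Lp.memLp G).locallyIntegrable one_le_two) x
    rw [convolution_lsmul]
    exact (ContinuousLinearMap.integral_comp_comm (EuclideanSpace.proj (𝕜 := ℝ) i) hi).symm
  rw [h1, h2]
  -- The weak gradient is tested with the reflected bump η; reflection flips the sign of its
  -- derivative and cancels the minus sign of integration by parts.
  set η : E d → ℝ := fun s => φ.normed volume (x - s) with hη
  have hηs : ContDiff ℝ (⊤ : ℕ∞) η := φ.contDiff_normed.comp (contDiff_const.sub contDiff_id)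
  have hηc : HasCompactSupport η := hφc.comp_homeomorph (Homeomorph.subLeft x)
  have hηd : ∀ s, fderiv ℝ η s e = -fderiv ℝ (φ.normed volume) (x - s) e := by
    intro s
    have hd : HasFDerivAt η ((fderiv ℝ (φ.normed volume) (x - s)).comp
        (-(ContinuousLinearMap.id ℝ (E d)))) s := by
      have ha : HasFDerivAt (fun s : E d => x - s) (-(ContinuousLinearMap.id ℝ (E d))) s :=
        (hasFDerivAt_id s).const_sub x
      exact ((hφ1.differentiable one_ne_zero (x - s)).hasFDerivAt).comp s ha
    rw [hd.fderiv]
    simp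
  have h3 := hG η hηs hηc i
  have h4 : ∫ t, fderiv ℝ (φ.normed volume) t e * u (x - t) = -∫ s, u s * fderiv ℝ η s e := by
    rw [← integral_neg, ← integral_sub_left_eq_self _ volume x]
    refine integral_congr_ae (Eventually.of_forall fun s => ?_)
    simp only [hηd, sub_sub_cancel]
    ring
  have h5 : ∫ t, φ.normed volume t * G (x - t) i = ∫ s, G s i * η s := by
    rw [← integral_sub_left_eq_self _ volume x]
    refine integral_congr_ae (Eventually.of_forall fun s => ?_)
    simp only [hη, sub_sub_cancel]
    ring
  rw [h4, h3, h5, neg_neg]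

theorem convolution_eq_zero {u : L d 2} {K : Set (E d)} (hu : ∀ᵐ x, x ∉ K → u x = 0)
    (φ : ContDiffBump (0 : E d)) (hφ : φ.rOut ≤ 1) {x : E d}
    (hx : x ∉ K + Metric.closedBall (0 : E d) 1) :
    (φ.normed volume ⋆[lsmul ℝ ℝ, volume] u : E d → ℝ) x = 0 := by
  rw [convolution_lsmul, ← integral_zero (E d) ℝ]
  refine integral_congr_ae ?_
  have hmp := quasiMeasurePreserving_sub_left (volume : Measure (E d)) x
  filter_upwards [hmp.ae hu] with t ht
  by_cases htb : t ∈ Metric.ball (0 : E d) φ.rOut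
  · have hxt : x - t ∉ K := fun hK => hx ⟨x - t, hK, t,
      Metric.ball_subset_closedBall (Metric.ball_subset_ball hφ htb), by simp⟩
    rw [ht hxt, smul_zero]
  · have : φ.normed volume t = 0 := by
      rw [← φ.support_normed_eq (μ := volume)] at htb
      simpa using htb
    rw [this, zero_smul]

/-- Functions in `W_0^{1,2}` are approximated by smooth functions. -/
theorem lscEnvelope_lipForm_le (hC : IsCoefficientMatrix C) : lscEnvelope (lipForm C) ≤ form C := by
  intro u
  by_cases hu : u ∈ W₀ d
  swap
  · rw [form, if_neg hu]; exact le_top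
  obtain ⟨⟨G, hG⟩, K, hK, huK⟩ := hu
  rw [form_eq hC hG hK huK]
  -- All bump radii are at most 1, so this one compact set carries every mollification.
  set K' : Set (E d) := K + Metric.closedBall (0 : E d) 1 with hK'
  have hK'c : IsCompact K' := hK.add (isCompact_closedBall 0 1)
  have hKK' : K ⊆ K' := fun x hx => ⟨x, hx, 0, by simp, by simp⟩
  have hGK := hG.ae_eq_zero hK huK
  let φ : ℕ → ContDiffBump (0 : E d) := fun n =>
    ⟨1 / (2 * ((n : ℝ) + 1)), 1 / ((n : ℝ) + 1), by positivity, by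
      refine one_div_lt_one_div_of_lt (by positivity) ?_
      have : (0 : ℝ) < n + 1 := by positivity
      linarith⟩
  have hφ1 : ∀ n, (φ n).rOut ≤ 1 := fun n => by
    have := Nat.one_div_le_one_div (α := ℝ) (Nat.zero_le n)
    rw [Nat.cast_zero, zero_add, div_one] at this
    exact this
  -- The codomain is left general because the convergence is used both for u and for its weak
  -- gradient.
  have hconv : ∀ {F : Type} [NormedAddCommGroup F] [NormedSpace ℝ F] [CompleteSpace F]
      (g : Lp F 2 (volume : Measure (E d))), Tendsto (fun n => eLpNorm (fun x =>
        ((φ n).normed volume ⋆[lsmul ℝ ℝ, volume] g : E d → F) x - g x) 2 volume) atTop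
        (𝓝 0) := by
    intro F _ _ _ g
    rw [ENNReal.tendsto_nhds_zero]
    intro ε hε
    have h1 := (tendsto_translate (Lp.memLp g)).eventually_le_const hε
    obtain ⟨δ, hδ, hδε⟩ := Metric.eventually_nhds_iff_ball.1 h1
    have h2 : ∀ᶠ n : ℕ in atTop, 1 / ((n : ℝ) + 1) < δ :=
      (tendsto_one_div_add_atTop_nhds_zero_nat (𝕜 := ℝ)).eventually_lt_const hδ
    filter_upwards [h2] with n hn
    exact eLpNorm_convolution_sub_le (Lp.stronglyMeasurable g) (Lp.memLp g) (φ n)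
      fun t ht => hδε t (Metric.ball_subset_ball hn.le ht)
  let f : ℕ → E d → ℝ := fun n => (φ n).normed volume ⋆[lsmul ℝ ℝ, volume] u
  have hfs : ∀ n, ContDiff ℝ 1 (f n) := fun n =>
    (φ n).hasCompactSupport_normed.contDiff_convolution_left (n := 1) _ (φ n).contDiff_normed
      ((Lp.memLp u).locallyIntegrable one_le_two)
  have hf0 : ∀ n, ∀ x ∉ K', f n x = 0 := fun n x hx => convolution_eq_zero huK (φ n) (hφ1 n) hx
  have hfc : ∀ n, HasCompactSupport (f n) := fun n => HasCompactSupport.intro hK'c (hf0 n)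
  have hfl : ∀ n, IsLipc (f n) := fun n =>
    ⟨⟨_, (ContDiff.lipschitzWith_of_hasCompactSupport (hfc n) (hfs n) one_ne_zero).choose_spec⟩,
      hfc n⟩
  have hgrad : ∀ n, ∇ (f n) = ((φ n).normed volume ⋆[lsmul ℝ ℝ, volume] G : E d → E d) :=
    fun n => funext fun x => gradient_convolution hG (φ n) x
  have hlim : Tendsto (fun n => ((hfl n).memLp 2).toLp (f n)) atTop (𝓝 u) := by
    rw [Lp.tendsto_Lp_iff_tendsto_eLpNorm']
    refine (hconv u).congr fun n => eLpNorm_congr_ae ?_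
    filter_upwards [((hfl n).memLp 2).coeFn_toLp] with x hx
    rw [Pi.sub_apply, hx]
  have hlimG : Tendsto (fun n => (hfl n).memLp_gradient.toLp) atTop (𝓝 G) := by
    rw [Lp.tendsto_Lp_iff_tendsto_eLpNorm']
    refine (hconv G).congr fun n => eLpNorm_congr_ae ?_
    filter_upwards [(hfl n).memLp_gradient.coeFn_toLp] with x hx
    rw [Pi.sub_apply, hx, hgrad]
  have hen := tendsto_integral_cInner hC hK'c (A := fun n => (hfl n).memLp_gradient.toLp)
    (fun n => ?_) (hGK.mono fun x hx hx' => hx fun h => hx' (hKK' h)) hlimG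
  · refine le_of_lowerSemicontinuous_of_tendsto (lowerSemicontinuous_lscEnvelope _) hlim
      (ENNReal.tendsto_ofReal hen) fun n => ?_
    refine (lscEnvelope_le _ _).trans (le_of_eq ?_)
    rw [lipForm_eq (hfl n) ((hfl n).memLp 2).coeFn_toLp]
    refine congrArg _ (integral_congr_ae ?_)
    filter_upwards [(hfl n).memLp_gradient.coeFn_toLp] with x hx
    rw [hx]
    rfl
  · filter_upwards [(hfl n).memLp_gradient.coeFn_toLp] with x hx hxK
    rw [hx]
    refine gradient_eq_zero_of_notMem_tsupport fun h => hxK ?_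
    exact closure_minimal (fun y hy => by_contra fun hn =>
      (Function.mem_support.1 hy) (hf0 n y hn)) hK'c.isClosed h

theorem isRelaxation_form (hC : IsCoefficientMatrix C) :
    IsRelaxation (form C) (lscEnvelope (lipForm C)) :=
  isRelaxation_lscEnvelope (isQuadraticForm_lipForm hC) (form_le_lipForm hC)
    (lscEnvelope_lipForm_le hC)

end Mollification

/-! ### The Markov property -/

section Markov

open Gradient

variable {d : ℕ} {C : E d → Matrix (Fin d) (Fin d) ℝ}

theorem tendsto_slope_fderiv {f : E d → ℝ} {x : E d} (hf : DifferentiableAt ℝ f x) (v : E d) :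
    Tendsto (fun t : ℝ => t⁻¹ * (f (x + t • v) - f x)) (𝓝[>] 0) (𝓝 (fderiv ℝ f x v)) := by
  have h := (hf.hasFDerivAt.hasLineDerivAt v).tendsto_slope_zero_right
  simpa using h

theorem abs_fderiv_le_abs_fderiv {f g : E d → ℝ} {x : E d} (hf : DifferentiableAt ℝ f x)
    (hg : DifferentiableAt ℝ g x) (h : ∀ y, |g y - g x| ≤ |f y - f x|) (v : E d) :
    |fderiv ℝ g x v| ≤ |fderiv ℝ f x v| := by
  refine le_of_tendsto_of_tendsto' (tendsto_slope_fderiv hg v).abs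
    (tendsto_slope_fderiv hf v).abs fun t => ?_
  rw [abs_mul, abs_mul]
  exact mul_le_mul_of_nonneg_left (h _) (abs_nonneg _)

theorem two_mul_abs_cInner_le {M : Matrix (Fin d) (Fin d) ℝ} (hM : M.PosSemidef) (a b : E d) :
    2 * |cInner M a b| ≤ cInner M a a + cInner M b b := by
  have h1 : 0 ≤ cInner M (a + b) (a + b) := cInner_self_nonneg hM
  have h2 : 0 ≤ cInner M (a - b) (a - b) := cInner_self_nonneg hM
  rw [cInner_add_left, cInner_add_right, cInner_add_right, cInner_comm hM (a := b) (b := a)] at h1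
  rw [cInner_sub_left, cInner_sub_right, cInner_sub_right, cInner_comm hM (a := b) (b := a)] at h2
  rcases abs_cases (cInner M a b) with h | h <;> linarith

/-- A contraction of `f` has a smaller energy density. -/
theorem energyDensity_le_of_abs_sub_le {f g : E d → ℝ} {x : E d} (hx : (C x).PosSemidef)
    (hf : DifferentiableAt ℝ f x) (hg : DifferentiableAt ℝ g x)
    (h : ∀ y, |g y - g x| ≤ |f y - f x|) : energyDensity C g g x ≤ energyDensity C f f x := by
  -- Differentiating in the direction C∇g gives (∇g, C∇g) ≤ |(∇f, C∇g)|, and Cauchy–Schwarz for C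
  -- absorbs half of the left side. No chain rule is needed.
  have h1 := abs_fderiv_le_abs_fderiv hf hg h (Matrix.toEuclideanCLM (𝕜 := ℝ) (C x) (∇ g x))
  rw [← inner_gradient_left, ← inner_gradient_left] at h1
  have h2 := two_mul_abs_cInner_le hx (∇ f x) (∇ g x)
  have h3 := le_abs_self (cInner (C x) (∇ g x) (∇ g x))
  simp only [energyDensity]
  change |cInner (C x) (∇ g x) (∇ g x)| ≤ |cInner (C x) (∇ f x) (∇ g x)| at h1
  linarith

theorem lipForm_comp_le (hC : IsCoefficientMatrix C) {F : ℝ → ℝ} (hF : LipschitzWith 1 F)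
    (hF0 : F 0 = 0) (u : L d 2) : lipForm C (hF.compLp hF0 u) ≤ lipForm C u := by
  by_cases hu : lipForm C u = ∞
  · rw [hu]; exact le_top
  obtain ⟨f, hf, huf⟩ := lipForm_ne_top_iff.1 hu
  have hFf : IsLipc fun x => F (f x) := hf.comp hF hF0
  have hae : hF.compLp hF0 u =ᵐ[volume] fun x => F (f x) := by
    filter_upwards [hF.coeFn_compLp hF0 u, huf] with x h1 h2
    rw [h1, Function.comp_apply, h2]
  rw [lipForm_eq hf huf, lipForm_eq hFf hae]
  refine ENNReal.ofReal_le_ofReal (integral_mono_ae (hFf.integrable_energyDensity hC hFf)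
    (hf.integrable_energyDensity hC hf) ?_)
  filter_upwards [hC.posSemidef, hf.ae_differentiableAt, hFf.ae_differentiableAt] with x hx h1 h2
  refine energyDensity_le_of_abs_sub_le hx h1 h2 fun y => ?_
  have := hF.dist_le_mul (f y) (f x)
  rwa [NNReal.coe_one, one_mul, Real.dist_eq, Real.dist_eq] at this

theorem lscEnvelope_le_of_continuous {H : Type*} [NormedAddCommGroup H] {q : H → ℝ≥0∞} {P : H → H}
    (hP : Continuous P) (hq : ∀ u, q (P u) ≤ q u) (u : H) :
    lscEnvelope q (P u) ≤ lscEnvelope q u :=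
  calc liminf q (𝓝 (P u)) ≤ liminf q (map P (𝓝 u)) := liminf_le_liminf_of_le (hP.tendsto u)
    _ ≤ liminf q (𝓝 u) := liminf_le_liminf (u := q ∘ P) (Eventually.of_forall hq)

theorem lipschitzWith_clamp (c : ℝ) : LipschitzWith 1 fun s : ℝ => max (-c) (min s c) :=
  (LipschitzWith.id.min_const c).const_max (-c)

theorem lipschitzWith_posPart : LipschitzWith 1 fun s : ℝ => max 0 s :=
  LipschitzWith.id.const_max 0

/-- The semigroup maps fixed points of a normal contraction that is a pointwise projection to
such fixed points. -/
theorem IsFormSemigroup.comp_eq_of_comp_eq (hC : IsCoefficientMatrix C)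
    {S : ℝ≥0 → L d 2 →L[ℝ] L d 2} (hS : IsFormSemigroup (lscEnvelope (lipForm C)) S)
    (hd : Dense {u | ∃ f, FormOperatorGraph (lscEnvelope (lipForm C)) u f})
    {F : ℝ → ℝ} (hF : LipschitzWith 1 F) (hF0 : F 0 = 0)
    (hproj : ∀ s r, |s - F s| ≤ |s - F r|) (t : ℝ≥0) {u : L d 2}
    (hu : ∀ᵐ x, F (u x) = u x) : ∀ᵐ x, F (S t u x) = S t u x := by
  have hPu : hF.compLp hF0 u = u := by
    refine Lp.ext ?_
    filter_upwards [hF.coeFn_compLp hF0 u, hu] with x h1 h2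
    rw [h1, Function.comp_apply, h2]
  have h := hS.norm_sub_projection_le (isQuadraticForm_lscEnvelope (isQuadraticForm_lipForm hC)) hd
    (P := hF.compLp hF0) (fun u v => ?_)
    (lscEnvelope_le_of_continuous (hF.continuous_compLp hF0) (lipForm_comp_le hC hF hF0)) t u
  · rw [hPu, sub_self, norm_zero] at h
    have h2 := sub_eq_zero.1 (norm_le_zero_iff.1 h)
    have h3 := hF.coeFn_compLp hF0 (S t u)
    rw [← h2] at h3
    filter_upwards [h3] with x hx
    exact hx.symm
  · refine Lp.norm_le_norm_of_ae_le ?_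
    filter_upwards [hF.coeFn_compLp hF0 u, hF.coeFn_compLp hF0 v,
      Lp.coeFn_sub v (hF.compLp hF0 u), Lp.coeFn_sub v (hF.compLp hF0 v)] with x h1 h2 h3 h4
    rw [h3, h4, Pi.sub_apply, Pi.sub_apply, h1, h2]
    exact hproj _ _

theorem IsFormSemigroup.apply_nonneg (hC : IsCoefficientMatrix C)
    {S : ℝ≥0 → L d 2 →L[ℝ] L d 2} (hS : IsFormSemigroup (lscEnvelope (lipForm C)) S)
    (hd : Dense {u | ∃ f, FormOperatorGraph (lscEnvelope (lipForm C)) u f}) (t : ℝ≥0)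
    {u : L d 2} (hu : 0 ≤ u) : 0 ≤ S t u := by
  rw [← Lp.coeFn_nonneg] at hu ⊢
  have h := hS.comp_eq_of_comp_eq hC hd lipschitzWith_posPart (by simp) (fun s r => ?_) t
    (u := u) ?_
  · filter_upwards [h] with x hx
    exact max_eq_right_iff.1 hx
  · rcases le_total 0 s with hs | hs
    · rw [max_eq_right hs, sub_self, abs_zero]
      exact abs_nonneg _
    · rw [max_eq_left hs, sub_zero, abs_of_nonpos hs,
        abs_of_nonpos (sub_nonpos.2 (hs.trans (le_max_left _ _)))]
      linarith [le_max_left 0 r]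
  · filter_upwards [hu] with x hx
    exact max_eq_right hx

theorem IsFormSemigroup.ae_abs_le (hC : IsCoefficientMatrix C)
    {S : ℝ≥0 → L d 2 →L[ℝ] L d 2} (hS : IsFormSemigroup (lscEnvelope (lipForm C)) S)
    (hd : Dense {u | ∃ f, FormOperatorGraph (lscEnvelope (lipForm C)) u f}) (t : ℝ≥0)
    {u : L d 2} {c : ℝ} (hu : ∀ᵐ x, |u x| ≤ c) : ∀ᵐ x, |S t u x| ≤ c := by
  obtain ⟨y, hy⟩ := hu.exists
  have hc : 0 ≤ c := (abs_nonneg _).trans hy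
  have h := hS.comp_eq_of_comp_eq hC hd (lipschitzWith_clamp c) (by simp [hc])
    (fun s r => ?_) t (u := u) ?_
  · filter_upwards [h] with x hx
    rw [← hx, abs_le]
    exact ⟨le_max_left _ _, max_le (by linarith) (min_le_right _ _)⟩
  · have h1 : -c ≤ max (-c) (min r c) := le_max_left _ _
    have h2 : max (-c) (min r c) ≤ c := max_le (by linarith) (min_le_right _ _)
    rcases le_total s (-c) with h3 | h3
    · rw [max_eq_left ((min_le_left _ _).trans h3), abs_of_nonpos (by linarith),
        abs_of_nonpos (by linarith)]
      linarith
    rcases le_total s c with h4 | h4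
    · rw [min_eq_left h4, max_eq_right h3, sub_self, abs_zero]
      exact abs_nonneg _
    · rw [min_eq_right h4, max_eq_right (by linarith), abs_of_nonneg (by linarith),
        abs_of_nonneg (by linarith)]
      linarith
  · filter_upwards [hu] with x hx
    rw [abs_le] at hx
    rw [min_eq_left hx.2, max_eq_right hx.1]

end Markov

/-! ### The distance `ρ` -/

section Distance

open Gradient

variable {d : ℕ} {C : E d → Matrix (Fin d) (Fin d) ℝ}

theorem nu_nonneg (C : E d → Matrix (Fin d) (Fin d) ℝ) (s : ℝ) : 0 ≤ nu C s :=
  ENNReal.toReal_nonneg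

theorem essSup_opNorm_ne_top (hC : IsCoefficientMatrix C) (s : ℝ) :
    essSup (fun x => ‖Matrix.toEuclideanCLM (𝕜 := ℝ) (C x)‖ₑ)
      (volume.restrict (Metric.closedBall (0 : E d) s)) ≠ ∞ := by
  obtain ⟨M, hM, hMx⟩ := hC.exists_opNorm_bound (isCompact_closedBall (0 : E d) s)
  refine ne_top_of_le_ne_top (ENNReal.ofReal_ne_top (r := M)) (essSup_le_of_ae_le _ ?_)
  rw [EventuallyLE, ae_restrict_iff' Metric.isClosed_closedBall.measurableSet]
  filter_upwards [hMx] with x hx hxs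
  rw [← ofReal_norm]
  exact ENNReal.ofReal_le_ofReal (hx hxs)

theorem monotone_nu (hC : IsCoefficientMatrix C) : Monotone (nu C) := fun s _ hst =>
  ENNReal.toReal_mono (essSup_opNorm_ne_top hC _) (essSup_mono_measure'
    (Measure.restrict_mono_set _ (Metric.closedBall_subset_closedBall hst)))

/-- Only rational radii are used, so the exceptional sets form one null set; the strict inequality
leaves room for a rational between ‖x‖ and s. -/
theorem ae_opNorm_le_nu (hC : IsCoefficientMatrix C) :
    ∀ᵐ x : E d, ∀ s, ‖x‖ < s → ‖Matrix.toEuclideanCLM (𝕜 := ℝ) (C x)‖ ≤ nu C s := by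
  have h : ∀ r : ℚ, ∀ᵐ x : E d, ‖x‖ ≤ r →
      ‖Matrix.toEuclideanCLM (𝕜 := ℝ) (C x)‖ ≤ nu C r := by
    intro r
    have h1 := ENNReal.ae_le_essSup (μ := volume.restrict (Metric.closedBall (0 : E d) r))
      (fun x => ‖Matrix.toEuclideanCLM (𝕜 := ℝ) (C x)‖ₑ)
    rw [ae_restrict_iff' Metric.isClosed_closedBall.measurableSet] at h1
    filter_upwards [h1] with x hx hxr
    rw [← toReal_enorm]
    exact ENNReal.toReal_mono (essSup_opNorm_ne_top hC _) (hx (by simpa using hxr))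
  filter_upwards [ae_all_iff.2 h] with x hx s hs
  obtain ⟨r, h1, h2⟩ := exists_rat_btwn hs
  exact (hx r h1.le).trans (monotone_nu hC h2.le)

theorem antitone_rho_integrand (hC : IsCoefficientMatrix C) :
    Antitone fun t => (1 + nu C t) ^ (-(1 / 2) : ℝ) := fun s t hst =>
  Real.rpow_le_rpow_of_nonpos (by linarith [nu_nonneg C s])
    (by linarith [monotone_nu hC hst]) (by norm_num)

theorem rho_sub (hC : IsCoefficientMatrix C) (s t : ℝ) :
    rho C t - rho C s = ∫ r in s..t, (1 + nu C r) ^ (-(1 / 2) : ℝ) :=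
  intervalIntegral.integral_interval_sub_left (antitone_rho_integrand hC).intervalIntegrable
    (antitone_rho_integrand hC).intervalIntegrable

theorem monotone_rho (hC : IsCoefficientMatrix C) : Monotone (rho C) := fun s t hst => by
  rw [← sub_nonneg, rho_sub hC]
  exact intervalIntegral.integral_nonneg hst fun r _ =>
    Real.rpow_nonneg (by linarith [nu_nonneg C r]) _

theorem rho_sub_le (hC : IsCoefficientMatrix C) {s t K : ℝ} (hst : s ≤ t) (hK : 0 ≤ K)
    (h : ∀ r, s < r → K ≤ nu C r) : rho C t - rho C s ≤ (t - s) * (1 + K) ^ (-(1 / 2) : ℝ) := by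
  rw [rho_sub hC, ← smul_eq_mul, ← intervalIntegral.integral_const]
  refine intervalIntegral.integral_mono_on_of_le_Ioo hst
    (antitone_rho_integrand hC).intervalIntegrable intervalIntegrable_const fun r hr => ?_
  exact Real.rpow_le_rpow_of_nonpos (by linarith) (by linarith [h r hr.1]) (by norm_num)

theorem abs_rho_sub_le (hC : IsCoefficientMatrix C) (s t : ℝ) :
    |rho C s - rho C t| ≤ |s - t| := by
  wlog hst : s ≤ t generalizing s t
  · rw [abs_sub_comm, abs_sub_comm s]
    exact this t s (le_of_not_ge hst)
  have h := rho_sub_le hC hst le_rfl fun r _ => nu_nonneg C r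
  rw [add_zero, Real.one_rpow, mul_one] at h
  rw [abs_sub_comm, abs_sub_comm s, abs_of_nonneg (sub_nonneg.2 hst),
    abs_of_nonneg (sub_nonneg.2 (monotone_rho hC hst))]
  exact h

theorem lipschitzWith_rho_norm (hC : IsCoefficientMatrix C) :
    LipschitzWith 1 fun x : E d => rho C ‖x‖ :=
  LipschitzWith.of_dist_le_mul fun x y => by
    rw [NNReal.coe_one, one_mul, Real.dist_eq]
    exact (abs_rho_sub_le hC _ _).trans
      ((abs_norm_sub_norm_le x y).trans_eq (dist_eq_norm x y).symm)

/-- The monotone function ν may jump at ‖x‖, so ρ need not be differentiable there and the chain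
rule is avoided. In a direction v with (x, v) ≥ 0 the difference quotient involves only radii beyond
‖x‖, where ν ≥ K; the other directions follow by v ↦ -v. -/
theorem norm_gradient_rho_le (hC : IsCoefficientMatrix C) {x : E d} {K : ℝ} (hK : 0 ≤ K)
    (h : ∀ r, ‖x‖ < r → K ≤ nu C r) (hd : DifferentiableAt ℝ (fun x : E d => rho C ‖x‖) x) :
    ‖∇ (fun x : E d => rho C ‖x‖) x‖ ≤ (1 + K) ^ (-(1 / 2) : ℝ) := by
  have hc : 0 ≤ (1 + K) ^ (-(1 / 2) : ℝ) := Real.rpow_nonneg (by linarith) _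
  have key : ∀ v : E d, 0 ≤ inner ℝ x v →
      |fderiv ℝ (fun x : E d => rho C ‖x‖) x v| ≤ (1 + K) ^ (-(1 / 2) : ℝ) * ‖v‖ := by
    intro v hv
    refine le_of_tendsto (tendsto_slope_fderiv hd v).abs ?_
    filter_upwards [self_mem_nhdsWithin] with t (ht : 0 < t)
    have h1 : ‖x‖ ≤ ‖x + t • v‖ := by
      refine le_of_sq_le_sq ?_ (norm_nonneg _)
      rw [norm_add_sq_real, real_inner_smul_right]
      nlinarith [mul_nonneg ht.le hv, sq_nonneg ‖t • v‖]
    have h2 : ‖x + t • v‖ - ‖x‖ ≤ t * ‖v‖ := by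
      have := norm_add_le x (t • v)
      rw [norm_smul, Real.norm_of_nonneg ht.le] at this
      linarith
    have h3 := rho_sub_le hC h1 hK h
    rw [abs_mul, abs_of_pos (inv_pos.2 ht), abs_of_nonneg (sub_nonneg.2 (monotone_rho hC h1)),
      inv_mul_le_iff₀ ht]
    calc _ ≤ _ := h3
      _ ≤ (t * ‖v‖) * (1 + K) ^ (-(1 / 2) : ℝ) := mul_le_mul_of_nonneg_right h2 hc
      _ = _ := by ring
  rw [norm_gradient]
  refine ContinuousLinearMap.opNorm_le_bound _ hc fun v => ?_
  rw [Real.norm_eq_abs]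
  rcases le_total 0 (inner ℝ x v) with hv | hv
  · exact key v hv
  · have := key (-v) (by rw [inner_neg_right]; linarith)
    rwa [map_neg, abs_neg, norm_neg] at this

/-- With K = ‖C(x)‖ the gradient bound gives K/(1 + K) ≤ 1. This is what the weight (1 + ν)^{-1/2}
in ρ is for. -/
theorem ae_energyDensity_rho_le (hC : IsCoefficientMatrix C) :
    ∀ᵐ x : E d, energyDensity C (fun x => rho C ‖x‖) (fun x => rho C ‖x‖) x ≤ 1 := by
  filter_upwards [ae_opNorm_le_nu hC, ae_differentiableAt_of_lipschitz (lipschitzWith_rho_norm hC)]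
    with x hx hd
  have hK := norm_nonneg (Matrix.toEuclideanCLM (𝕜 := ℝ) (C x))
  have h1 := norm_gradient_rho_le hC hK hx hd
  refine (le_abs_self _).trans (abs_cInner_le.trans ?_)
  set K := ‖Matrix.toEuclideanCLM (𝕜 := ℝ) (C x)‖
  have h2 : (1 + K) ^ (-(1 / 2) : ℝ) * (1 + K) ^ (-(1 / 2) : ℝ) = (1 + K)⁻¹ := by
    rw [← Real.rpow_add (by linarith), ← Real.rpow_neg_one]
    norm_num
  calc K * (‖∇ (fun x : E d => rho C ‖x‖) x‖ * ‖∇ (fun x : E d => rho C ‖x‖) x‖)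
      ≤ K * ((1 + K) ^ (-(1 / 2) : ℝ) * (1 + K) ^ (-(1 / 2) : ℝ)) := by gcongr
    _ ≤ 1 := by rw [h2, ← div_eq_mul_inv, div_le_one (by linarith)]; linarith

theorem lipschitz_of_abs_sub_le_rho (hC : IsCoefficientMatrix C) {g : E d → ℝ}
    (hg : ∀ x y, |g y - g x| ≤ |rho C ‖y‖ - rho C ‖x‖|) : LipschitzWith 1 g :=
  LipschitzWith.of_dist_le_mul fun x y => by
    rw [Real.dist_eq]
    refine (hg y x).trans ?_
    rw [← Real.dist_eq]
    exact (lipschitzWith_rho_norm hC).dist_le_mul x y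

/-- A normal contraction of `ρ` has energy density at most `1`. -/
theorem ae_energyDensity_le_one (hC : IsCoefficientMatrix C) {g : E d → ℝ}
    (hg : ∀ x y, |g y - g x| ≤ |rho C ‖y‖ - rho C ‖x‖|) :
    ∀ᵐ x : E d, energyDensity C g g x ≤ 1 := by
  have hgl := lipschitz_of_abs_sub_le_rho hC hg
  filter_upwards [ae_energyDensity_rho_le hC, hC.posSemidef, ae_differentiableAt_of_lipschitz hgl,
    ae_differentiableAt_of_lipschitz (lipschitzWith_rho_norm hC)] with x h1 h2 h3 h4
  exact (energyDensity_le_of_abs_sub_le h2 h4 h3 (hg x)).trans h1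

/-- Finite volume keeps the ρ-ball from being the whole space, and by monotonicity of ρ any missing
point bounds its radius. For d = 0 the whole space is compact. This makes the cut-off functions
compactly supported. -/
theorem exists_rhoBall_subset_closedBall (hC : IsCoefficientMatrix C) {r : ℝ}
    (hr : volume (rhoBall C r) ≠ ∞) :
    ∃ s, rhoBall C r ⊆ Metric.closedBall (0 : E d) s := by
  by_cases hcomp : CompactSpace (E d)
  · obtain ⟨s, hs⟩ := (isCompact_univ (X := E d)).isBounded.subset_closedBall 0
    exact ⟨s, (Set.subset_univ _).trans hs⟩
  · have : NoncompactSpace (E d) := not_compactSpace_iff.1 hcomp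
    have hne : rhoBall C r ≠ Set.univ := fun h => by
      rw [h, measure_univ_of_isAddLeftInvariant] at hr
      exact hr rfl
    obtain ⟨y, hy⟩ := (Set.ne_univ_iff_exists_notMem _).1 hne
    refine ⟨‖y‖, fun x hx => ?_⟩
    rw [mem_closedBall_zero_iff]
    by_contra! hlt
    exact hy ((monotone_rho hC hlt.le).trans_lt hx)

end Distance

/-! ### Weighted energy estimates -/

section Weights

open Gradient

variable {d : ℕ} {C : E d → Matrix (Fin d) (Fin d) ℝ}

/-- A bounded Lipschitz function with energy density at most `1`. -/
structure IsWeight (C : E d → Matrix (Fin d) (Fin d) ℝ) (m : E d → ℝ) (R : ℝ) : Prop where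
  lipschitz : LipschitzWith 1 m
  le : ∀ x, m x ≤ R
  energyDensity_le : ∀ᵐ x, energyDensity C m m x ≤ 1

/-- The exponential weight `e^{2 α m}`. -/
def expWeight (α : ℝ) (m : E d → ℝ) (x : E d) : ℝ := Real.exp (2 * α * m x)

theorem expWeight_pos (α : ℝ) (m : E d → ℝ) (x : E d) : 0 < expWeight α m x := Real.exp_pos _

theorem gradient_expWeight (α : ℝ) {m : E d → ℝ} {x : E d} (hm : DifferentiableAt ℝ m x) :
    DifferentiableAt ℝ (expWeight α m) x ∧
      ∇ (expWeight α m) x = (2 * α * expWeight α m x) • ∇ m x := by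
  have h : HasFDerivAt (expWeight α m) (expWeight α m x • ((2 * α) • fderiv ℝ m x)) x :=
    (hm.hasFDerivAt.const_mul (2 * α)).exp
  refine ⟨h.differentiableAt, ?_⟩
  rw [gradient, h.fderiv, smul_smul, map_smulₛₗ, mul_comm (2 * α)]
  rfl

theorem lipschitzOnWith_exp (c : ℝ) :
    LipschitzOnWith (Real.exp c).toNNReal Real.exp (Set.Iic c) := by
  refine (convex_Iic c).lipschitzOnWith_of_nnnorm_deriv_le
    (fun x _ => Real.differentiableAt_exp) fun x hx => ?_
  rw [Real.deriv_exp, ← NNReal.coe_le_coe, coe_nnnorm, Real.norm_of_nonneg (Real.exp_pos x).le,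
    Real.coe_toNNReal _ (Real.exp_pos c).le]
  exact Real.exp_le_exp.2 hx

namespace IsWeight

variable {m : E d → ℝ} {R α : ℝ}

theorem expWeight_le (hm : IsWeight C m R) (hα : 0 ≤ α) (x : E d) :
    expWeight α m x ≤ Real.exp (2 * α * R) :=
  Real.exp_le_exp.2 (mul_le_mul_of_nonneg_left (hm.le x) (by positivity))

theorem abs_expWeight_le (hm : IsWeight C m R) (hα : 0 ≤ α) (x : E d) :
    |expWeight α m x| ≤ Real.exp (2 * α * R) := by
  rw [abs_of_pos (expWeight_pos α m x)]
  exact hm.expWeight_le hα x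

theorem lipschitz_expWeight (hm : IsWeight C m R) (hα : 0 ≤ α) :
    ∃ K, LipschitzWith K (expWeight α m) := by
  refine ⟨(Real.exp (2 * α * R)).toNNReal * ((2 * α).toNNReal * 1), ?_⟩
  have h1 : LipschitzWith ((2 * α).toNNReal * 1) fun x => 2 * α * m x := by
    refine LipschitzWith.of_dist_le_mul fun x y => ?_
    rw [Real.dist_eq, ← mul_sub, abs_mul, abs_of_nonneg (by positivity : 0 ≤ 2 * α), mul_one,
      Real.coe_toNNReal _ (by positivity)]
    refine mul_le_mul_of_nonneg_left ?_ (by positivity)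
    rw [← Real.dist_eq]
    simpa using hm.lipschitz.dist_le_mul x y
  rw [← lipschitzOnWith_univ] at h1 ⊢
  exact (lipschitzOnWith_exp (2 * α * R)).comp h1 fun x _ =>
    mul_le_mul_of_nonneg_left (hm.le x) (by positivity)

theorem isLipc_mul (hm : IsWeight C m R) (hα : 0 ≤ α) {f : E d → ℝ} (hf : IsLipc f) :
    IsLipc fun x => expWeight α m x * f x :=
  hf.bounded_mul (hm.lipschitz_expWeight hα).choose_spec (hm.abs_expWeight_le hα)

theorem ae_gradient_mul (hm : IsWeight C m R) {f : E d → ℝ} (hf : IsLipc f) :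
    ∀ᵐ x, ∇ (fun y => expWeight α m y * f y) x =
      expWeight α m x • (∇ f x + (2 * α * f x) • ∇ m x) := by
  filter_upwards [hf.ae_differentiableAt, ae_differentiableAt_of_lipschitz hm.lipschitz]
    with x h1 h2
  obtain ⟨h3, h4⟩ := gradient_expWeight α h2
  rw [gradient_mul h3 h1, h4, smul_add, smul_smul, smul_smul]
  congr 2
  ring

end IsWeight

/-- The difference of the two sides is half the square of a + 2s b plus 2s²(1 - (b, Mb)). In use, a
= ∇f, b = ∇m and s = αf, so that e^{2αm}(a + 2s b) is the gradient of e^{2αm}f. -/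
theorem cInner_weighted_nonneg {M : Matrix (Fin d) (Fin d) ℝ} (hM : M.PosSemidef) {a b : E d}
    (hb : cInner M b b ≤ 1) (s : ℝ) :
    cInner M a a / 2 ≤ cInner M a (a + (2 * s) • b) + 2 * s ^ 2 := by
  have h : 0 ≤ cInner M (a + (2 * s) • b) (a + (2 * s) • b) := cInner_self_nonneg hM
  simp only [cInner_add_left, cInner_add_right, cInner_smul_left, cInner_smul_right,
    cInner_comm hM (a := b) (b := a)] at h ⊢
  nlinarith [mul_nonneg (sq_nonneg s) (sub_nonneg.2 hb)]

/-- Young's inequality with weight δw, after which the square of a is replaced by its pairing with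
the gradient of the weighted function. No weighted energy of a alone remains, so the integrated
bound uses only polar forms, which pass to the envelope. -/
theorem abs_cInner_le_weighted {M : Matrix (Fin d) (Fin d) ℝ} (hM : M.PosSemidef) {a b e : E d}
    (hb : cInner M b b ≤ 1) (s : ℝ) {w δ : ℝ} (hw : 0 < w) (hδ : 0 < δ) :
    |cInner M a e| ≤ δ * (cInner M a (w • (a + (2 * s) • b)) + 2 * (w * s ^ 2)) +
      w⁻¹ * cInner M e e / (2 * δ) := by
  have h1 := two_mul_abs_cInner_le hM ((δ * w) • a) e
  have hδw : 0 < δ * w := mul_pos hδ hw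
  rw [cInner_smul_left, cInner_smul_left, cInner_smul_right, abs_mul, abs_of_pos hδw] at h1
  have h2 : |cInner M a e| ≤ δ * w * (cInner M a a / 2) + w⁻¹ * cInner M e e / (2 * δ) := by
    have e1 : δ * w * (cInner M a a / 2) + w⁻¹ * cInner M e e / (2 * δ) =
        (δ * w * (δ * w * cInner M a a) + cInner M e e) / (2 * (δ * w)) := by
      field_simp
    rw [e1, le_div_iff₀ (by positivity)]
    linarith
  have h3 := mul_le_mul_of_nonneg_left (cInner_weighted_nonneg hM (a := a) hb s) hδw.le
  rw [cInner_smul_right]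
  linarith

theorem abs_energy_le_weighted (hC : IsCoefficientMatrix C) {m : E d → ℝ} {R α : ℝ}
    (hm : IsWeight C m R) (hα : 0 ≤ α) {f χ g : E d → ℝ} (hf : IsLipc f) (hχ : IsLipc χ)
    (hg : Integrable g) (hχg : ∀ᵐ x, (expWeight α m x)⁻¹ * energyDensity C χ χ x ≤ g x)
    {δ : ℝ} (hδ : 0 < δ) :
    |energy C f χ| ≤ δ * (energy C f (fun x => expWeight α m x * f x) +
      2 * α ^ 2 * ∫ x, f x * (expWeight α m x * f x)) + (∫ x, g x) / (2 * δ) := by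
  have hwf := hm.isLipc_mul hα hf
  have hi1 := hf.integrable_energyDensity hC hwf
  have hi2 : Integrable fun x => f x * (expWeight α m x * f x) :=
    (hf.memLp 2).integrable_mul (hwf.memLp 2)
  have hi3 : Integrable fun x => energyDensity C f (fun x => expWeight α m x * f x) x +
      2 * α ^ 2 * (f x * (expWeight α m x * f x)) := hi1.add (hi2.const_mul _)
  have e : δ * (energy C f (fun x => expWeight α m x * f x) +
      2 * α ^ 2 * ∫ x, f x * (expWeight α m x * f x)) + (∫ x, g x) / (2 * δ) =
      ∫ x, (δ * (energyDensity C f (fun x => expWeight α m x * f x) x +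
        2 * α ^ 2 * (f x * (expWeight α m x * f x))) + g x / (2 * δ)) := by
    rw [integral_add (hi3.const_mul δ) (hg.div_const _), integral_const_mul,
      integral_add hi1 (hi2.const_mul _), integral_const_mul, integral_div, energy]
  rw [e]
  refine (abs_integral_le_integral_abs).trans (integral_mono_ae
    (hf.integrable_energyDensity hC hχ).abs
    ((hi3.const_mul δ).add (hg.div_const _)) ?_)
  filter_upwards [hC.posSemidef, hm.energyDensity_le, hm.ae_gradient_mul (α := α) hf, hχg]
    with x h1 h2 h3 h4
  have h5 := abs_cInner_le_weighted h1 (a := ∇ f x) (e := ∇ χ x) h2 (α * f x)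
    (expWeight_pos α m x) hδ
  rw [← mul_assoc 2 α, ← h3] at h5
  refine h5.trans ?_
  have h6 : (expWeight α m x)⁻¹ * cInner (C x) (∇ χ x) (∇ χ x) / (2 * δ) ≤ g x / (2 * δ) :=
    div_le_div_of_nonneg_right h4 (by positivity)
  refine (add_le_add_right h6 _).trans (le_of_eq ?_)
  simp only [energyDensity]
  ring

/-- A crude bound from (a + b)² ≤ 2a² + 2b². It only serves to keep the energies of weighted
recovery sequences bounded. -/
theorem energy_mul_le (hC : IsCoefficientMatrix C) {m : E d → ℝ} {R α : ℝ}
    (hm : IsWeight C m R) (hα : 0 ≤ α) {f : E d → ℝ} (hf : IsLipc f) :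
    energy C (fun x => expWeight α m x * f x) (fun x => expWeight α m x * f x) ≤
      Real.exp (2 * α * R) ^ 2 * (2 * energy C f f + 8 * α ^ 2 * ∫ x, f x * f x) := by
  have hwf := hm.isLipc_mul hα hf
  have hi1 := hf.integrable_energyDensity hC hf
  have hi2 : Integrable fun x => f x * f x := (hf.memLp 2).integrable_mul (hf.memLp 2)
  rw [energy, energy, ← integral_const_mul, ← integral_const_mul,
    ← integral_add (hi1.const_mul _) (hi2.const_mul _), ← integral_const_mul]
  refine integral_mono_ae (hwf.integrable_energyDensity hC hwf)
    (((hi1.const_mul _).add (hi2.const_mul _)).const_mul _) ?_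
  filter_upwards [hC.posSemidef, hm.energyDensity_le, hm.ae_gradient_mul (α := α) hf]
    with x h1 h2 h3
  simp only [energyDensity] at h2 ⊢
  rw [h3, cInner_smul_left, cInner_smul_right, ← mul_assoc, ← sq]
  have h4 : cInner (C x) (∇ f x + (2 * α * f x) • ∇ m x) (∇ f x + (2 * α * f x) • ∇ m x) ≤
      2 * cInner (C x) (∇ f x) (∇ f x) + 8 * α ^ 2 * (f x * f x) := by
    have h5 := two_mul_abs_cInner_le h1 (∇ f x) ((2 * α * f x) • ∇ m x)
    have h5' := le_abs_self (cInner (C x) (∇ f x) ((2 * α * f x) • ∇ m x))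
    rw [cInner_add_left, cInner_add_right, cInner_add_right,
      cInner_comm h1 (a := (2 * α * f x) • ∇ m x) (b := ∇ f x)]
    have h6 : cInner (C x) ((2 * α * f x) • ∇ m x) ((2 * α * f x) • ∇ m x) ≤
        4 * α ^ 2 * (f x * f x) := by
      rw [cInner_smul_left, cInner_smul_right]
      nlinarith [mul_nonneg (sq_nonneg (2 * α * f x)) (sub_nonneg.2 h2)]
    linarith
  have h7 : 0 ≤ cInner (C x) (∇ f x + (2 * α * f x) • ∇ m x) (∇ f x + (2 * α * f x) • ∇ m x) :=
    cInner_self_nonneg h1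
  exact mul_le_mul (pow_le_pow_left₀ (expWeight_pos α m x).le (hm.expWeight_le hα x) 2) h4 h7
    (by positivity)

/-- Multiplication by a bounded continuous function. -/
theorem exists_mul_L2 {w : E d → ℝ} (hw : Continuous w) {B : ℝ} (hB : ∀ x, |w x| ≤ B) :
    ∃ M : L d 2 →L[ℝ] L d 2, ∀ u, M u =ᵐ[volume] fun x => w x * u x := by
  have hmem : ∀ u : L d 2, MemLp (fun x => w x * u x) 2 volume := fun u =>
    MemLp.of_le_mul (Lp.memLp u) (hw.aestronglyMeasurable.mul (Lp.aestronglyMeasurable u))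
      (c := B) (Eventually.of_forall fun x => by
        rw [norm_mul]
        exact mul_le_mul_of_nonneg_right (hB x) (norm_nonneg _))
  refine ⟨LinearMap.mkContinuous
    { toFun := fun u => (hmem u).toLp _
      map_add' := fun u v => Lp.ext ?_
      map_smul' := fun c u => Lp.ext ?_ } B fun u => ?_, fun u => (hmem u).coeFn_toLp⟩
  · filter_upwards [(hmem (u + v)).coeFn_toLp, (hmem u).coeFn_toLp, (hmem v).coeFn_toLp,
      Lp.coeFn_add u v, Lp.coeFn_add ((hmem u).toLp _) ((hmem v).toLp _)] with x h1 h2 h3 h4 h5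
    rw [h1, h5, Pi.add_apply, h2, h3, h4, Pi.add_apply, mul_add]
  · filter_upwards [(hmem (c • u)).coeFn_toLp, (hmem u).coeFn_toLp,
      Lp.coeFn_smul c u, Lp.coeFn_smul c ((hmem u).toLp _)] with x h1 h2 h3 h4
    simp only [RingHom.id_apply]
    rw [h1, h4, Pi.smul_apply, h2, h3, Pi.smul_apply, smul_eq_mul, smul_eq_mul]
    ring
  · refine Lp.norm_le_mul_norm_of_ae_le_mul ?_
    filter_upwards [(hmem u).coeFn_toLp] with x h1
    change ‖(hmem u).toLp _ x‖ ≤ _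
    rw [h1, norm_mul]
    exact mul_le_mul_of_nonneg_right (hB x) (norm_nonneg _)

/-- The weighted energy estimate for the relaxed form. -/
theorem abs_polar_le_weighted (hC : IsCoefficientMatrix C) {m : E d → ℝ} {R α : ℝ}
    (hm : IsWeight C m R) (hα : 0 ≤ α) {χ g : E d → ℝ} (hχ : IsLipc χ)
    (hg : Integrable g) (hχg : ∀ᵐ x, (expWeight α m x)⁻¹ * energyDensity C χ χ x ≤ g x)
    {δ : ℝ} (hδ : 0 < δ) {M : L d 2 →L[ℝ] L d 2}
    (hM : ∀ u, M u =ᵐ[volume] fun x => expWeight α m x * u x)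
    {χ' : L d 2} (hχ' : χ' =ᵐ[volume] χ) {u : L d 2} (hu : lscEnvelope (lipForm C) u ≠ ∞) :
    lscEnvelope (lipForm C) (M u) ≠ ∞ ∧
    |polar (lscEnvelope (lipForm C)) u χ'| ≤ δ * (polar (lscEnvelope (lipForm C)) u (M u) +
      2 * α ^ 2 * inner ℝ u (M u)) + (∫ x, g x) / (2 * δ) := by
  have hq := isQuadraticForm_lipForm hC
  obtain ⟨a, hafin, ha, hqa⟩ := exists_tendsto_lscEnvelope hu
  choose f hf haf using fun n => lipForm_ne_top_iff.1 (hafin n)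
  have hMa : ∀ n, M (a n) =ᵐ[volume] fun x => expWeight α m x * f n x := fun n => by
    filter_upwards [hM (a n), haf n] with x h1 h2
    rw [h1, h2]
  have hintg : ∀ n, ∫ x, f n x * f n x = inner ℝ (a n) (a n) := fun n => by
    rw [inner_eq_integral]
    refine integral_congr_ae ?_
    filter_upwards [haf n] with x hx
    rw [hx]
  have hintg' : ∀ n, ∫ x, f n x * (expWeight α m x * f n x) = inner ℝ (a n) (M (a n)) := fun n => by
    rw [inner_eq_integral]
    refine integral_congr_ae ?_
    filter_upwards [haf n, hMa n] with x hx hx'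
    rw [hx, hx']
  have hqr : ∀ n, (lipForm C (a n)).toReal = energy C (f n) (f n) := fun n => by
    rw [lipForm_eq (hf n) (haf n), ENNReal.toReal_ofReal (IsLipc.energy_nonneg hC _)]
  have hlim : Tendsto (fun n => Real.exp (2 * α * R) ^ 2 *
      (2 * energy C (f n) (f n) + 8 * α ^ 2 * ∫ x, f n x * f n x)) atTop
      (𝓝 (Real.exp (2 * α * R) ^ 2 * (2 * (lscEnvelope (lipForm C) u).toReal +
        8 * α ^ 2 * inner ℝ u u))) := by
    simp only [hintg, ← hqr]
    exact ((((ENNReal.tendsto_toReal hu).comp hqa).const_mul 2).add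
      ((ha.inner ha).const_mul _)).const_mul _
  obtain ⟨B, hB⟩ := hlim.bddAbove_range
  have hMlim : Tendsto (fun n => M (a n)) atTop (𝓝 (M u)) := (M.continuous.tendsto u).comp ha
  -- The weighted sequence M(a n) need not be a recovery sequence for M u; bounded energy is enough
  -- on this side of the polar form.
  obtain ⟨hfin, hp1⟩ := tendsto_polar_lscEnvelope hq ha hqa hafin hu hMlim (M := B) fun n => by
    rw [lipForm_eq (hm.isLipc_mul hα (hf n)) (hMa n)]
    exact ENNReal.ofReal_le_ofReal ((energy_mul_le hC hm hα (hf n)).trans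
      (hB (Set.mem_range_self n)))
  obtain ⟨-, hp2⟩ := tendsto_polar_lscEnvelope hq ha hqa hafin hu
    (tendsto_const_nhds (x := χ')) (M := energy C χ χ) fun _ => (lipForm_eq hχ hχ').le
  refine ⟨hfin, le_of_tendsto_of_tendsto' hp2.abs
    (((hp1.add ((ha.inner hMlim).const_mul (2 * α ^ 2))).const_mul δ).add_const _) fun n => ?_⟩
  rw [polar_lipForm hC (hf n) hχ (haf n) hχ',
    polar_lipForm hC (hf n) (hm.isLipc_mul hα (hf n)) (haf n) (hMa n), ← hintg']
  exact abs_energy_le_weighted hC hm hα (hf n) hχ hg hχg hδ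

end Weights

/-! ### Integrated estimates for the semigroup -/

section Evolution

variable {d : ℕ} {C : E d → Matrix (Fin d) (Fin d) ℝ}

/-- Differential inequalities for `F` and `G` that bound the increment of `G`. -/
theorem sub_le_of_deriv_right_le {F F' G G' : ℝ → ℝ} {K δ κ T : ℝ} (hT : 0 ≤ T)
    (hFc : Continuous F) (hGc : Continuous G) (hF0 : ∀ t, 0 ≤ F t) (hδ : 0 ≤ δ) (hK : 0 ≤ K)
    (hF : ∀ t, 0 ≤ t → HasDerivWithinAt F (F' t) (Set.Ici t) t)
    (hG : ∀ t, 0 ≤ t → HasDerivWithinAt G (G' t) (Set.Ici t) t)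
    (hF' : ∀ t, 0 ≤ t → F' t ≤ K * F t)
    (hG' : ∀ t, 0 ≤ t → G' t + δ * F' t ≤ δ * (K * F t) + κ) :
    G T - G 0 ≤ δ * (F 0 * Real.exp (K * T)) + κ * T := by
  have hFle : ∀ t ∈ Set.Icc 0 T, F t ≤ F 0 * Real.exp (K * t) := by
    intro t ht
    have h := le_gronwallBound_of_liminf_deriv_right_le (f := F) (f' := F') (δ := F 0) (K := K)
      (ε := 0) (a := 0) (b := T) hFc.continuousOn
      (fun x hx r hr => (hF x hx.1).liminf_right_slope_le hr) le_rfl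
      (fun x hx => by rw [add_zero]; exact hF' x hx.1) t ht
    rwa [gronwallBound_ε0, sub_zero] at h
  -- This function majorizes G + δF: its derivative is the right side of the hypothesis on G' + δF'
  -- with F replaced by its Gronwall bound.
  have hB : ∀ t, HasDerivAt (fun t => G 0 + δ * F 0 + (δ * (F 0 * (Real.exp (K * t) - 1)) + κ * t))
      (δ * (K * (F 0 * Real.exp (K * t))) + κ) t := by
    intro t
    have h1 : HasDerivAt (fun t => Real.exp (K * t)) (Real.exp (K * t) * (K * 1)) t :=
      ((hasDerivAt_id t).const_mul K).exp
    have h2 := ((((h1.sub_const 1).const_mul (F 0)).const_mul δ).add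
      ((hasDerivAt_id t).const_mul κ)).const_add (G 0 + δ * F 0)
    exact h2.congr_deriv (by ring)
  have h := image_le_of_deriv_right_le_deriv_boundary (f := fun t => G t + δ * F t)
    (f' := fun t => G' t + δ * F' t) (a := 0) (b := T)
    (hGc.add (hFc.const_mul δ)).continuousOn
    (fun t ht => (hG t ht.1).add ((hF t ht.1).const_mul δ))
    (B := fun t => G 0 + δ * F 0 + (δ * (F 0 * (Real.exp (K * t) - 1)) + κ * t))
    (by simp) (fun t _ => (hB t).continuousAt.continuousWithinAt)
    (fun t _ => (hB t).hasDerivWithinAt) (fun t ht => ?_) (Set.right_mem_Icc.2 hT)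
  · nlinarith [mul_nonneg hδ (hF0 T)]
  · refine (hG' t ht.1).trans ?_
    have := hFle t ⟨ht.1, ht.2.le⟩
    gcongr

theorem inner_mul_comm {w : E d → ℝ} {M : L d 2 →L[ℝ] L d 2}
    (hM : ∀ u, M u =ᵐ[volume] fun x => w x * u x) (u v : L d 2) :
    inner ℝ (M u) v = inner ℝ u (M v) := by
  rw [inner_eq_integral, inner_eq_integral]
  refine integral_congr_ae ?_
  filter_upwards [hM u, hM v] with x h1 h2
  rw [h1, h2]
  ring

theorem inner_mul_self_nonneg {w : E d → ℝ} (hw : ∀ x, 0 ≤ w x) {M : L d 2 →L[ℝ] L d 2}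
    (hM : ∀ u, M u =ᵐ[volume] fun x => w x * u x) (u : L d 2) : 0 ≤ inner ℝ u (M u) := by
  rw [inner_eq_integral]
  refine integral_nonneg_of_ae ?_
  filter_upwards [hM u] with x h1
  rw [h1, Pi.zero_apply]
  nlinarith [mul_nonneg (hw x) (mul_self_nonneg (u x))]

/-- With F = (U, wU) and G = ±(U, χ), the derivative of F is -2 times the polar form of U and wU.
Adding (δ/2)F to G therefore cancels exactly the energy term in the weighted estimate for G'. -/
theorem abs_inner_semigroup_sub_le_of_graph (hC : IsCoefficientMatrix C)
    {S : ℝ≥0 → L d 2 →L[ℝ] L d 2} (hS : IsFormSemigroup (lscEnvelope (lipForm C)) S)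
    {m : E d → ℝ} {R α : ℝ} (hm : IsWeight C m R) (hα : 0 ≤ α) {χ g : E d → ℝ} (hχ : IsLipc χ)
    (hg : Integrable g) (hχg : ∀ᵐ x, (expWeight α m x)⁻¹ * energyDensity C χ χ x ≤ g x)
    {δ : ℝ} (hδ : 0 < δ) {M : L d 2 →L[ℝ] L d 2}
    (hM : ∀ u, M u =ᵐ[volume] fun x => expWeight α m x * u x)
    {χ' : L d 2} (hχ' : χ' =ᵐ[volume] χ) {u f : L d 2}
    (huf : FormOperatorGraph (lscEnvelope (lipForm C)) u f) (T : ℝ≥0) :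
    |inner ℝ (S T u) χ' - inner ℝ u χ'| ≤
      δ / 2 * (inner ℝ u (M u) * Real.exp (4 * α ^ 2 * T)) + (∫ x, g x) / (2 * δ) * T := by
  let U : ℝ → L d 2 := fun t => S t.toNNReal u
  let V : ℝ → L d 2 := fun t => S t.toNNReal f
  have hU0 : U 0 = u := by simp [U, hS.zero]
  have hUc : Continuous U := hS.continuous_toNNReal u
  have hUd : ∀ t, 0 ≤ t → HasDerivWithinAt U (-(V t)) (Set.Ici t) t := fun t ht =>
    hS.hasDerivWithinAt huf ht
  have hgraph : ∀ t, FormOperatorGraph (lscEnvelope (lipForm C)) (U t) (V t) := fun t =>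
    hS.graph huf t.toNNReal
  have hχfin : lscEnvelope (lipForm C) χ' ≠ ∞ := ne_top_of_le_ne_top
    (lipForm_ne_top_iff.2 ⟨χ, hχ, hχ'⟩) (lscEnvelope_le _ _)
  have hzero : IsLipc fun _ : E d => (0 : ℝ) :=
    ⟨⟨0, LipschitzWith.const 0⟩, HasCompactSupport.zero⟩
  have hFd : ∀ t, 0 ≤ t → HasDerivWithinAt (fun t => inner ℝ (U t) (M (U t)))
      (-2 * inner ℝ (V t) (M (U t))) (Set.Ici t) t := by
    intro t ht
    have h := (hUd t ht).inner ℝ (M.hasFDerivAt.comp_hasDerivWithinAt t (hUd t ht))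
    refine h.congr_deriv ?_
    rw [map_neg, inner_neg_left, inner_neg_right, ← inner_mul_comm hM, real_inner_comm,
      Function.comp_apply]
    ring
  -- The weighted estimate with χ = 0, g = 0 and δ = 1, which amounts to F' ≤ 4α²F.
  have hweak : ∀ t, 0 ≤ inner ℝ (V t) (M (U t)) + 2 * α ^ 2 * inner ℝ (U t) (M (U t)) := by
    intro t
    obtain ⟨h1, h2⟩ := abs_polar_le_weighted hC hm hα hzero (integrable_zero (E d) ℝ volume)
      (Eventually.of_forall fun x => by simp [energyDensity, cInner, gradient]) one_pos hM
      (Lp.coeFn_zero ℝ 2 volume) (hgraph t).1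
    rw [(hgraph t).2 _ h1] at h2
    have h3 := (abs_nonneg _).trans h2
    simpa using h3
  have hstrong : ∀ t, |inner ℝ (V t) χ'| ≤ δ * (inner ℝ (V t) (M (U t)) +
      2 * α ^ 2 * inner ℝ (U t) (M (U t))) + (∫ x, g x) / (2 * δ) := by
    intro t
    obtain ⟨h1, h2⟩ := abs_polar_le_weighted hC hm hα hχ hg hχg hδ hM hχ' (hgraph t).1
    rwa [(hgraph t).2 _ h1, (hgraph t).2 _ hχfin] at h2
  have hGd : ∀ t, 0 ≤ t → HasDerivWithinAt (fun t => inner ℝ (U t) χ')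
      (-inner ℝ (V t) χ') (Set.Ici t) t := by
    intro t ht
    have h := (hUd t ht).inner ℝ (hasDerivWithinAt_const t (Set.Ici t) χ')
    refine h.congr_deriv ?_
    rw [inner_zero_right, inner_neg_left, zero_add]
  have hFc : Continuous fun t => (inner ℝ (U t) (M (U t)) : ℝ) :=
    hUc.inner (M.continuous.comp hUc)
  have hGc : Continuous fun t => (inner ℝ (U t) χ' : ℝ) := hUc.inner continuous_const
  have hF0 : ∀ t, 0 ≤ (inner ℝ (U t) (M (U t)) : ℝ) := fun t =>
    inner_mul_self_nonneg (fun x => (expWeight_pos α m x).le) hM (U t)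
  have h1 := sub_le_of_deriv_right_le T.2 hFc hGc hF0 (half_pos hδ).le
    (by positivity : 0 ≤ 4 * α ^ 2) hFd hGd (fun t _ => by linarith [hweak t])
    (κ := (∫ x, g x) / (2 * δ)) (fun t _ => by linarith [hstrong t, neg_abs_le (inner ℝ (V t) χ')])
  have h2 := sub_le_of_deriv_right_le T.2 hFc hGc.neg hF0 (half_pos hδ).le
    (by positivity : 0 ≤ 4 * α ^ 2) hFd (fun t ht => (hGd t ht).neg)
    (fun t _ => by linarith [hweak t])
    (κ := (∫ x, g x) / (2 * δ)) (fun t _ => by linarith [hstrong t, le_abs_self (inner ℝ (V t) χ')])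
  have hUT : U (T : ℝ) = S T u := by simp [U]
  simp only [NNReal.val_eq_coe, Pi.neg_apply, hU0, hUT] at h1 h2
  rw [abs_le]
  constructor <;> linarith

/-- The integrated estimate for the semigroup. -/
theorem abs_inner_semigroup_sub_le (hC : IsCoefficientMatrix C)
    {S : ℝ≥0 → L d 2 →L[ℝ] L d 2} (hS : IsFormSemigroup (lscEnvelope (lipForm C)) S)
    (hd : Dense {u | ∃ f, FormOperatorGraph (lscEnvelope (lipForm C)) u f})
    {m : E d → ℝ} {R α : ℝ} (hm : IsWeight C m R) (hα : 0 ≤ α) {χ g : E d → ℝ} (hχ : IsLipc χ)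
    (hg : Integrable g) (hχg : ∀ᵐ x, (expWeight α m x)⁻¹ * energyDensity C χ χ x ≤ g x)
    {δ : ℝ} (hδ : 0 < δ) {M : L d 2 →L[ℝ] L d 2}
    (hM : ∀ u, M u =ᵐ[volume] fun x => expWeight α m x * u x)
    {χ' : L d 2} (hχ' : χ' =ᵐ[volume] χ) (u : L d 2) (T : ℝ≥0) :
    |inner ℝ (S T u) χ' - inner ℝ u χ'| ≤
      δ / 2 * (inner ℝ u (M u) * Real.exp (4 * α ^ 2 * T)) + (∫ x, g x) / (2 * δ) * T := by
  refine isClosed_property hd.denseRange_val (p := fun u => |inner ℝ (S T u) χ' - inner ℝ u χ'| ≤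
      δ / 2 * (inner ℝ u (M u) * Real.exp (4 * α ^ 2 * T)) + (∫ x, g x) / (2 * δ) * T)
    (isClosed_le ?_ ?_) ?_ u
  · exact (((S T).continuous.inner continuous_const).sub
      (continuous_id.inner continuous_const)).abs
  · exact (continuous_const.mul ((continuous_id.inner M.continuous).mul continuous_const)).add
      continuous_const
  · rintro ⟨v, f, hf⟩
    exact abs_inner_semigroup_sub_le_of_graph hC hS hm hα hχ hg hχg hδ hM hχ' hf T

end Evolution

/-! ### Cut-off functions and conservation of mass -/

section Conservation

open Gradient

variable {d : ℕ} {C : E d → Matrix (Fin d) (Fin d) ℝ}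

/-- The truncated distance `min(ρ(|x|), R)`. -/
def truncDist (C : E d → Matrix (Fin d) (Fin d) ℝ) (R : ℝ) (x : E d) : ℝ := min (rho C ‖x‖) R

/-- The cut-off function with value `1` on `B_ρ(R)` and `0` off `B_ρ(R + 1)`. -/
def cutoff (C : E d → Matrix (Fin d) (Fin d) ℝ) (R : ℝ) (x : E d) : ℝ :=
  max 0 (min (R + 1 - rho C ‖x‖) 1)

theorem abs_truncDist_sub_le (R : ℝ) (x y : E d) :
    |truncDist C R y - truncDist C R x| ≤ |rho C ‖y‖ - rho C ‖x‖| := by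
  have := (LipschitzWith.id.min_const R).dist_le_mul (rho C ‖y‖) (rho C ‖x‖)
  rwa [NNReal.coe_one, one_mul, Real.dist_eq, Real.dist_eq] at this

theorem abs_cutoff_sub_le (R : ℝ) (x y : E d) :
    |cutoff C R y - cutoff C R x| ≤ |rho C ‖y‖ - rho C ‖x‖| := by
  have h := ((LipschitzWith.id.min_const 1).const_max 0).dist_le_mul
    (R + 1 - rho C ‖y‖) (R + 1 - rho C ‖x‖)
  rw [NNReal.coe_one, one_mul, Real.dist_eq, Real.dist_eq, sub_sub_sub_cancel_left,
    abs_sub_comm (rho C ‖x‖)] at h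
  exact h

theorem isWeight_truncDist (hC : IsCoefficientMatrix C) (R : ℝ) :
    IsWeight C (truncDist C R) R where
  lipschitz := lipschitz_of_abs_sub_le_rho hC (abs_truncDist_sub_le R)
  le _ := min_le_right _ _
  energyDensity_le := ae_energyDensity_le_one hC (abs_truncDist_sub_le R)

theorem cutoff_eq_one {R : ℝ} {x : E d} (hx : rho C ‖x‖ ≤ R) : cutoff C R x = 1 := by
  rw [cutoff, min_eq_right (by linarith), max_eq_right zero_le_one]

theorem cutoff_eq_zero {R : ℝ} {x : E d} (hx : R + 1 ≤ rho C ‖x‖) : cutoff C R x = 0 := by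
  rw [cutoff, max_eq_left]
  exact (min_le_left _ _).trans (by linarith)

theorem abs_cutoff_le_one (R : ℝ) (x : E d) : |cutoff C R x| ≤ 1 := by
  rw [cutoff, abs_of_nonneg (le_max_left _ _)]
  exact max_le zero_le_one (min_le_right _ _)

theorem isLipc_cutoff (hC : IsCoefficientMatrix C) (hvol : ∀ r, volume (rhoBall C r) ≠ ∞) (R : ℝ) :
    IsLipc (cutoff C R) := by
  refine ⟨⟨1, lipschitz_of_abs_sub_le_rho hC (abs_cutoff_sub_le R)⟩, ?_⟩
  obtain ⟨s, hs⟩ := exists_rhoBall_subset_closedBall hC (hvol (R + 1))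
  refine HasCompactSupport.intro (isCompact_closedBall 0 s) fun x hx => cutoff_eq_zero ?_
  by_contra! h
  exact hx (hs h)

theorem gradient_eq_zero_of_eventually_eq {f : E d → ℝ} {x : E d} {c : ℝ}
    (h : ∀ᶠ y in 𝓝 x, f y = c) : ∇ f x = 0 := by
  have h1 : f =ᶠ[𝓝 x] fun _ => c := h
  rw [gradient, h1.fderiv_eq, fderiv_const_apply, map_zero]

/-- The gradient of the cut-off vanishes unless R ≤ ρ ≤ R + 1, and there the truncated distance
equals R. The radius R + 2 makes the open ρ-ball contain the closed outer boundary. -/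
theorem ae_inv_expWeight_mul_energyDensity_cutoff_le (hC : IsCoefficientMatrix C) (R α : ℝ) :
    ∀ᵐ x, (expWeight α (truncDist C R) x)⁻¹ * energyDensity C (cutoff C R) (cutoff C R) x ≤
      (rhoBall C (R + 2)).indicator (fun _ => Real.exp (-(2 * α * R))) x := by
  have hcont : Continuous fun x : E d => rho C ‖x‖ := (lipschitzWith_rho_norm hC).continuous
  have hnonneg : ∀ x, 0 ≤ (rhoBall C (R + 2)).indicator (fun _ => Real.exp (-(2 * α * R))) x :=
    Set.indicator_nonneg fun _ _ => (Real.exp_pos _).le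
  filter_upwards [ae_energyDensity_le_one hC (abs_cutoff_sub_le R)] with x hx
  have hzero : ∇ (cutoff C R) x = 0 → (expWeight α (truncDist C R) x)⁻¹ *
      energyDensity C (cutoff C R) (cutoff C R) x ≤
      (rhoBall C (R + 2)).indicator (fun _ => Real.exp (-(2 * α * R))) x := by
    intro h
    rw [energyDensity, h]
    simpa [cInner] using hnonneg x
  rcases lt_or_ge (rho C ‖x‖) R with h1 | h1
  · exact hzero (gradient_eq_zero_of_eventually_eq
      ((hcont.continuousAt.eventually_lt_const h1).mono fun y hy => cutoff_eq_one hy.le))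
  rcases lt_or_ge (R + 1) (rho C ‖x‖) with h2 | h2
  · exact hzero (gradient_eq_zero_of_eventually_eq
      ((hcont.continuousAt.eventually_const_lt h2).mono fun y hy => cutoff_eq_zero hy.le))
  · have hmem : x ∈ rhoBall C (R + 2) := by
      change rho C ‖x‖ < R + 2
      linarith
    rw [Set.indicator_of_mem hmem, expWeight, truncDist, min_eq_right h1, ← Real.exp_neg]
    exact mul_le_of_le_one_right (Real.exp_pos _).le hx

theorem measurableSet_rhoBall (hC : IsCoefficientMatrix C) (r : ℝ) :
    MeasurableSet (rhoBall C r) :=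
  (isOpen_lt (lipschitzWith_rho_norm hC).continuous continuous_const).measurableSet

theorem volume_rhoBall_ne_top {a b : ℝ} (h : ∀ᶠ r : ℝ in atTop,
    volume (rhoBall C r) ≤ ENNReal.ofReal (a * Real.exp (b * r ^ 2))) (r : ℝ) :
    volume (rhoBall C r) ≠ ∞ := by
  obtain ⟨s, hs, hrs⟩ := (h.and (eventually_ge_atTop r)).exists
  refine ne_top_of_le_ne_top ENNReal.ofReal_ne_top ((measure_mono fun x hx => ?_).trans hs)
  exact lt_of_lt_of_le hx hrs

theorem inner_mul_expWeight_le {m : E d → ℝ} {α r : ℝ} (hα : 0 ≤ α) {M : L d 2 →L[ℝ] L d 2}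
    (hM : ∀ u, M u =ᵐ[volume] fun x => expWeight α m x * u x) {u : L d 2}
    (hu : ∀ᵐ x, u x ≠ 0 → m x ≤ r) :
    inner ℝ u (M u) ≤ Real.exp (2 * α * r) * ‖u‖ ^ 2 := by
  rw [← real_inner_self_eq_norm_sq, inner_eq_integral, inner_eq_integral, ← integral_const_mul]
  refine integral_mono_ae (integrable_mul_L2 _ _) ((integrable_mul_L2 _ _).const_mul _) ?_
  filter_upwards [hM u, hu] with x h1 h2
  rw [h1]
  rcases eq_or_ne (u x) 0 with h | h
  · simp [h]
  · have h3 : expWeight α m x ≤ Real.exp (2 * α * r) :=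
      Real.exp_le_exp.2 (mul_le_mul_of_nonneg_left (h2 h) (by positivity))
    nlinarith [mul_le_mul_of_nonneg_right h3 (mul_self_nonneg (u x))]

theorem tendsto_exp_neg_sq {c : ℝ} (hc : 0 < c) (k l : ℝ) :
    Tendsto (fun n : ℕ => Real.exp (-(c * (n : ℝ) ^ 2) + k * n + l)) atTop (𝓝 0) := by
  refine Real.tendsto_exp_atBot.comp (tendsto_atBot_add_const_right _ l ?_)
  have h1 : Tendsto (fun n : ℕ => -(c * (n : ℝ)) + k) atTop atBot :=
    tendsto_atBot_add_const_right _ k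
      (tendsto_neg_atTop_atBot.comp (tendsto_natCast_atTop_atTop.const_mul_atTop hc))
  refine (tendsto_natCast_atTop_atTop.atTop_mul_atBot₀ h1).congr fun n => ?_
  ring

/-- The mass escaping through the n-th annulus is bounded by two Gaussian terms in n. The first
gains from the small δ; the second competes with the volume growth, which is where the restriction
on T enters. -/
theorem tendsto_inner_cutoff_sub (hC : IsCoefficientMatrix C)
    {S : ℝ≥0 → L d 2 →L[ℝ] L d 2} (hS : IsFormSemigroup (lscEnvelope (lipForm C)) S)
    (hd : Dense {u | ∃ f, FormOperatorGraph (lscEnvelope (lipForm C)) u f})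
    {a b : ℝ} (hgrowth : ∀ᶠ r : ℝ in atTop,
      volume (rhoBall C r) ≤ ENNReal.ofReal (a * Real.exp (b * r ^ 2))) (ha : 0 < a)
    {T : ℝ≥0} (hT : 0 < T) (hTb : b < 1 / (8 * (T : ℝ)))
    {u : L d 2} {r : ℝ} (hu : ∀ᵐ x, u x ≠ 0 → rho C ‖x‖ ≤ r) {χ : ℕ → L d 2}
    (hχ : ∀ n, χ n =ᵐ[volume] cutoff C n) :
    Tendsto (fun n => inner ℝ (S T u) (χ n) - inner ℝ u (χ n)) atTop (𝓝 0) := by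
  have hvol := volume_rhoBall_ne_top hgrowth
  have hT' : (0 : ℝ) < T := hT
  have hlim : Tendsto (fun n : ℕ =>
      ‖u‖ ^ 2 / 2 * Real.exp (-(1 / (8 * (T : ℝ)) * (n : ℝ) ^ 2) + r / (2 * T) * n + 0) +
      a * T / 2 * Real.exp (-((1 / (8 * (T : ℝ)) - b) * (n : ℝ) ^ 2) + 4 * b * n + 4 * b))
      atTop (𝓝 (‖u‖ ^ 2 / 2 * 0 + a * T / 2 * 0)) :=
    ((tendsto_exp_neg_sq (by positivity) _ _).const_mul _).add
      ((tendsto_exp_neg_sq (sub_pos.2 hTb) _ _).const_mul _)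
  rw [mul_zero, mul_zero, add_zero] at hlim
  refine squeeze_zero_norm' ?_ hlim
  have hshift : Tendsto (fun n : ℕ => (n : ℝ) + 2) atTop atTop :=
    tendsto_atTop_add_const_right _ 2 tendsto_natCast_atTop_atTop
  filter_upwards [hshift.eventually hgrowth] with n hn
  -- This α minimizes 4α²T - 2αn. The δ balances the factors δe^{4α²T} and δ⁻¹e^{-2αn}: both become
  -- e^{-n²/(8T)}, which beats e^{b(n+2)²} when b < 1/(8T).
  set α : ℝ := n / (4 * T) with hα
  set δ : ℝ := Real.exp (-(3 / (8 * T) * (n : ℝ) ^ 2)) with hδ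
  have hα0 : 0 ≤ α := by positivity
  have hw := isWeight_truncDist hC (n : ℝ)
  obtain ⟨K, hK⟩ := hw.lipschitz_expWeight hα0
  obtain ⟨M, hM⟩ := exists_mul_L2 hK.continuous (hw.abs_expWeight_le hα0)
  have hg : Integrable ((rhoBall C ((n : ℝ) + 2)).indicator
      fun _ => Real.exp (-(2 * α * n))) volume :=
    (integrable_indicator_iff (measurableSet_rhoBall hC _)).2
      (integrableOn_const (hvol _))
  have h := abs_inner_semigroup_sub_le hC hS hd hw hα0 (isLipc_cutoff hC hvol n) hg
    (ae_inv_expWeight_mul_energyDensity_cutoff_le hC n α) (Real.exp_pos _ : 0 < δ) hM (hχ n) u T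
  have hintg : ∫ x, (rhoBall C ((n : ℝ) + 2)).indicator (fun _ => Real.exp (-(2 * α * n))) x ≤
      a * Real.exp (b * ((n : ℝ) + 2) ^ 2) * Real.exp (-(2 * α * n)) := by
    rw [integral_indicator_const _ (measurableSet_rhoBall hC _), smul_eq_mul]
    refine mul_le_mul_of_nonneg_right ?_ (Real.exp_pos _).le
    exact ENNReal.toReal_le_of_le_ofReal (by positivity) hn
  have hin := inner_mul_expWeight_le hα0 hM (u := u) (r := r)
    (hu.mono fun x hx h => (min_le_left _ _).trans (hx h))
  rw [Real.norm_eq_abs]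
  refine h.trans (add_le_add ?_ ?_)
  · calc δ / 2 * (inner ℝ u (M u) * Real.exp (4 * α ^ 2 * T))
        ≤ δ / 2 * (Real.exp (2 * α * r) * ‖u‖ ^ 2 * Real.exp (4 * α ^ 2 * T)) := by
          gcongr
      _ = ‖u‖ ^ 2 / 2 * (δ * Real.exp (2 * α * r) * Real.exp (4 * α ^ 2 * T)) := by ring
      _ = _ := by
          rw [hδ, ← Real.exp_add, ← Real.exp_add, hα]
          congr 2
          field_simp
          ring
  · calc (∫ x, (rhoBall C ((n : ℝ) + 2)).indicator (fun _ => Real.exp (-(2 * α * n))) x) /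
          (2 * δ) * T
        ≤ a * Real.exp (b * ((n : ℝ) + 2) ^ 2) * Real.exp (-(2 * α * n)) / (2 * δ) * T := by
          gcongr
      _ = a * T / 2 * (Real.exp (b * ((n : ℝ) + 2) ^ 2) * Real.exp (-(2 * α * n)) * δ⁻¹) := by
          ring
      _ = _ := by
          rw [hδ, ← Real.exp_neg, ← Real.exp_add, ← Real.exp_add, hα]
          congr 2
          field_simp
          ring

theorem tendsto_integral_cutoff_mul (hC : IsCoefficientMatrix C) {g : E d → ℝ}
    (hg : Integrable g) :
    Tendsto (fun n : ℕ => ∫ x, cutoff C n x * g x) atTop (𝓝 (∫ x, g x)) := by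
  refine tendsto_integral_of_dominated_convergence (fun x => ‖g x‖)
    (fun n => ((lipschitz_of_abs_sub_le_rho hC
      (abs_cutoff_sub_le n)).continuous.aestronglyMeasurable.mul hg.1)) hg.norm
    (fun n => Eventually.of_forall fun x => ?_) (Eventually.of_forall fun x => ?_)
  · rw [norm_mul]
    exact mul_le_of_le_one_left (norm_nonneg _) (abs_cutoff_le_one _ x)
  · refine tendsto_const_nhds.congr' ?_
    filter_upwards [tendsto_natCast_atTop_atTop.eventually_ge_atTop (rho C ‖x‖)] with n hn
    rw [cutoff_eq_one hn, one_mul]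

/-- For small times the `L_∞`-extension of the semigroup preserves `1`. -/
theorem linftyExtension_one_eq (hC : IsCoefficientMatrix C)
    {S : ℝ≥0 → L d 2 →L[ℝ] L d 2} (hS : IsFormSemigroup (lscEnvelope (lipForm C)) S)
    (hd : Dense {u | ∃ f, FormOperatorGraph (lscEnvelope (lipForm C)) u f})
    (hsym : ∀ t u v, inner ℝ (S t u) v = inner ℝ u (S t v))
    {a b : ℝ} (hgrowth : ∀ᶠ r : ℝ in atTop,
      volume (rhoBall C r) ≤ ENNReal.ofReal (a * Real.exp (b * r ^ 2))) (ha : 0 < a)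
    {t : ℝ≥0} (ht : 0 < t) (htb : b < 1 / (8 * (t : ℝ)))
    {T : L d ∞ →L[ℝ] L d ∞} (hT : IsLinftyExtension (S t) T) :
    T (oneLinfty d) = oneLinfty d := by
  have hvol := volume_rhoBall_ne_top hgrowth
  refine Lp.ext (ae_eq_of_integral_contDiff_smul_eq ((Lp.memLp _).locallyIntegrable le_top)
    ((Lp.memLp _).locallyIntegrable le_top) fun η hη hηc => ?_)
  have hη2 : MemLp η 2 (volume : Measure (E d)) :=
    hη.continuous.memLp_of_hasCompactSupport hηc
  have hη1 : MemLp η 1 (volume : Measure (E d)) :=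
    hη.continuous.memLp_of_hasCompactSupport hηc
  set u : L d 2 := hη2.toLp η
  set χ : ℕ → L d 2 := fun n => ((isLipc_cutoff hC hvol n).memLp 2).toLp _
  set χ' : ℕ → L d ∞ := fun n => ((isLipc_cutoff hC hvol n).memLp ∞).toLp _
  have hχ : ∀ n, χ n =ᵐ[volume] cutoff C n := fun n => MemLp.coeFn_toLp _
  have hχ' : ∀ n, χ' n =ᵐ[volume] cutoff C n := fun n => MemLp.coeFn_toLp _
  have hu : u =ᵐ[volume] η := MemLp.coeFn_toLp _
  have hηL1 := hη1.coeFn_toLp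
  obtain ⟨g, hg⟩ := hT.weakStar (hη1.toLp η)
  -- The integrable function g represents the pairing of T(·) with η. Replacing 1 by cut-offs makes
  -- both functions square integrable, so symmetry turns the pairing into (S_t u, χ_n), which
  -- differs from (u, χ_n) by a null sequence.
  have h1 : Tendsto (fun n => ∫ x, χ' n x * g x) atTop
      (𝓝 (∫ x, η x • (T (oneLinfty d) : E d → ℝ) x)) := by
    have e : ∫ x, η x • (T (oneLinfty d) : E d → ℝ) x = ∫ x, g x := by
      calc ∫ x, η x • (T (oneLinfty d) : E d → ℝ) x
          = ∫ x, T (oneLinfty d) x * hη1.toLp η x := by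
            refine integral_congr_ae ?_
            filter_upwards [hηL1] with x hx
            rw [hx, smul_eq_mul, mul_comm]
        _ = ∫ x, oneLinfty d x * g x := hg _
        _ = ∫ x, g x := by
            refine integral_congr_ae ?_
            filter_upwards [coeFn_oneLinfty (d := d)] with x hx
            rw [hx, one_mul]
    rw [e]
    refine (tendsto_integral_cutoff_mul hC (memLp_one_iff_integrable.1 (Lp.memLp g))).congr
      fun n => integral_congr_ae ?_
    filter_upwards [hχ' n] with x hx
    rw [hx]
  have h2 : ∀ n, ∫ x, χ' n x * g x = inner ℝ (S t u) (χ n) := by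
    intro n
    rw [← hg, hsym, real_inner_comm, inner_eq_integral]
    refine integral_congr_ae ?_
    filter_upwards [hT.agrees (χ n) (χ' n) ((hχ n).trans (hχ' n).symm), hηL1, hu] with x h3 h4 h5
    rw [h3, h4, h5]
  have h3 : Tendsto (fun n => inner ℝ u (χ n)) atTop (𝓝 (∫ x, η x)) := by
    refine (tendsto_integral_cutoff_mul hC (memLp_one_iff_integrable.1 hη1)).congr fun n => ?_
    rw [real_inner_comm, inner_eq_integral]
    refine integral_congr_ae ?_
    filter_upwards [hχ n, hu] with x h4 h5
    rw [h4, h5]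
  obtain ⟨r, hr⟩ := (hηc.image (lipschitzWith_rho_norm hC).continuous).bddAbove
  have h4 := tendsto_inner_cutoff_sub hC hS hd hgrowth ha ht htb (u := u) (r := r)
    (hu.mono fun x hx hne => hr ⟨x, subset_tsupport η (by rwa [hx] at hne), rfl⟩) hχ
  have h5 := h4.add h3
  simp only [sub_add_cancel, zero_add, ← h2] at h5
  rw [tendsto_nhds_unique h1 h5]
  refine integral_congr_ae ?_
  filter_upwards [coeFn_oneLinfty (d := d)] with x hx
  rw [hx, smul_eq_mul, mul_one]

theorem isClosedForm_lscEnvelope_lipForm (hC : IsCoefficientMatrix C) :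
    IsClosedForm (lscEnvelope (lipForm C)) :=
  isClosedForm_of_lowerSemicontinuous (isQuadraticForm_lscEnvelope (isQuadraticForm_lipForm hC))
    (lowerSemicontinuous_lscEnvelope _)

theorem dense_lscEnvelope_lipForm (C : E d → Matrix (Fin d) (Fin d) ℝ) :
    Dense {u | lscEnvelope (lipForm C) u ≠ ∞} :=
  (dense_lipForm C).mono fun _ hu => ne_top_of_le_ne_top hu (lscEnvelope_le _ _)

/-- The growth constant b admits only times below 1/(8b). A general t is split into n > 8bt equal
steps, and both the extension and the preservation of 1 pass to compositions. -/
theorem IsFormSemigroup.isConservative (hC : IsCoefficientMatrix C) (hgrowth : TikhonovGrowth C)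
    {S : ℝ≥0 → L d 2 →L[ℝ] L d 2} (hS : IsFormSemigroup (lscEnvelope (lipForm C)) S) :
    IsConservative S := by
  have hcl := isClosedForm_lscEnvelope_lipForm hC
  have hd := dense_graph hcl (dense_lscEnvelope_lipForm C)
  -- Symmetry is not part of the definition of the semigroup; it comes from the constructed one by
  -- uniqueness.
  have hsym : ∀ t u v, inner ℝ (S t u) v = inner ℝ u (S t v) := by
    obtain ⟨S', hS', hsym'⟩ := exists_formSemigroup hcl (dense_lscEnvelope_lipForm C)
    rw [hS.unique hcl.toIsQuadraticForm hd hS']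
    exact hsym'
  obtain ⟨a, b, ha, hb, hab⟩ := hgrowth
  intro t ht
  obtain ⟨n, hn⟩ := exists_nat_gt (8 * b * t)
  have hn0 : (0 : ℝ) < n := lt_of_le_of_lt (by positivity) hn
  have hs : 0 < t / n := div_pos ht (by exact_mod_cast hn0)
  have hsb : b < 1 / (8 * ((t / n : ℝ≥0) : ℝ)) := by
    have ht' : (0 : ℝ) < t := ht
    rw [NNReal.coe_div, NNReal.coe_natCast, lt_div_iff₀ (by positivity)]
    calc b * (8 * (t / n)) = 8 * b * t / n := by ring
      _ < 1 := (div_lt_one hn0).2 hn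
  obtain ⟨T, hT⟩ := exists_isLinftyExtension (hsym (t / n))
    (fun u hu => hS.apply_nonneg hC hd _ hu) (fun u c hu => hS.ae_abs_le hC hd _ hu)
  have hT1 := linftyExtension_one_eq hC hS hd hsym hab ha hs hsb hT
  have key : ∀ k : ℕ, ∃ T : L d ∞ →L[ℝ] L d ∞, IsLinftyExtension (S (k * (t / n))) T ∧
      T (oneLinfty d) = oneLinfty d := by
    intro k
    induction k with
    | zero => exact ⟨_, by rw [Nat.cast_zero, zero_mul, hS.zero]; exact IsLinftyExtension.id, rfl⟩
    | succ k ih =>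
      obtain ⟨U, hU, hU1⟩ := ih
      refine ⟨U.comp T, ?_, ?_⟩
      · rw [Nat.cast_succ, add_mul, one_mul, hS.add]
        exact hU.comp hT
      · rw [ContinuousLinearMap.comp_apply, hT1, hU1]
  have h := key n
  rwa [mul_div_cancel₀ t (by exact_mod_cast hn0.ne')] at h

end Conservation

end DegenerateElliptic

end

theorem theorem3p1 (d : ℕ)
    (C : DegenerateElliptic.E d → Matrix (Fin d) (Fin d) ℝ)
    (hC : DegenerateElliptic.IsCoefficientMatrix C)
    (hgrowth : DegenerateElliptic.TikhonovGrowth C) :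
    ∃ h₀ : DegenerateElliptic.L d 2 → ENNReal,
      DegenerateElliptic.IsRelaxation (DegenerateElliptic.form C) h₀ ∧
      (∃ S, DegenerateElliptic.IsFormSemigroup h₀ S) ∧
      ∀ S, DegenerateElliptic.IsFormSemigroup h₀ S → DegenerateElliptic.IsConservative S := by
  have hcl := DegenerateElliptic.isClosedForm_lscEnvelope_lipForm hC
  obtain ⟨S, hS, -⟩ := DegenerateElliptic.exists_formSemigroup hcl
    (DegenerateElliptic.dense_lscEnvelope_lipForm C)
  exact ⟨_, DegenerateElliptic.isRelaxation_form hC, ⟨S, hS⟩,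
    fun _ hS' => hS'.isConservative hC hgrowth⟩
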